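/- **Conventions.** Words are finite words over $\{0,1\}$. A decision problem is a set of words; an enumeration problem $E$ assigns to every word $x$ a set $E(x)$ of words (its solutions). The machines are random access machines with unit-cost steps (constants, addition, truncated subtraction, halving, indirect addressing, conditional jumps); on inputs $x$ all their register contents are required to have at most $p(|x|)$ binary digits for some polynomial $p$. An oracle machine has in addition an infinite sequence of query registers, into which it writes a word symbol by symbol, and one answer register, in which the answer appears in one step. - An oracle for a decision problem $L$ answers whether the submitted word is in $L$. An oracle for an enumeration problem $E$, asked a word $w$, answers with an arbitrary element of $E(w)$ that it has not yet given as an answer to $w$ in the current run, and with a special symbol $\bot$ if there is none left. - A machine enumerates an enumeration problem $B$ with polynomial delay if there is a polynomial $p$ such that, on every input $x$, it outputs exactly the elements of $B(x)$, each exactly once, and the time before the first output, between any two consecutive outputs, and between the last output and halting is at most $p(|x|)$. It is oracle-bounded if all oracle queries on input $x$ have length at most $p(|x|)$. - For a class $C$ of decision problems, $\mathrm{Del}C$ is the class of all enumeration problems that are enumerated with polynomial delay by an oracle-bounded machine with an oracle for some $L\in C$. - $B$ reduces to $E$ via D-reductions, $B\le_D E$, if there is an oracle-bounded machine that, with an oracle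 for the enumeration problem $E$, enumerates $B$ with polynomial delay, for every order in which the oracle may give its answers (with the same polynomial). $E$ is $\mathcal D$-hard under D-reductions if $B\le_D E$ for all $B\in\mathcal D$. - $\Sigma_k^p$ is the $k$-th level of the polynomial hierarchy ($\Sigma_0^p=\mathrm P$); a decision problem is $\Sigma_k^p$-hard if every problem in $\Sigma_k^p$ reduces to it by a polynomial-time many-one reduction. **Theorem.** Let $k\ge 0$, let $A$ be a $\Sigma_k^p$-hard decision problem, and let $E$ be an enumeration problem such that $A$ can be decided in polynomial time by a machine with access to an oracle for $E$ (correctly and within the time bound for every order of the oracle's answers). Then $E$ is $\mathrm{Del}\Sigma_k^p$-hard under D-reductions. -/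

import Mathlib

namespace EnumComplexity

/-- Words over the alphabet `{0, 1}`. -/
abbrev Word := List Bool

/-- A decision problem: the set of its yes-instances. -/
abbrev DecProblem := Set Word

/-- An enumeration problem: it assigns to every input the set of its solutions. -/
abbrev EnumProblem := Word → Set Word

/-! ### Random access machines with an oracle -/

/-- Instructions of a random access machine. `R` stands for the work registers, which hold natural
numbers. A machine also has read-only input cells, an infinite sequence of query registers (one
symbol per register), one answer register, and a write-only output medium. -/
inductive Instr where
  /-- `R i := n` -/
  | const (i n : ℕ)
  /-- `R i := R j + R k` -/
  | add (i j k : ℕ)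
  /-- `R i := R j - R k`, truncated at `0` -/
  | sub (i j k : ℕ)
  /-- `R i := ⌊R j / 2⌋` -/
  | half (i j : ℕ)
  /-- indirect read: `R i := R (R j)` -/
  | load (i j : ℕ)
  /-- indirect write: `R (R i) := R j` -/
  | store (i j : ℕ)
  /-- go to instruction `l` -/
  | jump (l : ℕ)
  /-- if `R i = 0` go to instruction `l` -/
  | jumpZero (i l : ℕ)
  /-- `R i :=` content of the input cell with address `R j` -/
  | input (i j : ℕ)
  /-- write the symbol with code `R j` into the query register with address `R i` -/
  | ask (i j : ℕ)
  /-- submit the word in the query registers to the oracle -/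
  | query
  /-- `R i :=` content of the answer register -/
  | answer (i : ℕ)
  /-- append the bit with code `R i` to the word that is being printed -/
  | print (i : ℕ)
  /-- the word printed so far is complete: it is output, and a new word is begun -/
  | output

/-- A program; the machine halts when the program counter leaves the program. -/
abbrev Program := List Instr

/-- Codes of symbols in registers: blank is `0`, the bit `0` is `1`, the bit `1` is `2`. -/
def symbolCode : Option Bool → ℕ
  | none => 0
  | some false => 1
  | some true => 2

/-- The symbol with a given code (numbers above `2` are read as `2`). -/
def codeSymbol : ℕ → Option Bool
  | 0 => none
  | 1 => some false
  | _ => some true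

/-- A word as the content of a single register: the binary number whose digits, from the lowest
one on, are the letters of the word, followed by a highest digit `1`. In particular it is not `0`. -/
def wordCode (w : Word) : ℕ :=
  w.foldr (fun b a => 2 * a + b.toNat) 1

/-- Oracles: `O w j` is the content of the answer register when the word `w` is submitted and has
been submitted exactly `j` times before in the run. -/
abbrev Oracle := Word → ℕ → ℕ

structure Config where
  /-- program counter -/
  pc : ℕ
  /-- work registers -/
  reg : ℕ → ℕ
  /-- query registers (`none` is blank) -/
  qreg : ℕ → Option Bool
  /-- answer register -/
  ans : ℕ
  /-- how often each word has been submitted to the oracle so far -/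
  asked : Word → ℕ
  /-- the word that is being printed -/
  out : Word

/-- The initial configuration: all registers are zero or blank. -/
def startConfig : Config where
  pc := 0
  reg := fun _ => 0
  qreg := fun _ => none
  ans := 0
  asked := fun _ => 0
  out := []

/-- The word in the query registers: the symbols before the first blank. (In a run only finitely
many query registers are not blank.) -/
noncomputable def Config.queryWord (c : Config) : Word :=
  (List.range (sInf {i : ℕ | c.qreg i = none})).map fun i => (c.qreg i).getD false

/-- Move on to the next instruction. -/
def Config.next (c : Config) : Config :=
  { c with pc := c.pc + 1 }

/-- Set a work register and move on to the next instruction. -/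
def Config.set (c : Config) (i v : ℕ) : Config :=
  { c with pc := c.pc + 1, reg := Function.update c.reg i v }

/-- The effect of one instruction on input `x` with oracle `O`. -/
noncomputable def Instr.exec (O : Oracle) (x : Word) (c : Config) : Instr → Config
  | .const i n => c.set i n
  | .add i j k => c.set i (c.reg j + c.reg k)
  | .sub i j k => c.set i (c.reg j - c.reg k)
  | .half i j => c.set i (c.reg j / 2)
  | .load i j => c.set i (c.reg (c.reg j))
  | .store i j => c.set (c.reg i) (c.reg j)
  | .jump l => { c with pc := l }
  | .jumpZero i l => if c.reg i = 0 then { c with pc := l } else c.next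
  | .input i j => c.set i (symbolCode x[c.reg j]?)
  | .ask i j => { c.next with qreg := Function.update c.qreg (c.reg i) (codeSymbol (c.reg j)) }
  | .query =>
      { c.next with
        ans := O c.queryWord (c.asked c.queryWord)
        asked := Function.update c.asked c.queryWord (c.asked c.queryWord + 1) }
  | .answer i => c.set i c.ans
  | .print i => { c.next with out := c.out ++ (codeSymbol (c.reg i)).toList }
  | .output => { c.next with out := [] }

/-- One step of the machine; a halted machine stays as it is. -/
noncomputable def step (M : Program) (O : Oracle) (x : Word) (c : Config) : Config :=
  match M[c.pc]? with
  | none => c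
  | some I => I.exec O x c

/-- The configuration after `t` steps on input `x`. -/
noncomputable def run (M : Program) (O : Oracle) (x : Word) (t : ℕ) : Config :=
  (step M O x)^[t] startConfig

/-- The machine has halted after at most `t` steps. -/
def HaltedAt (M : Program) (O : Oracle) (x : Word) (t : ℕ) : Prop :=
  M[(run M O x t).pc]? = none

/-- The instruction executed after `t` steps outputs the word `y`. -/
def OutputsAt (M : Program) (O : Oracle) (x : Word) (t : ℕ) (y : Word) : Prop :=
  M[(run M O x t).pc]? = some Instr.output ∧ (run M O x t).out = y

/-- The instruction executed after `t` steps submits the word `w` to the oracle. -/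
def QueriesAt (M : Program) (O : Oracle) (x : Word) (t : ℕ) (w : Word) : Prop :=
  M[(run M O x t).pc]? = some Instr.query ∧ (run M O x t).queryWord = w

/-- Throughout the run, all register contents have at most `d` binary digits. Steps have unit cost,
so this is the usual condition that keeps a random access machine from computing with numbers that
are too long. -/
def RegistersBounded (M : Program) (O : Oracle) (x : Word) (d : ℕ) : Prop :=
  ∀ t, (∀ i, ((run M O x t).reg i).size ≤ d) ∧ (run M O x t).ans.size ≤ d

/-- On input `x` the machine enumerates the set `S` without repetitions with delay at most `d`: the
time before the first output, between two consecutive outputs, and between the last output and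
halting is at most `d`. Register contents and oracle queries are bounded by `d` as well. -/
def EnumeratesWithin (M : Program) (O : Oracle) (x : Word) (S : Set Word) (d : ℕ) : Prop :=
  (∀ y, y ∈ S ↔ ∃ t, OutputsAt M O x t y) ∧
  (∀ t t' y, OutputsAt M O x t y → OutputsAt M O x t' y → t = t') ∧
  (∀ t, ∃ s, t ≤ s ∧ s ≤ t + d ∧ (HaltedAt M O x s ∨ ∃ y, OutputsAt M O x s y)) ∧
  (∀ t w, QueriesAt M O x t w → w.length ≤ d) ∧
  RegistersBounded M O x d

/-- On input `x` the machine halts within `d` steps, and it accepts (the register `R 0` is not `0`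
in the end) if and only if `accept` holds. -/
def DecidesWithin (M : Program) (O : Oracle) (x : Word) (accept : Prop) (d : ℕ) : Prop :=
  HaltedAt M O x d ∧ (accept ↔ (run M O x d).reg 0 ≠ 0) ∧ RegistersBounded M O x d

/-- On input `x` the machine halts within `d` steps, having printed the word `y`. -/
def ComputesWithin (M : Program) (O : Oracle) (x : Word) (y : Word) (d : ℕ) : Prop :=
  HaltedAt M O x d ∧ (run M O x d).out = y ∧ RegistersBounded M O x d

/-! ### Kinds of oracles -/

/-- The trivial oracle, which always answers `0`; machines with it are machines without oracle. -/
def noOracle : Oracle := fun _ _ => 0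

open Classical in
/-- The oracle for a decision problem. -/
noncomputable def decOracle (L : DecProblem) : Oracle :=
  fun w _ => if w ∈ L then 1 else 0

/-- An order in which an oracle for the enumeration problem `E` gives its answers: `a w j` is the
answer if `w` has been asked `j` times before. As long as there are solutions that were not given
before, the answer is one of them; otherwise it is the special symbol `none`. -/
def IsAnswerOrder (E : EnumProblem) (a : Word → ℕ → Option Word) : Prop :=
  ∀ w j,
    ((∃ y ∈ E w, ∀ i < j, a w i ≠ some y) →
      ∃ y ∈ E w, (∀ i < j, a w i ≠ some y) ∧ a w j = some y) ∧
    ((¬ ∃ y ∈ E w, ∀ i < j, a w i ≠ some y) → a w j = none)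

/-- The oracle for an enumeration problem with a given order of answers; the special symbol is
represented by `0`. -/
def enumOracle (a : Word → ℕ → Option Word) : Oracle :=
  fun w j => match a w j with
    | none => 0
    | some y => wordCode y

/-! ### Decision complexity classes -/

/-- The class P. -/
def classP : Set DecProblem :=
  {L | ∃ (M : Program) (p : Polynomial ℕ), ∀ x,
    DecidesWithin M noOracle x (x ∈ L) (p.eval x.length)}

/-- Encoding of pairs of words by words. -/
def pairWord (x y : Word) : Word :=
  (x.flatMap fun b => [true, b]) ++ false :: y

/-- The classes `Σₖᵖ` of the polynomial hierarchy: `Σ₀ᵖ = P`, and `L ∈ Σₖ₊₁ᵖ` if membership in `L`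
is a polynomially bounded existential quantifier in front of a `Πₖᵖ` predicate, where `Πₖᵖ` consists
of the complements of the problems in `Σₖᵖ`. -/
def SigmaP : ℕ → Set DecProblem
  | 0 => classP
  | k + 1 => {L | ∃ K : DecProblem, Kᶜ ∈ SigmaP k ∧ ∃ p : Polynomial ℕ, ∀ x,
      x ∈ L ↔ ∃ y : Word, y.length ≤ p.eval x.length ∧ pairWord x y ∈ K}

/-- Polynomial time many-one reducibility. -/
def PolyManyOneReducible (L A : DecProblem) : Prop :=
  ∃ f : Word → Word,
    (∃ (M : Program) (p : Polynomial ℕ), ∀ x,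
      ComputesWithin M noOracle x (f x) (p.eval x.length)) ∧
    ∀ x, x ∈ L ↔ f x ∈ A

/-- Hardness of a decision problem for a class under polynomial time many-one reductions. -/
def IsHard (C : Set DecProblem) (A : DecProblem) : Prop :=
  ∀ L ∈ C, PolyManyOneReducible L A

/-- `A` can be decided in polynomial time by a machine with access to an oracle for the enumeration
problem `E`, whatever the order of the oracle's answers. -/
def DecidableInPolyTimeWith (A : DecProblem) (E : EnumProblem) : Prop :=
  ∃ (M : Program) (p : Polynomial ℕ), ∀ a, IsAnswerOrder E a → ∀ x,
    DecidesWithin M (enumOracle a) x (x ∈ A) (p.eval x.length)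

/-! ### Enumeration complexity classes -/

/-- The class `Del C`: the problems that can be enumerated with polynomial delay by a random access
machine with an oracle from `C` and polynomially bounded oracle queries. -/
def Del (C : Set DecProblem) : Set EnumProblem :=
  {B | ∃ L ∈ C, ∃ (M : Program) (p : Polynomial ℕ), ∀ x,
    EnumeratesWithin M (decOracle L) x (B x) (p.eval x.length)}

/-- `B` reduces to `E` via D-reductions: an oracle-bounded enumeration oracle machine enumerates `B`
with polynomial delay using an oracle for `E`, whatever the order of the oracle's answers. -/
def DReducible (B E : EnumProblem) : Prop :=
  ∃ (M : Program) (p : Polynomial ℕ), ∀ a, IsAnswerOrder E a → ∀ x,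
    EnumeratesWithin M (enumOracle a) x (B x) (p.eval x.length)

/-- Hardness of an enumeration problem for a class under D-reductions. -/
def IsDHard (D : Set EnumProblem) (E : EnumProblem) : Prop :=
  ∀ B ∈ D, DReducible B E

end EnumComplexity

namespace EnumComplexity

/-! ### Segments of runs -/

/-! Let `M` enumerate `B` with an oracle for `L`, let `F` compute a reduction of `L` to `A`, and let
`D` decide `A` with an oracle for `E`. The reducing machine runs `M` and replaces each query `w` to
`L` by a run of `F` on `w`, followed by a run of `D` on the result. Queries of `M` have polynomial
length, so each step of `M` costs polynomial time and the delay stays polynomial. Of the polynomial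
hierarchy only the reducibility of `L` to `A` matters.

The difficulty is that the oracle for `E` has a memory. What it answered during one run of `D` it
will not answer again in a later run, while `D` is only known to be correct with an oracle that
starts afresh. Hence all answers are kept in a cache, indexed by the word and the number of earlier
submissions. A query of `D` is answered from the cache, and the true oracle is asked only if the
entry is missing. Every run of `D` then sees one and the same oracle from its beginning
(`exec_fetch`, `exec_cachedQuery`). The cache may become exponentially large, but indirect
addressing only needs addresses with polynomially many digits, as `cacheAddr` provides.

The memory of `F` and `D` must also look empty at the start of each run. Nothing is cleared: entries
carry a stamp with the number of the run in which they were written, the epoch, and count as `0` if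
the stamp is outdated (`exec_subStart`). The epoch is at most twice the number of simulated steps of
`M`. It has polynomially many digits because `M` halts in exponential time: its outputs are
distinct, have polynomial length and come with polynomial delay
(`EnumeratesWithin.le_of_not_halted`).

The simulating machine is written in a small structured language and compiled; `Expr.seg_code` and
the rules for `Exec` justify the compilation. An `Iface` allows the same simulation of instructions
to serve `M`, `F` and `D`. Sizes of numbers are tracked only between commands: within one simulated
step of `M` each machine step adds at most one digit, and there are polynomially many. The run thus
splits into short windows, one for each step of `M` (`InStep.next`), from which
`mainProgram_enumerates` reads off all requirements. -/

/-- The next instruction outputs nothing, and if it is a query, then the word that is asked and the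
answer are short. -/
def Quiet (M : Program) (O : Oracle) (d : ℕ) (c : Config) : Prop :=
  M[c.pc]? ≠ some Instr.output ∧
    (M[c.pc]? = some Instr.query →
      c.queryWord.length ≤ d ∧ (O c.queryWord (c.asked c.queryWord)).size ≤ d)

/-- The machine gets from `c` to `c'` in at most `n` steps, all of which are quiet. -/
def Seg (M : Program) (O : Oracle) (x : Word) (d : ℕ) (c : Config) (n : ℕ) (c' : Config) : Prop :=
  ∃ m ≤ n, (step M O x)^[m] c = c' ∧ ∀ i < m, Quiet M O d ((step M O x)^[i] c)

section
variable {M : Program} {O : Oracle} {x : Word} {d : ℕ}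

theorem Seg.refl (c : Config) : Seg M O x d c 0 c :=
  ⟨0, le_rfl, rfl, by simp⟩

theorem Seg.mono {c c' : Config} {n n' : ℕ} (h : Seg M O x d c n c') (hn : n ≤ n') :
    Seg M O x d c n' c' := by
  obtain ⟨m, hm, h⟩ := h
  exact ⟨m, hm.trans hn, h⟩

theorem Seg.congr {c c' c'' : Config} {n n' : ℕ} (h : Seg M O x d c n c') (hn : n ≤ n')
    (hc : c' = c'') : Seg M O x d c n' c'' :=
  hc ▸ h.mono hn

theorem Seg.trans {c c' c'' : Config} {n n' : ℕ} (h : Seg M O x d c n c')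
    (h' : Seg M O x d c' n' c'') : Seg M O x d c (n + n') c'' := by
  obtain ⟨m, hm, rfl, hq⟩ := h
  obtain ⟨m', hm', rfl, hq'⟩ := h'
  refine ⟨m' + m, by omega, by rw [Function.iterate_add_apply], fun i hi => ?_⟩
  rcases lt_or_ge i m with h | h
  · exact hq i h
  · obtain ⟨j, rfl⟩ := Nat.exists_eq_add_of_le' h
    rw [Function.iterate_add_apply]
    exact hq' j (by omega)

theorem Seg.single {c : Config} {I : Instr} (hI : M[c.pc]? = some I) (hq : Quiet M O d c) :
    Seg M O x d c 1 (I.exec O x c) := by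
  refine ⟨1, le_rfl, by simp [step, hI], fun i hi => ?_⟩
  obtain rfl : i = 0 := by omega
  exact hq

/-- Instructions that move on to the next one, without query or output. -/
def Instr.Basic : Instr → Prop
  | .jump _ => False
  | .jumpZero _ _ => False
  | .query => False
  | .output => False
  | _ => True

theorem Instr.Basic.pc_exec {I : Instr} (h : I.Basic) (c : Config) :
    (I.exec O x c).pc = c.pc + 1 := by
  cases I <;> first | exact h.elim | rfl

theorem quiet_of_ne {c : Config} {I : Instr} (hI : M[c.pc]? = some I) (h : I ≠ .query)
    (h' : I ≠ .output) : Quiet M O d c := by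
  simp [Quiet, hI, h, h']

/-- The instructions `l` stand in the program `M` from position `b` on. -/
def CodeAt (M : Program) (b : ℕ) (l : List Instr) : Prop :=
  ∀ i < l.length, M[b + i]? = l[i]?

theorem codeAt_cons {b : ℕ} {I : Instr} {l : List Instr} :
    CodeAt M b (I :: l) ↔ M[b]? = some I ∧ CodeAt M (b + 1) l := by
  constructor
  · intro h
    refine ⟨by simpa using h 0 (by simp), fun i hi => ?_⟩
    have := h (i + 1) (by simpa using hi)
    rw [show b + 1 + i = b + (i + 1) by ring, this]
    simp
  · rintro ⟨h, h'⟩ i hi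
    rcases i with _ | i
    · simpa using h
    · have := h' i (by simpa using hi)
      rw [show b + (i + 1) = b + 1 + i by ring, this]
      simp

theorem codeAt_append {b : ℕ} {l l' : List Instr} :
    CodeAt M b (l ++ l') ↔ CodeAt M b l ∧ CodeAt M (b + l.length) l' := by
  induction l generalizing b with
  | nil => simp [CodeAt]
  | cons I l ih =>
    rw [List.cons_append, codeAt_cons, ih, codeAt_cons, List.length_cons,
      show b + 1 + l.length = b + (l.length + 1) by ring, and_assoc]

/-- Straight-line code neither jumps nor asks, so its effect is a fold over the instructions, which
simplification can compute for concrete code. -/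
theorem Seg.basic {l : List Instr} {c : Config} (hl : ∀ I ∈ l, I.Basic) (hc : CodeAt M c.pc l) :
    Seg M O x d c l.length (l.foldl (fun c I => I.exec O x c) c) := by
  induction l generalizing c with
  | nil => exact Seg.refl c
  | cons I l ih =>
    rw [codeAt_cons] at hc
    have hI := hl I (by simp)
    have h1 : Seg M O x d c 1 (I.exec O x c) :=
      Seg.single hc.1 (quiet_of_ne hc.1 (by rintro rfl; exact hI) (by rintro rfl; exact hI))
    have h2 := ih (c := I.exec O x c) (fun J hJ => hl J (by simp [hJ]))
      (by rw [hI.pc_exec]; exact hc.2)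
    exact (h1.trans h2).mono (by simp; omega)

end

/-! ### A structured language -/

/-- The store of a structured program: fifteen arrays of numbers, in place of the work registers. -/
structure State where
  /-- the arrays -/
  mem : Fin 15 → ℕ → ℕ
  /-- query registers -/
  qreg : ℕ → Option Bool
  /-- answer register -/
  ans : ℕ
  /-- how often each word has been submitted to the oracle -/
  asked : Word → ℕ
  /-- the word that is being printed -/
  out : Word

/-- Change of an array entry. -/
def State.set (s : State) (r : Fin 15) (i v : ℕ) : State :=
  { s with mem := Function.update s.mem r (Function.update (s.mem r) i v) }

/-- The work registers that represent the arrays. Registers whose address is divisible by `16` are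
reserved for intermediate results. -/
def State.phys (s : State) (a : ℕ) : ℕ :=
  if a % 16 = 0 then 0 else s.mem (Fin.ofNat 15 (a % 16 - 1)) (a / 16)

/-- The configuration with the work registers `R` and everything else as in `s`. -/
def State.withReg (s : State) (pc : ℕ) (R : ℕ → ℕ) : Config :=
  ⟨pc, R, s.qreg, s.ans, s.asked, s.out⟩

/-- The configuration that represents `s`. -/
def State.config (s : State) (pc : ℕ) : Config :=
  s.withReg pc s.phys

theorem State.phys_tmp (s : State) (k : ℕ) : s.phys (16 * k) = 0 := by
  simp [State.phys]

theorem State.phys_addr (s : State) (r : Fin 15) (i : ℕ) :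
    s.phys (16 * i + (r + 1)) = s.mem r i := by
  have h := r.2
  have h1 : (16 * i + (r + 1)) % 16 = r + 1 := by omega
  have h2 : (16 * i + (r + 1)) / 16 = i := by omega
  rw [State.phys, h1, h2, if_neg (by omega)]
  congr 1
  ext
  simp

/-- The residues `1` to `15` modulo `16` name the arrays. Together with `addr_inj`, the addressing
is a bijection onto the registers whose address is not divisible by `16`. -/
theorem eq_addr_of_mod {a : ℕ} (h : a % 16 ≠ 0) : ∃ (r : Fin 15) (i : ℕ), a = 16 * i + (r + 1) :=
  ⟨⟨a % 16 - 1, by omega⟩, a / 16, by simp; omega⟩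

theorem addr_inj {r r' : Fin 15} {i i' : ℕ} :
    16 * i + (r + 1) = 16 * i' + (r' + 1) ↔ r = r' ∧ i = i' := by
  have := r.2
  have := r'.2
  rw [Fin.ext_iff]
  omega

theorem State.mem_set (s : State) (r r' : Fin 15) (i i' v : ℕ) :
    (s.set r i v).mem r' i' = if r' = r ∧ i' = i then v else s.mem r' i' := by
  by_cases h : r' = r
  · subst h
    simp [State.set, Function.update_apply]
  · simp [State.set, h]

theorem State.phys_set (s : State) (r : Fin 15) (i v : ℕ) :
    (s.set r i v).phys = Function.update s.phys (16 * i + (r + 1)) v := by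
  funext a
  by_cases h : a % 16 = 0
  · rw [Function.update_of_ne (by have := r.2; omega)]
    simp [State.phys, h]
  · obtain ⟨r', i', rfl⟩ := eq_addr_of_mod h
    rw [State.phys_addr, State.mem_set, Function.update_apply, State.phys_addr]
    simp only [addr_inj]

/-- Expressions. -/
inductive Expr where
  | const (n : ℕ)
  | add (e f : Expr)
  | sub (e f : Expr)
  | half (e : Expr)
  /-- array entry -/
  | mem (r : Fin 15) (e : Expr)
  /-- input symbol -/
  | input (e : Expr)
  /-- the content of the answer register -/
  | ans
  /-- the value of `e` if `c` is not zero, the value of `f` otherwise -/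
  | cond (c e f : Expr)

namespace Expr

/-- The value of an expression. -/
def eval (x : Word) (s : State) : Expr → ℕ
  | const n => n
  | add e f => e.eval x s + f.eval x s
  | sub e f => e.eval x s - f.eval x s
  | half e => e.eval x s / 2
  | mem r e => s.mem r (e.eval x s)
  | input e => symbolCode x[e.eval x s]?
  | ans => s.ans
  | cond c e f => if c.eval x s = 0 then f.eval x s else e.eval x s

/-- The length of the code of an expression. -/
def cost : Expr → ℕ
  | const _ => 1
  | add e f => e.cost + f.cost + 2
  | sub e f => e.cost + f.cost + 2
  | half e => e.cost + 1
  | mem _ e => e.cost + 8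
  | input e => e.cost + 1
  | ans => 1
  | cond c e f => c.cost + e.cost + f.cost + 3

/-- Instructions at position `b` that store the value of an expression in the register `16 * k`,
where intermediate results go to higher multiples of `16`. -/
def code : Expr → ℕ → ℕ → List Instr
  | const n, k, _ => [.const (16 * k) n]
  | add e f, k, b => e.code k b ++ (f.code (k + 1) (b + e.cost) ++
      [.add (16 * k) (16 * k) (16 * (k + 1)), .const (16 * (k + 1)) 0])
  | sub e f, k, b => e.code k b ++ (f.code (k + 1) (b + e.cost) ++
      [.sub (16 * k) (16 * k) (16 * (k + 1)), .const (16 * (k + 1)) 0])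
  | half e, k, b => e.code k b ++ [.half (16 * k) (16 * k)]
  | mem r e, k, b => e.code k b ++
      [.add (16 * k) (16 * k) (16 * k), .add (16 * k) (16 * k) (16 * k),
        .add (16 * k) (16 * k) (16 * k), .add (16 * k) (16 * k) (16 * k),
        .const (16 * (k + 1)) (r + 1), .add (16 * k) (16 * k) (16 * (k + 1)),
        .const (16 * (k + 1)) 0, .load (16 * k) (16 * k)]
  | input e, k, b => e.code k b ++ [.input (16 * k) (16 * k)]
  | ans, k, _ => [.answer (16 * k)]
  | cond c e f, k, b => c.code k b ++
      ([.jumpZero (16 * k) (b + c.cost + 2 + e.cost + 1), .const (16 * k) 0] ++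
        (e.code k (b + c.cost + 2) ++ ([.jump (b + c.cost + e.cost + f.cost + 3)] ++
          f.code k (b + c.cost + 2 + e.cost + 1))))

theorem length_code (e : Expr) (k b : ℕ) : (e.code k b).length = e.cost := by
  induction e generalizing k b <;> simp_all [code, cost] <;> omega

/-- Registers that represent the arrays of `s` and have zeros at the multiples of `16` from
`16 * k` on. -/
structure Fits (s : State) (k : ℕ) (R : ℕ → ℕ) : Prop where
  addr : ∀ (r : Fin 15) i, R (16 * i + (r + 1)) = s.mem r i
  tmp : ∀ j ≥ k, R (16 * j) = 0

theorem Fits.update {s : State} {k : ℕ} {R : ℕ → ℕ} (h : Fits s k R) (v : ℕ) :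
    Fits s (k + 1) (Function.update R (16 * k) v) where
  addr r i := by
    rw [Function.update_of_ne (by have := r.2; omega), h.addr]
  tmp j hj := by
    rw [Function.update_of_ne (by omega), h.tmp j (by omega)]

variable {M : Program} {O : Oracle} {x : Word} {d : ℕ} {s : State}

/-- The induction works because the code leaves all temporary registers above `16 * k` at zero
again: only register `16 * k` changes. After the first operand is evaluated there, `Fits` holds with
`k + 1`, and the second operand can be evaluated one level higher. -/
theorem seg_code (e : Expr) {k b : ℕ} {R : ℕ → ℕ} (hR : Fits s k R)
    (hM : CodeAt M b (e.code k b)) :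
    Seg M O x d (s.withReg b R) e.cost
      (s.withReg (b + e.cost) (Function.update R (16 * k) (e.eval x s))) := by
  induction e generalizing k b R with
  | const n =>
    exact Seg.basic (c := s.withReg b R) (by simp [code, Instr.Basic]) hM
  | add e f he hf =>
    rw [code, codeAt_append, codeAt_append, length_code, length_code] at hM
    have h := ((he hR hM.1).trans (hf (hR.update _) hM.2.1)).trans
      (Seg.basic (by simp [Instr.Basic]) hM.2.2)
    refine h.congr (by simp [cost]) ?_
    simp only [State.withReg, List.foldl, Instr.exec, Config.set, cost, eval, Config.mk.injEq,
      and_true]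
    refine ⟨by omega, ?_⟩
    funext a
    have := hR.tmp (k + 1) (by omega)
    simp only [Function.update_apply]
    grind
  | sub e f he hf =>
    rw [code, codeAt_append, codeAt_append, length_code, length_code] at hM
    have h := ((he hR hM.1).trans (hf (hR.update _) hM.2.1)).trans
      (Seg.basic (by simp [Instr.Basic]) hM.2.2)
    refine h.congr (by simp [cost]) ?_
    simp only [State.withReg, List.foldl, Instr.exec, Config.set, cost, eval, Config.mk.injEq,
      and_true]
    refine ⟨by omega, ?_⟩
    funext a
    have := hR.tmp (k + 1) (by omega)
    simp only [Function.update_apply]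
    grind
  | half e he =>
    rw [code, codeAt_append, length_code] at hM
    have h := (he hR hM.1).trans (Seg.basic (by simp [Instr.Basic]) hM.2)
    refine h.congr (by simp [cost]) ?_
    simp [State.withReg, Instr.exec, Config.set, cost, eval, add_assoc]
  | mem r e he =>
    rw [code, codeAt_append, length_code] at hM
    have h := (he hR hM.1).trans (Seg.basic (by simp [Instr.Basic]) hM.2)
    refine h.congr (by simp [cost]) ?_
    simp only [State.withReg, List.foldl, Instr.exec, Config.set, cost, eval, Config.mk.injEq,
      and_true]
    refine ⟨by omega, ?_⟩
    funext a
    have h0 := hR.tmp (k + 1) (by omega)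
    have h1 := hR.addr r (e.eval x s)
    have hr := r.2
    have hne : (16 * k = 16 * (k + 1)) = False := by simp
    have hne' : (16 * (k + 1) = 16 * k) = False := by simp
    -- There is no multiplication, so the code forms the factor `16` of the address by four
    -- doublings.
    have hs : e.eval x s + e.eval x s + (e.eval x s + e.eval x s) +
        (e.eval x s + e.eval x s + (e.eval x s + e.eval x s)) +
        (e.eval x s + e.eval x s + (e.eval x s + e.eval x s) +
        (e.eval x s + e.eval x s + (e.eval x s + e.eval x s))) + ((r : ℕ) + 1) =
        16 * e.eval x s + (r + 1) := by ring
    have n1 : 16 * e.eval x s + (r + 1) ≠ 16 * k := by omega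
    have n2 : 16 * e.eval x s + (r + 1) ≠ 16 * (k + 1) := by omega
    simp only [Function.update_apply, if_true, hne, hne', if_false, hs, n1, n2, h1]
    by_cases ha : a = 16 * k
    · simp [ha]
    · by_cases ha' : a = 16 * (k + 1)
      · simp [ha', h0]
      · simp [ha, ha']
  | input e he =>
    rw [code, codeAt_append, length_code] at hM
    have h := (he hR hM.1).trans (Seg.basic (by simp [Instr.Basic]) hM.2)
    refine h.congr (by simp [cost]) ?_
    simp [State.withReg, Instr.exec, Config.set, cost, eval, add_assoc]
  | ans =>
    exact Seg.basic (c := s.withReg b R) (by simp [code, Instr.Basic]) hM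
  | cond c e f hc he hf =>
    rw [code, codeAt_append, codeAt_append, codeAt_append, codeAt_append, length_code,
      length_code] at hM
    obtain ⟨h1, h2, h3, h4, h5⟩ := hM
    have hseg := hc hR h1
    rw [List.length_singleton] at h5
    rw [codeAt_cons, codeAt_cons] at h2
    rw [codeAt_cons] at h4
    have hj := Seg.single (M := M) (O := O) (x := x) (d := d)
      (c := s.withReg (b + c.cost) (Function.update R (16 * k) (c.eval x s)))
      h2.1 (quiet_of_ne h2.1 (by simp) (by simp))
    -- Both branches expect a zero in register `16 * k`. It is zero anyway if the condition fails,
    -- and the instruction after the jump clears it otherwise.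
    have hRR : Function.update R (16 * k) 0 = R :=
      Function.update_eq_self_iff.2 (hR.tmp k le_rfl).symm
    by_cases h0 : c.eval x s = 0
    · have hf' := hf hR h5
      have hj' : Seg M O x d (s.withReg (b + c.cost) (Function.update R (16 * k) (c.eval x s))) 1
          (s.withReg (b + c.cost + 2 + e.cost + 1) R) := by
        convert hj using 1
        rw [h0, hRR]
        simp [Instr.exec, State.withReg, hR.tmp k le_rfl]
      have h := ((hseg.trans hj').trans hf').mono (n' := (cond c e f).cost) (by simp [cost]; omega)
      convert h using 2
      · simp [cost]; omega
      · simp [eval, h0]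
    · have he' := he hR h3
      have hj' : Seg M O x d (s.withReg (b + c.cost) (Function.update R (16 * k) (c.eval x s))) 1
          (s.withReg (b + c.cost + 1) (Function.update R (16 * k) (c.eval x s))) := by
        convert hj using 1
        simp [Instr.exec, State.withReg, h0, Config.next]
      have hk := Seg.single (M := M) (O := O) (x := x) (d := d)
        (c := s.withReg (b + c.cost + 1) (Function.update R (16 * k) (c.eval x s)))
        h2.2.1 (quiet_of_ne h2.2.1 (by simp) (by simp))
      have hk' : Seg M O x d
          (s.withReg (b + c.cost + 1) (Function.update R (16 * k) (c.eval x s))) 1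
          (s.withReg (b + c.cost + 2) R) := by
        convert hk using 1
        simp [Instr.exec, State.withReg, Config.set, hRR]
      have hl := Seg.single (M := M) (O := O) (x := x) (d := d)
        (c := s.withReg (b + c.cost + 2 + e.cost) (Function.update R (16 * k) (e.eval x s)))
        h4.1 (quiet_of_ne h4.1 (by simp) (by simp))
      have h := ((((hseg.trans hj').trans hk').trans he').trans hl).mono
        (n' := (cond c e f).cost) (by simp [cost]; omega)
      convert h using 1
      simp [cost, eval, h0, State.withReg, Instr.exec]
      omega

end Expr

theorem State.fits (s : State) : Expr.Fits s 0 s.phys :=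
  ⟨s.phys_addr, fun j _ => s.phys_tmp j⟩

/-- Commands. -/
inductive Cmd where
  | skip
  /-- array entry `r[e] := f` -/
  | write (r : Fin 15) (e f : Expr)
  | ask (e f : Expr)
  | query
  | print (e : Expr)
  | seq (c c' : Cmd)
  /-- execute `c` if the value of `e` is not zero, and `c'` otherwise -/
  | ite (e : Expr) (c c' : Cmd)
  /-- repeat `c` as long as the value of `e` is not zero -/
  | loop (e : Expr) (c : Cmd)

namespace Cmd

/-- The length of the code of a command; it bounds the running time if there is no loop. -/
def cost : Cmd → ℕ
  | skip => 0
  | write _ e f => e.cost + f.cost + 10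
  | ask e f => e.cost + f.cost + 3
  | query => 1
  | print e => e.cost + 2
  | seq c c' => c.cost + c'.cost
  | ite e c c' => e.cost + c.cost + c'.cost + 3
  | loop e c => e.cost + c.cost + 3

theorem cost_seq (c c' : Cmd) : (seq c c').cost = c.cost + c'.cost := rfl

/-- Instructions at position `b` that execute a command. -/
def code : Cmd → ℕ → List Instr
  | skip, _ => []
  | write r e f, b => e.code 0 b ++ (f.code 1 (b + e.cost) ++
      [.add 0 0 0, .add 0 0 0, .add 0 0 0, .add 0 0 0, .const 32 (r + 1), .add 0 0 32,
        .store 0 16, .const 0 0, .const 16 0, .const 32 0])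
  | ask e f, b => e.code 0 b ++ (f.code 1 (b + e.cost) ++
      [.ask 0 16, .const 0 0, .const 16 0])
  | query, _ => [.query]
  | print e, b => e.code 0 b ++ [.print 0, .const 0 0]
  | seq c c', b => c.code b ++ c'.code (b + c.cost)
  | ite e c c', b => e.code 0 b ++
      ([.jumpZero 0 (b + e.cost + 2 + c.cost + 1), .const 0 0] ++
        (c.code (b + e.cost + 2) ++ ([.jump (b + e.cost + c.cost + c'.cost + 3)] ++
          c'.code (b + e.cost + 2 + c.cost + 1))))
  | loop e c, b => e.code 0 b ++ ([.jumpZero 0 (b + e.cost + c.cost + 3), .const 0 0] ++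
      (c.code (b + e.cost + 2) ++ [.jump b]))

theorem length_code (c : Cmd) (b : ℕ) : (c.code b).length = c.cost := by
  induction c generalizing b <;> simp_all [code, cost, Expr.length_code] <;> omega

end Cmd

/-- The word in the query registers. -/
noncomputable def State.queryWord (s : State) : Word := (s.config 0).queryWord

/-- With oracle `O`, the command `c` leads from `s` to `s'` within `n` quiet steps. -/
def Exec (O : Oracle) (x : Word) (d : ℕ) (c : Cmd) (s : State) (n : ℕ) (s' : State) : Prop :=
  ∀ (M : Program) (b : ℕ), CodeAt M b (c.code b) →
    Seg M O x d (s.config b) n (s'.config (b + c.cost))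

/-! ### Rules for the execution of commands -/

namespace Exec

variable {O : Oracle} {x : Word} {d : ℕ} {s s' s'' : State} {n n' : ℕ} {c c' : Cmd} {e f : Expr}

theorem mono (h : Exec O x d c s n s') (hn : n ≤ n') : Exec O x d c s n' s' :=
  fun M b hM => (h M b hM).mono hn

theorem skip : Exec O x d .skip s 0 s := fun _ _ _ => Seg.refl _

/-- The address needs a third temporary register, since `store` wants it complete in register `0`
while the value waits in register `16`. The last three instructions clear all three registers, so
that the registers represent a state again. -/
theorem write (r : Fin 15) : Exec O x d (.write r e f) s (Cmd.write r e f).cost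
    (s.set r (e.eval x s) (f.eval x s)) := by
  intro M b hM
  rw [Cmd.code, codeAt_append, codeAt_append, Expr.length_code, Expr.length_code] at hM
  have h := ((e.seg_code (O := O) (x := x) (d := d) s.fits hM.1).trans
    (f.seg_code (s.fits.update _) hM.2.1)).trans (Seg.basic (by simp [Instr.Basic]) hM.2.2)
  refine h.congr (by simp [Cmd.cost]) ?_
  have hr := r.2
  simp only [State.config, State.withReg, List.foldl, Instr.exec, Config.set, Cmd.cost,
    State.phys_set, Config.mk.injEq]
  refine ⟨by omega, ?_, rfl, rfl, rfl, rfl⟩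
  funext a
  have h0 := s.phys_tmp 0
  have h1 := s.phys_tmp 1
  have h2 := s.phys_tmp 2
  have hs : e.eval x s + e.eval x s + (e.eval x s + e.eval x s) +
      (e.eval x s + e.eval x s + (e.eval x s + e.eval x s)) +
      (e.eval x s + e.eval x s + (e.eval x s + e.eval x s) +
      (e.eval x s + e.eval x s + (e.eval x s + e.eval x s))) + ((r : ℕ) + 1) =
      16 * e.eval x s + (r + 1) := by ring
  simp [Function.update_apply, hs]
  have h3 : 16 * e.eval x s + (r + 1) ≠ 0 := by omega
  have h4 : 16 * e.eval x s + (r + 1) ≠ 16 := by omega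
  have h5 : 16 * e.eval x s + (r + 1) ≠ 32 := by omega
  simp only [mul_zero, mul_one] at h0 h1 h2
  grind

theorem ask : Exec O x d (.ask e f) s (Cmd.ask e f).cost
    { s with qreg := Function.update s.qreg (e.eval x s) (codeSymbol (f.eval x s)) } := by
  intro M b hM
  rw [Cmd.code, codeAt_append, codeAt_append, Expr.length_code, Expr.length_code] at hM
  have h := ((e.seg_code (O := O) (x := x) (d := d) s.fits hM.1).trans
    (f.seg_code (s.fits.update _) hM.2.1)).trans (Seg.basic (by simp [Instr.Basic]) hM.2.2)
  refine h.congr (by simp [Cmd.cost]) ?_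
  have h0 := s.phys_tmp 0
  have h1 := s.phys_tmp 1
  simp only [mul_zero, mul_one] at h0 h1
  simp only [State.config, State.withReg, List.foldl, Instr.exec, Config.set, Config.next,
    Cmd.cost, Config.mk.injEq]
  refine ⟨by omega, ?_, ?_, trivial, trivial, trivial⟩
  · funext a
    simp only [Function.update_apply]
    change _ = s.phys a
    grind
  · simp

theorem query (h : s.queryWord.length ≤ d)
    (h' : (O s.queryWord (s.asked s.queryWord)).size ≤ d) :
    Exec O x d .query s 1
      { s with
        ans := O s.queryWord (s.asked s.queryWord)
        asked := Function.update s.asked s.queryWord (s.asked s.queryWord + 1) } := by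
  intro M b hM
  rw [Cmd.code, codeAt_cons] at hM
  exact Seg.single (c := s.config b) hM.1 ⟨by simp [State.config, State.withReg, hM.1],
    fun _ => ⟨h, h'⟩⟩

theorem print : Exec O x d (.print e) s (Cmd.print e).cost
    { s with out := s.out ++ (codeSymbol (e.eval x s)).toList } := by
  intro M b hM
  rw [Cmd.code, codeAt_append, Expr.length_code] at hM
  have h := (e.seg_code (O := O) (x := x) (d := d) s.fits hM.1).trans
    (Seg.basic (by simp [Instr.Basic]) hM.2)
  refine h.congr (by simp [Cmd.cost]) ?_
  have h0 := s.phys_tmp 0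
  simp only [mul_zero] at h0
  simp only [State.config, State.withReg, List.foldl, Instr.exec, Config.set, Config.next,
    Cmd.cost, Config.mk.injEq]
  refine ⟨by omega, ?_, trivial, trivial, trivial, ?_⟩
  · funext a
    simp only [Function.update_apply]
    change _ = s.phys a
    grind
  · simp

theorem seq (h : Exec O x d c s n s') (h' : Exec O x d c' s' n' s'') :
    Exec O x d (.seq c c') s (n + n') s'' := by
  intro M b hM
  rw [Cmd.code, codeAt_append, Cmd.length_code] at hM
  have := (h M _ hM.1).trans (h' M _ hM.2)
  rwa [add_assoc] at this

/-- Conditionals and loops begin with the same test. Register `0` holds zero afterwards on both ways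
out, so the configuration represents `s` again. -/
theorem seg_test {M : Program} {b l : ℕ}
    (hM : CodeAt M b (e.code 0 b ++ [.jumpZero 0 l, .const 0 0])) :
    Seg M O x d (s.config b) (e.cost + 2)
      (s.config (if e.eval x s = 0 then l else b + e.cost + 2)) := by
  rw [codeAt_append, Expr.length_code, codeAt_cons, codeAt_cons] at hM
  have h1 := e.seg_code (O := O) (x := x) (d := d) s.fits hM.1
  have h2 := Seg.single (M := M) (O := O) (x := x) (d := d)
    (c := s.withReg (b + e.cost) (Function.update s.phys (16 * 0) (e.eval x s)))
    hM.2.1 (quiet_of_ne hM.2.1 (by simp) (by simp))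
  have h3 := Seg.single (M := M) (O := O) (x := x) (d := d)
    (c := s.withReg (b + e.cost + 1) (Function.update s.phys (16 * 0) (e.eval x s)))
    hM.2.2.1 (quiet_of_ne hM.2.2.1 (by simp) (by simp))
  have h0 : s.phys 0 = 0 := s.phys_tmp 0
  have hs : Function.update s.phys 0 0 = s.phys := Function.update_eq_self_iff.2 h0.symm
  by_cases he : e.eval x s = 0
  · refine (h1.trans ?_).mono (by omega : e.cost + 1 ≤ _)
    convert h2 using 1
    simp [he, Instr.exec, State.withReg, State.config, hs, h0]
  · have h2' : Seg M O x d
        (s.withReg (b + e.cost) (Function.update s.phys (16 * 0) (e.eval x s))) 1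
        (s.withReg (b + e.cost + 1) (Function.update s.phys (16 * 0) (e.eval x s))) := by
      convert h2 using 1
      simp [he, Instr.exec, State.withReg, Config.next]
    refine ((h1.trans h2').trans ?_).mono (by omega : e.cost + 1 + 1 ≤ _)
    convert h3 using 1
    simp [he, Instr.exec, State.withReg, State.config, hs, Config.set]

theorem ite_true (he : e.eval x s ≠ 0) (h : Exec O x d c s n s') :
    Exec O x d (.ite e c c') s (e.cost + n + 3) s' := by
  intro M b hM
  rw [Cmd.code, ← List.append_assoc, codeAt_append, codeAt_append, codeAt_append,
    codeAt_append] at hM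
  obtain ⟨⟨h1, h1'⟩, h2, h3, -⟩ := hM
  simp only [List.length_append, Expr.length_code, Cmd.length_code, List.length_cons,
    List.length_nil] at h2 h3
  have ht := seg_test (O := O) (x := x) (d := d) (s := s) (codeAt_append.2 ⟨h1, h1'⟩)
  rw [if_neg he] at ht
  rw [codeAt_cons] at h3
  have h2 := h M _ h2
  have hj := Seg.single (M := M) (O := O) (x := x) (d := d)
    (c := s'.config (b + (e.cost + 2) + c.cost)) h3.1 (quiet_of_ne h3.1 (by simp) (by simp))
  refine ((ht.trans h2).trans ?_).mono (by omega : e.cost + 2 + n + 1 ≤ _)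
  convert hj using 1
  simp [Instr.exec, State.config, State.withReg, Cmd.cost]
  omega

theorem ite_false (he : e.eval x s = 0) (h : Exec O x d c' s n s') :
    Exec O x d (.ite e c c') s (e.cost + n + 3) s' := by
  intro M b hM
  rw [Cmd.code, ← List.append_assoc, codeAt_append, codeAt_append, codeAt_append,
    codeAt_append] at hM
  obtain ⟨⟨h1, h1'⟩, -, -, h4⟩ := hM
  simp only [List.length_append, Expr.length_code, Cmd.length_code, List.length_cons,
    List.length_nil] at h4
  have ht := seg_test (O := O) (x := x) (d := d) (s := s) (codeAt_append.2 ⟨h1, h1'⟩)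
  rw [if_pos he] at ht
  have h4 := h M _ h4
  have := (ht.trans h4).mono (by omega : _ ≤ e.cost + n + 3)
  convert this using 2
  simp [Cmd.cost]; omega

/-- There is no general time bound for loops. This rule and `loop_step` are the base and the step of
an induction on the number of rounds for each concrete loop. -/
theorem loop_stop (he : e.eval x s = 0) : Exec O x d (.loop e c) s (e.cost + 2) s := by
  intro M b hM
  rw [Cmd.code, ← List.append_assoc, codeAt_append] at hM
  have ht := seg_test (O := O) (x := x) (d := d) (s := s) hM.1
  rw [if_pos he] at ht
  simpa only [Cmd.cost, add_assoc] using ht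

theorem loop_step (he : e.eval x s ≠ 0) (h : Exec O x d c s n s')
    (h' : Exec O x d (.loop e c) s' n' s'') :
    Exec O x d (.loop e c) s (e.cost + n + 3 + n') s'' := by
  intro M b hM
  have h' := h' M b hM
  rw [Cmd.code, ← List.append_assoc, codeAt_append, codeAt_append, codeAt_append] at hM
  obtain ⟨⟨h1, h1'⟩, h2, h3⟩ := hM
  simp only [List.length_append, Expr.length_code, Cmd.length_code, List.length_cons,
    List.length_nil] at h2 h3
  have ht := seg_test (O := O) (x := x) (d := d) (s := s) (codeAt_append.2 ⟨h1, h1'⟩)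
  rw [if_neg he] at ht
  rw [codeAt_cons] at h3
  have h2 := h M _ h2
  have hj := Seg.single (M := M) (O := O) (x := x) (d := d)
    (c := s'.config (b + (e.cost + 2) + c.cost)) h3.1 (quiet_of_ne h3.1 (by simp) (by simp))
  exact (((ht.trans h2).trans hj).trans h').mono (by omega)

end Exec


/-! ### Simulation of the instructions of a machine -/

/-- The number stored under `v` in array `0`, which serves for named variables. -/
abbrev Expr.var (v : ℕ) : Expr := .mem 0 (.const v)

/-- Assignment to a variable. -/
abbrev Cmd.assign (v : ℕ) (e : Expr) : Cmd := .write 0 (.const v) e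

/-- Equality test. -/
def Expr.eqTest (e f : Expr) : Expr := .sub (.const 1) (.add (.sub e f) (.sub f e))

theorem Expr.eval_eqTest (x : Word) (s : State) (e f : Expr) :
    (e.eqTest f).eval x s = if e.eval x s = f.eval x s then 1 else 0 := by
  simp only [eqTest, eval]
  split_ifs <;> omega

/-- The code of the symbol that is read when the value of `e` is read as a symbol. -/
def Expr.norm (e : Expr) : Expr :=
  .cond e (.cond (.sub e (.const 1)) (.const 2) (.const 1)) (.const 0)

/-- A machine may use any number above `1` for the bit `1` when it writes a symbol, whereas the
arrays that represent words hold exact codes. -/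
theorem Expr.eval_norm (x : Word) (s : State) (e : Expr) :
    e.norm.eval x s = symbolCode (codeSymbol (e.eval x s)) := by
  by_cases h : e.eval x s = 0
  · simp [norm, eval, h, codeSymbol, symbolCode]
  · by_cases h' : e.eval x s = 1
    · simp [norm, eval, h', codeSymbol, symbolCode]
    · obtain ⟨n, hn⟩ := Nat.exists_eq_add_of_le' (show 2 ≤ e.eval x s by omega)
      simp [norm, eval, hn, codeSymbol, symbolCode]

/-- Execution of the command whose number is the value of a variable. -/
def Cmd.select (v : ℕ) (dead : Cmd) : List Cmd → ℕ → Cmd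
  | [], _ => dead
  | c :: l, k => .ite ((Expr.var v).eqTest (.const k)) c (select v dead l (k + 1))

/-- The tests that precede the selected command are part of the code of the selection, so its length
pays for them. -/
theorem Exec.select {O : Oracle} {x : Word} {d : ℕ} {s s' : State} {n v : ℕ} {dead : Cmd}
    {l : List Cmd} {k i : ℕ} (hi : s.mem 0 v = k + i)
    (h : Exec O x d (l[i]?.getD dead) s n s') :
    Exec O x d (.select v dead l k) s (n + (Cmd.select v dead l k).cost) s' := by
  induction l generalizing k i with
  | nil => exact h.mono (by simp)
  | cons c l ih =>
    rcases i with _ | i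
    · refine (Exec.ite_true ?_ h).mono ?_
      · simp [Expr.eval_eqTest, Expr.eval, hi]
      · simp [Cmd.select, Cmd.cost]; omega
    · refine (Exec.ite_false ?_ (ih (k := k + 1) (i := i) (by omega) h)).mono ?_
      · simp [Expr.eval_eqTest, Expr.eval, hi]
      · simp [Cmd.select, Cmd.cost]; omega

theorem Cmd.cost_le_cost_select {v : ℕ} {dead c : Cmd} {l : List Cmd} {k : ℕ} (h : c ∈ l) :
    c.cost ≤ (select v dead l k).cost := by
  induction l generalizing k with
  | nil => simp at h
  | cons c' l ih =>
    rcases List.mem_cons.1 h with rfl | h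
    · simp [select, cost]; omega
    · have := ih (k := k + 1) h
      simp [select, cost]; omega

theorem Cmd.cost_le_cost_select_dead {v : ℕ} {dead : Cmd} {l : List Cmd} {k : ℕ} :
    dead.cost ≤ (select v dead l k).cost := by
  induction l generalizing k with
  | nil => simp [select]
  | cons c' l ih =>
    have := ih (k := k + 1)
    simp [select, cost]; omega

/-- How the parts of a simulated machine are accessed. The commands for instructions find an
address in variable `14` and a value in variable `15`. -/
structure Iface where
  /-- content of the work register whose address is the value of an expression -/
  get : Expr → Expr
  /-- content of the input cell whose address is the value of an expression -/
  inp : Expr → Expr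
  /-- write into a work register -/
  put : Cmd
  /-- write into a query register -/
  ask : Cmd
  print : Cmd
  query : Cmd
  output : Cmd
  /-- the variable that holds the program counter -/
  pc : ℕ
  /-- the variable that holds the content of the answer register -/
  ans : ℕ

namespace Iface

/-- Execute `c` with the values of `e` and `f` as address and value and move on to the next
instruction. -/
def block (J : Iface) (e f : Expr) (c : Cmd) : Cmd :=
  .seq (.assign 14 e) (.seq (.assign 15 f)
    (.seq c (.assign J.pc (.add (.var J.pc) (.const 1)))))

/-- Simulation of an instruction. -/
def instr (J : Iface) : Instr → Cmd
  | .const i n => J.block (.const i) (.const n) J.put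
  | .add i j k => J.block (.const i) (.add (J.get (.const j)) (J.get (.const k))) J.put
  | .sub i j k => J.block (.const i) (.sub (J.get (.const j)) (J.get (.const k))) J.put
  | .half i j => J.block (.const i) (.half (J.get (.const j))) J.put
  | .load i j => J.block (.const i) (J.get (J.get (.const j))) J.put
  | .store i j => J.block (J.get (.const i)) (J.get (.const j)) J.put
  | .jump l => .assign J.pc (.const l)
  | .jumpZero i l => .ite (J.get (.const i)) (.assign J.pc (.add (.var J.pc) (.const 1)))
      (.assign J.pc (.const l))
  | .input i j => J.block (.const i) (J.inp (J.get (.const j))) J.put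
  | .ask i j => J.block (J.get (.const i)) (J.get (.const j)) J.ask
  | .query => J.block (.const 0) (.const 0) J.query
  | .answer i => J.block (.const i) (.var J.ans) J.put
  | .print i => J.block (.const 0) (J.get (.const i)) J.print
  | .output => .seq (J.block (.const 0) (.const 0) .skip) J.output

/-- Simulation of one step of the program `P`; when it has halted, `dead` is executed. -/
def stepCmd (J : Iface) (P : Program) (dead : Cmd) : Cmd :=
  .select J.pc dead (P.map J.instr) 0

/-- With oracle `O` on input `x`, the interface accesses a machine on input `xv` with oracle `OV`
whose configurations are represented in the way described by `Rep`. Here `m` bounds the number of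
digits, `Nq` the time for a query, and `GoodPrint` and `GoodQuery` may restrict the configurations
in which something is printed or asked. -/
structure Sound (J : Iface) (O : Oracle) (x : Word) (d m : ℕ) (OV : Oracle) (xv : Word)
    (Rep : State → Config → Prop) (GoodPrint GoodQuery : Config → Prop) (Nq : ℕ) : Prop where
  get {s c} (e : Expr) : Rep s c → (J.get e).eval x s = c.reg (e.eval x s)
  inp {s c} (e : Expr) : Rep s c → (J.inp e).eval x s = symbolCode xv[e.eval x s]?
  ans {s c} : Rep s c → s.mem 0 J.ans = c.ans
  pc {s c} : Rep s c → s.mem 0 J.pc = c.pc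
  setAddr {s c v} : Rep s c → v.size ≤ m → Rep (s.set 0 14 v) c
  setValue {s c v} : Rep s c → v.size ≤ m → Rep (s.set 0 15 v) c
  setPC {s c v} : Rep s c → v.size ≤ m → Rep (s.set 0 J.pc v) { c with pc := v }
  put {s c} : Rep s c → (s.mem 0 15).size ≤ m → ∃ s', Exec O x d J.put s J.put.cost s' ∧
    Rep s' { c with reg := Function.update c.reg (s.mem 0 14) (s.mem 0 15) }
  ask {s c} : Rep s c → ∃ s', Exec O x d J.ask s J.ask.cost s' ∧
    Rep s' { c with qreg := Function.update c.qreg (s.mem 0 14) (codeSymbol (s.mem 0 15)) }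
  print {s c} : Rep s c → GoodPrint c → ∃ s', Exec O x d J.print s J.print.cost s' ∧
    Rep s' { c with out := c.out ++ (codeSymbol (s.mem 0 15)).toList }
  query {s c} : Rep s c → GoodQuery c → ∃ s', Exec O x d J.query s Nq s' ∧
    Rep s' { c with
      ans := OV c.queryWord (c.asked c.queryWord)
      asked := Function.update c.asked c.queryWord (c.asked c.queryWord + 1) }

end Iface

/-- The sum of the numbers in an instruction. -/
def Instr.numerals : Instr → ℕ
  | .const i n => i + n
  | .add i j k => i + j + k
  | .sub i j k => i + j + k
  | .half i j => i + j
  | .load i j => i + j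
  | .store i j => i + j
  | .jump l => l
  | .jumpZero i l => i + l
  | .input i j => i + j
  | .ask i j => i + j
  | .query => 0
  | .answer i => i
  | .print i => i
  | .output => 0

theorem size_le_of_le {a b m : ℕ} (h : a ≤ b) (hb : b.size ≤ m) : a.size ≤ m :=
  (Nat.size_le_size h).trans hb

theorem size_le_self (a : ℕ) : a.size ≤ a :=
  Nat.size_le.2 Nat.lt_two_pow_self

/-! ### Correctness of simulated instructions -/

namespace Iface.Sound

variable {J : Iface} {O : Oracle} {x : Word} {d m : ℕ} {OV : Oracle} {xv : Word}
  {Rep : State → Config → Prop} {GoodPrint GoodQuery : Config → Prop} {Nq : ℕ}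

/-- The relation `Rep'` after the operation may differ from `Rep`: a query of the main machine
advances the epoch, which is a parameter of the representation. -/
theorem block (hJ : J.Sound O x d m OV xv Rep GoodPrint GoodQuery Nq) {Rep' : State → Config → Prop}
    {s : State} {c c' : Config} {e f : Expr} {op : Cmd} {n v : ℕ} (hR : Rep s c)
    (he : (e.eval x s).size ≤ m)
    (hf : ∀ s, Rep s c → f.eval x s = v) (hv : v.size ≤ m)
    (hop : ∀ s₁, Rep s₁ c → s₁.mem 0 14 = e.eval x s → s₁.mem 0 15 = v →
      ∃ s', Exec O x d op s₁ n s' ∧ Rep' s' c')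
    (hset : ∀ s', Rep' s' c' → s'.mem 0 J.pc = c'.pc ∧
      Rep' (s'.set 0 J.pc (c'.pc + 1)) { c' with pc := c'.pc + 1 }) :
    ∃ s', Exec O x d (J.block e f op) s ((J.block e f .skip).cost + n) s' ∧
      Rep' s' { c' with pc := c'.pc + 1 } := by
  have h1 := hJ.setAddr hR he
  have h2 := hJ.setValue h1 hv
  obtain ⟨s', h3, h3'⟩ := hop _ h2 (by simp [State.mem_set]) (by simp [State.mem_set])
  refine ⟨s'.set 0 J.pc (c'.pc + 1), ?_, (hset _ h3').2⟩
  have hf1 := hf _ h1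
  have e1 := Exec.write (O := O) (x := x) (d := d) (s := s) (e := .const 14) (f := e) 0
  have e2 := Exec.write (O := O) (x := x) (d := d) (s := s.set 0 14 (e.eval x s))
    (e := .const 15) (f := f) 0
  have e3 := Exec.write (O := O) (x := x) (d := d) (s := s')
    (e := .const J.pc) (f := .add (.var J.pc) (.const 1)) 0
  simp only [Expr.eval, hf1, (hset _ h3').1] at e1 e2 e3
  refine (e1.seq (e2.seq (h3.seq e3))).mono ?_
  simp only [Iface.block, Cmd.cost]
  omega

/-- Every number that the simulation stores is a numeral of the program, a program counter, or a
register content of the simulated machine before or after the step. This is why bounds for the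
latter suffice. Outputs are treated apart, since main machine and subroutines differ there. -/
theorem instr (hJ : J.Sound O x d m OV xv Rep GoodPrint GoodQuery Nq) {s : State} {c : Config}
    {I : Instr}
    (hI : I ≠ .output) (hR : Rep s c) (hGP : GoodPrint c)
    (hGQ : I = .query → GoodQuery c) (hm : I.numerals.size ≤ m)
    (hc : ∀ i, (c.reg i).size ≤ m)
    (hc' : ∀ i, ((I.exec OV xv c).reg i).size ≤ m) (hpc : (I.exec OV xv c).pc.size ≤ m)
    (hpc' : (c.pc + 1).size ≤ m) :
    ∃ s', Exec O x d (J.instr I) s ((J.instr I).cost + Nq) s' ∧ Rep s' (I.exec OV xv c) := by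
  have hset : ∀ (c' : Config), c'.pc = c.pc → ∀ s', Rep s' c' → s'.mem 0 J.pc = c'.pc ∧
      Rep (s'.set 0 J.pc (c'.pc + 1)) { c' with pc := c'.pc + 1 } :=
    fun c' h s' h' => ⟨hJ.pc h', hJ.setPC h' (by rwa [h])⟩
  have hput : ∀ (i v : ℕ) (e f : Expr), e.eval x s = i → i.size ≤ m →
      (∀ s, Rep s c → f.eval x s = v) → I.exec OV xv c = c.set i v →
      ∃ s', Exec O x d (J.block e f J.put) s ((J.block e f J.put).cost + Nq) s' ∧
        Rep s' (c.set i v) := by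
    intro i v e f he hi hf hv
    -- The value to be stored is a register content after the step.
    have hv' : v.size ≤ m := by
      have := hc' i
      rw [hv] at this
      simpa [Config.set] using this
    obtain ⟨s', h, h'⟩ := hJ.block (c' := { c with reg := Function.update c.reg i v }) hR
      (he ▸ hi) hf hv'
      (fun s₁ h1 h2 h3 => by
        have := hJ.put h1 (h3 ▸ hv')
        rwa [h2, h3, he] at this) (hset _ rfl)
    exact ⟨s', h.mono (by simp [Iface.block, Cmd.cost]; omega), h'⟩
  have hget : ∀ j s, Rep s c → (J.get (.const j)).eval x s = c.reg j :=
    fun j s h => hJ.get (.const j) h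
  have hle : ∀ {j}, j ≤ I.numerals → j.size ≤ m := fun h => size_le_of_le h hm
  cases I with
  | const i n =>
    exact hput i n _ _ rfl (hle (by simp [Instr.numerals])) (fun _ _ => rfl) rfl
  | add i j k =>
    exact hput i _ _ _ rfl (hle (by simp [Instr.numerals]; omega))
      (fun s h => by rw [Expr.eval, hget _ _ h, hget _ _ h]) rfl
  | sub i j k =>
    exact hput i _ _ _ rfl (hle (by simp [Instr.numerals]; omega))
      (fun s h => by rw [Expr.eval, hget _ _ h, hget _ _ h]) rfl
  | half i j =>
    exact hput i _ _ _ rfl (hle (by simp [Instr.numerals]))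
      (fun s h => by rw [Expr.eval, hget _ _ h]) rfl
  | load i j =>
    exact hput i _ _ _ rfl (hle (by simp [Instr.numerals]))
      (fun s h => by rw [hJ.get _ h, hget _ _ h]) rfl
  | store i j =>
    exact hput _ _ _ _ (hget _ _ hR) (hc _) (fun s h => hget _ _ h) rfl
  | input i j =>
    exact hput i _ _ _ rfl (hle (by simp [Instr.numerals]))
      (fun s h => by rw [hJ.inp _ h, hget _ _ h]) rfl
  | answer i =>
    exact hput i _ _ _ rfl (hle (by simp [Instr.numerals])) (fun s h => hJ.ans h) rfl
  | jump l =>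
    refine ⟨_, (Exec.write 0).mono ?_, hJ.setPC hR hpc⟩
    simp [Iface.instr]
  | jumpZero i l =>
    by_cases h0 : c.reg i = 0
    · refine ⟨_, (Exec.ite_false (by rw [hget _ _ hR, h0]) (Exec.write 0)).mono ?_, ?_⟩
      · simp [Iface.instr, Cmd.cost]; omega
      · simp only [Instr.exec, h0, if_true] at hpc ⊢
        exact hJ.setPC hR hpc
    · refine ⟨_, (Exec.ite_true (by rwa [hget _ _ hR]) (Exec.write 0)).mono ?_, ?_⟩
      · simp [Iface.instr, Cmd.cost]; omega
      · simp only [Instr.exec, h0, if_false] at hpc ⊢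
        simp only [Expr.eval, hJ.pc hR]
        exact hJ.setPC hR hpc
  | ask i j =>
    obtain ⟨s', h, h'⟩ := hJ.block
      (c' := { c with qreg := Function.update c.qreg (c.reg i) (codeSymbol (c.reg j)) }) hR
      (by rw [hget i _ hR]; exact hc _) (fun s h => hget j s h) (hc _)
      (fun s₁ h1 h2 h3 => by
        have := hJ.ask h1
        rwa [h2, h3, hget i _ hR] at this) (hset _ rfl)
    exact ⟨s', h.mono (by simp [Iface.instr, Iface.block, Cmd.cost]; omega), h'⟩
  | query =>
    obtain ⟨s', h, h'⟩ := hJ.block (e := .const 0) (f := .const 0) hR (by simp [Expr.eval])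
      (fun s h => rfl) (by simp) (fun s₁ h1 _ _ => hJ.query h1 (hGQ rfl)) (hset _ rfl)
    exact ⟨s', h.mono (by simp [Iface.instr, Iface.block, Cmd.cost]), h'⟩
  | print i =>
    obtain ⟨s', h, h'⟩ := hJ.block (e := .const 0)
      (c' := { c with out := c.out ++ (codeSymbol (c.reg i)).toList }) hR (by simp [Expr.eval])
      (fun s h => hget i s h) (hc _)
      (fun s₁ h1 h2 h3 => by
        have := hJ.print h1 hGP
        rwa [h3] at this) (hset _ rfl)
    exact ⟨s', h.mono (by simp [Iface.instr, Iface.block, Cmd.cost]; omega), h'⟩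
  | output => exact absurd rfl hI

/-- In the factor `2`, one share pays for finding the instruction and the other for the instruction
itself. -/
theorem stepCmd (hJ : J.Sound O x d m OV xv Rep GoodPrint GoodQuery Nq) {s s' : State}
    {c : Config} {P : Program} {I : Instr} {dead : Cmd} {n : ℕ} (hR : Rep s c)
    (hP : P[c.pc]? = some I) (h : Exec O x d (J.instr I) s ((J.instr I).cost + n) s') :
    Exec O x d (J.stepCmd P dead) s (2 * (J.stepCmd P dead).cost + n) s' := by
  have hg : ((P.map J.instr)[c.pc]?.getD dead) = J.instr I := by simp [hP]
  refine (Exec.select (k := 0) (i := c.pc) (by rw [hJ.pc hR, zero_add])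
    (by rw [hg]; exact h)).mono ?_
  have : (J.instr I).cost ≤ (J.stepCmd P dead).cost :=
    Cmd.cost_le_cost_select (List.mem_map_of_mem (List.mem_of_getElem? hP))
  simp only [Iface.stepCmd] at this ⊢
  omega

theorem stepCmd_dead (hJ : J.Sound O x d m OV xv Rep GoodPrint GoodQuery Nq) {s s' : State}
    {c : Config} {P : Program} {dead : Cmd} {n : ℕ} (hR : Rep s c) (hP : P[c.pc]? = none)
    (h : Exec O x d dead s n s') :
    Exec O x d (J.stepCmd P dead) s (n + (J.stepCmd P dead).cost) s' := by
  have hg : ((P.map J.instr)[c.pc]?.getD dead) = dead := by simp [hP]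
  exact Exec.select (k := 0) (i := c.pc) (by rw [hJ.pc hR, zero_add]) (by rw [hg]; exact h)

end Iface.Sound


/-! ### Codes of words -/

/-- The binary number whose digits are a leading `1` followed by the letters of the word. -/
def revCode (w : Word) : ℕ := w.foldl (fun a b => 2 * a + b.toNat) 1

theorem revCode_nil : revCode [] = 1 := rfl

theorem revCode_concat (w : Word) (b : Bool) : revCode (w ++ [b]) = 2 * revCode w + b.toNat := by
  simp [revCode]

theorem revCode_pos (w : Word) : 0 < revCode w := by
  induction w using List.reverseRecOn with
  | nil => simp [revCode]
  | append_singleton w b ih => rw [revCode_concat]; omega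

theorem revCode_lt (w : Word) : revCode w < 2 ^ (w.length + 1) := by
  induction w using List.reverseRecOn with
  | nil => simp [revCode]
  | append_singleton w b ih =>
    rw [revCode_concat, List.length_append, List.length_singleton, pow_succ]
    have := b.toNat_lt
    omega

/-- The last letter is the parity of the code, and the leading `1` distinguishes the empty word from
all others. -/
theorem revCode_injective : Function.Injective revCode := by
  intro w w' h
  induction w using List.reverseRecOn generalizing w' with
  | nil =>
    induction w' using List.reverseRecOn with
    | nil => rfl
    | append_singleton w' b =>
      rw [revCode_concat, revCode_nil] at h
      have := revCode_pos w'
      omega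
  | append_singleton w b ih =>
    induction w' using List.reverseRecOn with
    | nil =>
      rw [revCode_concat, revCode_nil] at h
      have := revCode_pos w
      omega
    | append_singleton w' b' =>
      rw [revCode_concat, revCode_concat] at h
      have h1 := b.toNat_lt
      have h2 := b'.toNat_lt
      rw [ih (show revCode w = revCode w' by omega)]
      congr 2
      have : b.toNat = b'.toNat := by omega
      cases b <;> cases b' <;> simp_all

/-- The cache address of the answer to the word `w` when it has been asked `j` times before. -/
def cacheAddr (w : Word) (j : ℕ) : ℕ := (2 * revCode w + 1) * 2 ^ j

theorem cacheAddr_pos (w : Word) (j : ℕ) : 0 < cacheAddr w j := by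
  unfold cacheAddr; positivity

/-- One addition leads to the address for the next submission of the same word, so powers of two
never have to be computed. -/
theorem cacheAddr_succ (w : Word) (j : ℕ) :
    cacheAddr w (j + 1) = cacheAddr w j + cacheAddr w j := by
  unfold cacheAddr; ring

/-- The factorization of a positive number into an odd number and a power of two is unique. -/
theorem odd_mul_two_pow_inj {a b i j : ℕ} (h : (2 * a + 1) * 2 ^ i = (2 * b + 1) * 2 ^ j) :
    a = b ∧ i = j := by
  induction i generalizing j with
  | zero =>
    rcases j with _ | j
    · omega
    · rw [pow_succ, ← mul_assoc] at h; omega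
  | succ i ih =>
    rcases j with _ | j
    · rw [pow_succ, ← mul_assoc] at h; omega
    · rw [pow_succ, pow_succ] at h
      have := ih (j := j) (by nlinarith)
      omega

theorem cacheAddr_inj {w w' : Word} {j j' : ℕ} :
    cacheAddr w j = cacheAddr w' j' ↔ w = w' ∧ j = j' := by
  refine ⟨fun h => ?_, by rintro ⟨rfl, rfl⟩; rfl⟩
  obtain ⟨h1, h2⟩ := odd_mul_two_pow_inj h
  exact ⟨revCode_injective h1, h2⟩

/-- The number of digits grows only linearly in `j`. This is enough since `j` counts submissions
within one polynomial-time run. -/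
theorem size_cacheAddr_le (w : Word) (j : ℕ) : (cacheAddr w j).size ≤ w.length + 2 + j := by
  rw [Nat.size_le, cacheAddr, pow_add, pow_succ]
  have := revCode_lt w
  exact Nat.mul_lt_mul_of_pos_right (by omega) (by positivity)

/-! ### The word in the query registers -/

theorem Config.queryWord_spec {c : Config} (h : ∃ i, c.qreg i = none) :
    c.qreg c.queryWord.length = none ∧
      ∀ i (hi : i < c.queryWord.length), c.qreg i = some c.queryWord[i] := by
  have hl : c.queryWord.length = sInf {i | c.qreg i = none} := by simp [Config.queryWord]
  constructor
  · rw [hl]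
    exact Nat.sInf_mem (s := {i | c.qreg i = none}) h
  · intro i hi
    have h1 : c.qreg i ≠ none := fun h0 =>
      Nat.notMem_of_lt_sInf (s := {i | c.qreg i = none}) (hl ▸ hi) h0
    obtain ⟨b, hb⟩ := Option.ne_none_iff_exists'.1 h1
    simp [Config.queryWord, hb]

theorem Config.queryWord_eq {c : Config} {w : Word} (h : c.qreg w.length = none)
    (h' : ∀ i (hi : i < w.length), c.qreg i = some w[i]) : c.queryWord = w := by
  have hl : sInf {i | c.qreg i = none} = w.length := by
    apply le_antisymm (Nat.sInf_le h)
    refine le_csInf (s := {i | c.qreg i = none}) ⟨_, h⟩ ?_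
    intro i hi
    by_contra hlt
    rw [Set.mem_ofPred_eq, h' i (by omega)] at hi
    simp at hi
  apply List.ext_getElem
  · simp [Config.queryWord, hl]
  · intro i h1 h2
    simp [Config.queryWord, h' i h2]

/-! ### Stamped arrays -/

/-- The entry of array `r`, read as `0` unless the stamp in array `r'` is the present epoch, which
is variable `4`. -/
def State.stamped (s : State) (r r' : Fin 15) (i : ℕ) : ℕ :=
  if s.mem r' i = s.mem 0 4 then s.mem r i else 0

/-- Access to a stamped array. -/
def Expr.stamped (r r' : Fin 15) (e : Expr) : Expr :=
  .cond (.eqTest (.mem r' e) (.var 4)) (.mem r e) (.const 0)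

theorem Expr.eval_stamped (x : Word) (s : State) (r r' : Fin 15) (e : Expr) :
    (Expr.stamped r r' e).eval x s = s.stamped r r' (e.eval x s) := by
  by_cases h : s.mem r' (e.eval x s) = s.mem 0 4 <;>
    simp [Expr.stamped, eval, Expr.eval_eqTest, State.stamped, h]

/-- The part of the memory that stays the same while the answer to a query of the simulated machine
is computed: variables `0` and `3` and arrays `1` and `2` hold the program counter, the answer
register, the work registers and the query registers of the simulated machine, variables `1` and
`2` tell whether it has halted or wants to output a word, and array `9` is a cache of all answers
that were given by the oracle so far. -/
structure Frame (O : Oracle) (m : ℕ) (c : Config) (s : State) : Prop where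
  regs : ∀ i, s.mem 1 i = c.reg i
  qregs : ∀ i, s.mem 2 i = symbolCode (c.qreg i)
  out : s.out = c.out
  pc : s.mem 0 0 = c.pc
  flag : s.mem 0 1 = 0
  flag' : s.mem 0 2 = 0
  ans : s.mem 0 3 = c.ans
  cache : ∀ w j, s.mem 9 (cacheAddr w j) = if j < s.asked w then O w j + 1 else 0
  stamp₄ : ∀ i, s.mem 4 i ≤ s.mem 0 4
  stamp₆ : ∀ i, s.mem 6 i ≤ s.mem 0 4
  stamp₈ : ∀ i, s.mem 8 i ≤ s.mem 0 4
  size : ∀ r i, (s.mem r i).size ≤ m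
  size_ans : s.ans.size ≤ m

theorem State.size_set {s : State} {m v : ℕ} (h : ∀ r i, (s.mem r i).size ≤ m) (hv : v.size ≤ m)
    (r : Fin 15) (i : ℕ) : ∀ r' i', ((s.set r i v).mem r' i').size ≤ m := by
  intro r' i'
  rw [State.mem_set]
  split_ifs
  exacts [hv, h r' i']

/-- The listed places are those that a frame leaves free. Stamps may be changed too, but only to the
present epoch, so that none lies in the future. -/
theorem Frame.set {O : Oracle} {m : ℕ} {c : Config} {s : State} (h : Frame O m c s) {r : Fin 15}
    {i v : ℕ} (hv : v.size ≤ m)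
    (hr : (r = 0 ∧ 5 ≤ i) ∨ r = 3 ∨ r = 5 ∨ r = 7 ∨ r = 10 ∨ r = 11 ∨
      ((r = 4 ∨ r = 6 ∨ r = 8) ∧ v = s.mem 0 4)) : Frame O m c (s.set r i v) := by
  have hm : ∀ r' i', (s.set r i v).mem r' i' = if r' = r ∧ i' = i then v else s.mem r' i' :=
    fun r' i' => State.mem_set ..
  constructor
  case size => exact State.size_set h.size hv r i
  case out => exact h.out
  case size_ans => exact h.size_ans
  case cache =>
    intro w j
    rw [hm, if_neg (by rintro ⟨rfl, -⟩; revert hr; simp)]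
    exact h.cache w j
  case regs => intro j; rw [hm, if_neg (by rintro ⟨rfl, -⟩; revert hr; simp)]; exact h.regs j
  case qregs => intro j; rw [hm, if_neg (by rintro ⟨rfl, -⟩; revert hr; simp)]; exact h.qregs j
  case pc => rw [hm, if_neg (by rintro ⟨rfl, rfl⟩; revert hr; simp)]; exact h.pc
  case flag => rw [hm, if_neg (by rintro ⟨rfl, rfl⟩; revert hr; simp)]; exact h.flag
  case flag' => rw [hm, if_neg (by rintro ⟨rfl, rfl⟩; revert hr; simp)]; exact h.flag'
  case ans => rw [hm, if_neg (by rintro ⟨rfl, rfl⟩; revert hr; simp)]; exact h.ans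
  all_goals
    intro j
    rw [hm, hm, if_neg (c := 0 = r ∧ 4 = i) (by rintro ⟨rfl, rfl⟩; revert hr; simp)]
    split_ifs with h0
    · obtain ⟨rfl, -⟩ := h0
      have : v = s.mem 0 4 := by revert hr; simp
      exact this.le
    · first | exact h.stamp₄ j | exact h.stamp₆ j | exact h.stamp₈ j

/-! ### Simulation of a subroutine -/

/-- The array with the input of the subroutine: the first subroutine (`b = false`) reads the query
registers of the main machine, the second one (`b = true`) reads what the first one has printed. -/
def inArr (b : Bool) : Fin 15 := bif b then 10 else 2

/-- The array for the word that is printed by the subroutine. -/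
def outArr (b : Bool) : Fin 15 := bif b then 11 else 10

/-- The variable for the length of the input of the subroutine. -/
def inLen (b : Bool) : ℕ := bif b then 9 else 8

/-- The variable for the length of the word that is printed by the subroutine. -/
def outLen (b : Bool) : ℕ := bif b then 10 else 9

/-- The memory represents the configuration `c` of a subroutine on input `w`, while the main machine
is in the configuration `cM`. For the second subroutine, array `7` holds the cache address for the
next query of each word. -/
structure SubRep (O : Oracle) (m e : ℕ) (cM : Config) (b : Bool) (w : Word) (s : State)
    (c : Config) : Prop where
  frame : Frame O m cM s
  epoch : s.mem 0 4 = e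
  running : s.mem 0 6 = 1
  reg : ∀ i, s.stamped 3 4 i = c.reg i
  qreg : ∀ i, s.stamped 5 6 i = symbolCode (c.qreg i)
  pc : s.mem 0 5 = c.pc
  ans : s.mem 0 7 = c.ans
  lenInp : s.mem 0 (inLen b) = w.length
  inp : ∀ i < w.length, s.mem (inArr b) i = symbolCode w[i]?
  lenOut : s.mem 0 (outLen b) = c.out.length
  out : ∀ i < c.out.length, s.mem (outArr b) i = symbolCode c.out[i]?
  cur : b = true → ∀ u,
    s.stamped 7 8 (revCode u) = if c.asked u = 0 then 0 else cacheAddr u (c.asked u)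
  asked : b = true → ∀ u, c.asked u ≤ s.asked u

/-- The loop of `cachedQuery`. -/
def copyLoop : Cmd :=
  .loop (.stamped 5 6 (.var 12)) <|
    .seq (.ask (.var 12) (.stamped 5 6 (.var 12))) <|
    .seq (.assign 11 (.add (.add (.var 11) (.var 11))
      (.sub (.stamped 5 6 (.var 12)) (.const 1)))) <|
    .assign 12 (.add (.var 12) (.const 1))

/-- The part of `cachedQuery` that asks the oracle. -/
def fetch : Cmd :=
  .ite (.mem 9 (.var 13)) .skip (.seq .query (.write 9 (.var 13) (.add .ans (.const 1))))

/-- The oracle access of the second subroutine: the word in its query registers is copied to the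
query registers proper, and the oracle is asked only if the answer is not in the cache. -/
def cachedQuery : Cmd :=
  .seq (.assign 12 (.const 0)) <| .seq (.assign 11 (.const 1)) <|
  .seq copyLoop <|
  .seq (.ask (.var 12) (.const 0)) <|
  .seq (.assign 13 (.cond (.stamped 7 8 (.var 11)) (.stamped 7 8 (.var 11))
    (.add (.add (.var 11) (.var 11)) (.const 1)))) <|
  .seq fetch <|
  .seq (.write 7 (.var 11) (.add (.var 13) (.var 13))) <|
  .seq (.write 8 (.var 11) (.var 4)) <|
  .assign 7 (.sub (.mem 9 (.var 13)) (.const 1))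

/-- The access to a subroutine. -/
def subIface (b : Bool) : Iface where
  get := .stamped 3 4
  inp e := .cond (.sub (.var (inLen b)) e) (.mem (inArr b) e) (.const 0)
  put := .seq (.write 3 (.var 14) (.var 15)) (.write 4 (.var 14) (.var 4))
  ask := .seq (.write 5 (.var 14) (.norm (.var 15))) (.write 6 (.var 14) (.var 4))
  print := .ite (.var 15)
    (.seq (.write (outArr b) (.var (outLen b)) (.norm (.var 15)))
      (.assign (outLen b) (.add (.var (outLen b)) (.const 1)))) .skip
  query := bif b then cachedQuery else .assign 7 (.const 0)
  output := .assign (outLen b) (.const 0)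
  pc := 5
  ans := 7

theorem size_symbolCode_le {m : ℕ} (h : 2 ≤ m) (a : Option Bool) : (symbolCode a).size ≤ m := by
  refine size_le_of_le (b := 2) ?_ (le_trans (by simp [Nat.size_le]) h)
  rcases a with _ | _ | _ <;> simp [symbolCode]

section
variable {O : Oracle} {x : Word} {d m e : ℕ} {cM : Config} {b : Bool} {w : Word} {s : State}
  {c : Config}

/-- Changes of scratch variables are harmless. -/
theorem SubRep.setScratch (h : SubRep O m e cM b w s c) {i v : ℕ} (hi : 11 ≤ i)
    (hv : v.size ≤ m) : SubRep O m e cM b w (s.set 0 i v) c := by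
  have hm : ∀ r j, (s.set 0 i v).mem r j = if r = 0 ∧ j = i then v else s.mem r j :=
    fun r' i' => State.mem_set ..
  have h0 : ∀ r j, r ≠ 0 ∨ j ≤ 10 → (s.set 0 i v).mem r j = s.mem r j := fun r j hj => by
    rw [hm, if_neg (by omega)]
  have hs : ∀ r r', r ≠ 0 → r' ≠ 0 → ∀ j, (s.set 0 i v).stamped r r' j = s.stamped r r' j :=
    fun r r' h1 h2 j => by
      rw [State.stamped, State.stamped, h0 _ _ (.inl h1), h0 _ _ (.inl h2), h0 _ _ (.inr (by simp))]
  constructor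
  case frame => exact h.frame.set hv (.inl ⟨rfl, by omega⟩)
  case epoch => rw [h0 _ _ (.inr (by simp))]; exact h.epoch
  case running => rw [h0 _ _ (.inr (by simp))]; exact h.running
  case pc => rw [h0 _ _ (.inr (by simp))]; exact h.pc
  case ans => rw [h0 _ _ (.inr (by simp))]; exact h.ans
  case reg => intro j; rw [hs _ _ (by simp) (by simp)]; exact h.reg j
  case qreg => intro j; rw [hs _ _ (by simp) (by simp)]; exact h.qreg j
  case cur => intro hb j; rw [hs _ _ (by simp) (by simp)]; exact h.cur hb j
  case asked => exact h.asked
  case lenInp => rw [h0 _ _ (.inr (by cases b <;> simp [inLen]))]; exact h.lenInp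
  case lenOut => rw [h0 _ _ (.inr (by cases b <;> simp [outLen]))]; exact h.lenOut
  case inp => intro j hj; rw [h0 _ _ (.inl (by cases b <;> simp [inArr]))]; exact h.inp j hj
  case out => intro j hj; rw [h0 _ _ (.inl (by cases b <;> simp [outArr]))]; exact h.out j hj

/-- The true query registers are scratch space: both simulated machines have theirs in arrays, and
each true query is preceded by a fresh copy of the word. -/
theorem SubRep.setQreg (h : SubRep O m e cM b w s c) (q : ℕ → Option Bool) :
    SubRep O m e cM b w { s with qreg := q } c := by
  obtain ⟨⟨a1, a2, a3, a4, a5, a6, a7, a8, a9, a10, a11, a12, a13⟩,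
    b1, b2, b3, b4, b5, b6, b7, b8, b9, b10, b11, b12⟩ := h
  exact ⟨⟨a1, a2, a3, a4, a5, a6, a7, a8, a9, a10, a11, a12, a13⟩,
    b1, b2, b3, b4, b5, b6, b7, b8, b9, b10, b11, b12⟩

/-- Writing into one of the stamped arrays `3` and `5`. -/
theorem SubRep.put (h : SubRep O m e cM b w s c) {i v : ℕ} (hv : v.size ≤ m) :
    SubRep O m e cM b w ((s.set 3 i v).set 4 i (s.mem 0 4))
      { c with reg := Function.update c.reg i v } := by
  have hm : ∀ r j, ((s.set 3 i v).set 4 i (s.mem 0 4)).mem r j =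
      if r = 4 ∧ j = i then s.mem 0 4 else if r = 3 ∧ j = i then v else s.mem r j :=
    fun r' i' => by rw [State.mem_set, State.mem_set]
  constructor
  case frame =>
    refine (h.frame.set hv (by simp)).set (h.frame.size 0 4) ?_
    simp [State.mem_set]
  case reg =>
    intro j
    have := h.reg j
    simp only [State.stamped, hm, Function.update_apply] at this ⊢
    by_cases hj : j = i <;> simp_all
  case qreg => simpa [State.stamped, hm] using h.qreg
  case cur => simpa [State.stamped, hm] using h.cur
  case asked => exact h.asked
  case inp => cases b <;> simpa [hm, inArr] using h.inp
  case out => cases b <;> simpa [hm, outArr] using h.out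
  case lenInp => simpa [hm] using h.lenInp
  case lenOut => simpa [hm] using h.lenOut
  case epoch => simpa [hm] using h.epoch
  case running => simpa [hm] using h.running
  case pc => simpa [hm] using h.pc
  case ans => simpa [hm] using h.ans

theorem SubRep.ask (h : SubRep O m e cM b w s c) {i : ℕ} {a : Option Bool} (hm2 : 2 ≤ m) :
    SubRep O m e cM b w ((s.set 5 i (symbolCode a)).set 6 i (s.mem 0 4))
      { c with qreg := Function.update c.qreg i a } := by
  have hm : ∀ r j, ((s.set 5 i (symbolCode a)).set 6 i (s.mem 0 4)).mem r j =
      if r = 6 ∧ j = i then s.mem 0 4 else if r = 5 ∧ j = i then symbolCode a else s.mem r j :=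
    fun r' i' => by rw [State.mem_set, State.mem_set]
  constructor
  case frame =>
    refine (h.frame.set (size_symbolCode_le hm2 a) (by simp)).set (h.frame.size 0 4) ?_
    simp [State.mem_set]
  case qreg =>
    intro j
    have := h.qreg j
    simp only [State.stamped, hm, Function.update_apply] at this ⊢
    by_cases hj : j = i <;> simp_all
  case reg => simpa [State.stamped, hm] using h.reg
  case cur => simpa [State.stamped, hm] using h.cur
  case asked => exact h.asked
  case inp => cases b <;> simpa [hm, inArr] using h.inp
  case out => cases b <;> simpa [hm, outArr] using h.out
  case lenInp => simpa [hm] using h.lenInp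
  case lenOut => simpa [hm] using h.lenOut
  case epoch => simpa [hm] using h.epoch
  case running => simpa [hm] using h.running
  case pc => simpa [hm] using h.pc
  case ans => simpa [hm] using h.ans

theorem SubRep.setPC (h : SubRep O m e cM b w s c) {v : ℕ} (hv : v.size ≤ m) :
    SubRep O m e cM b w (s.set 0 5 v) { c with pc := v } := by
  constructor
  case frame => exact h.frame.set hv (by simp)
  case pc => simp [State.mem_set]
  case reg => simpa [State.stamped, State.mem_set] using h.reg
  case qreg => simpa [State.stamped, State.mem_set] using h.qreg
  case cur => simpa [State.stamped, State.mem_set] using h.cur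
  case asked => exact h.asked
  case inp => cases b <;> simpa [State.mem_set, inArr] using h.inp
  case out => cases b <;> simpa [State.mem_set, outArr] using h.out
  case lenInp => cases b <;> simpa [State.mem_set, inLen] using h.lenInp
  case lenOut => cases b <;> simpa [State.mem_set, outLen] using h.lenOut
  case epoch => simpa [State.mem_set] using h.epoch
  case running => simpa [State.mem_set] using h.running
  case ans => simpa [State.mem_set] using h.ans

theorem SubRep.print (h : SubRep O m e cM b w s c) {a : Bool}
    (hm2 : 2 ≤ m) (hl : (c.out.length + 1).size ≤ m) :
    SubRep O m e cM b w ((s.set (outArr b) c.out.length (symbolCode a)).set 0 (outLen b)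
      (c.out.length + 1)) { c with out := c.out ++ [a] } := by
  constructor
  case frame =>
    refine (h.frame.set (size_symbolCode_le hm2 a) ?_).set hl (.inl ⟨rfl, ?_⟩)
    · cases b <;> simp [outArr]
    · cases b <;> simp [outLen]
  case out =>
    intro i hi
    simp only [List.length_append, List.length_singleton] at hi
    rcases Nat.lt_succ_iff_lt_or_eq.1 hi with hi | rfl
    · rw [List.getElem?_append_left hi, ← h.out i hi]
      cases b <;> simp [State.mem_set, outArr, hi.ne]
    · cases b <;> simp [State.mem_set, outArr]
  case lenOut => simp [State.mem_set]
  case reg =>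
    cases b <;> simpa [State.stamped, State.mem_set, outArr, outLen] using h.reg
  case qreg =>
    cases b <;> simpa [State.stamped, State.mem_set, outArr, outLen] using h.qreg
  case cur =>
    cases b
    · simp [State.stamped, State.mem_set, outArr, outLen]
    · simpa [State.stamped, State.mem_set, outArr, outLen] using h.cur
  case asked => exact h.asked
  case inp =>
    cases b <;> simpa [State.mem_set, inArr, outArr] using h.inp
  case lenInp =>
    cases b <;> simpa [State.mem_set, inLen, outLen, outArr] using h.lenInp
  case epoch =>
    cases b <;> simpa [State.mem_set, outLen, outArr] using h.epoch
  case running =>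
    cases b <;> simpa [State.mem_set, outLen, outArr] using h.running
  case ans =>
    cases b <;> simpa [State.mem_set, outLen, outArr] using h.ans
  case pc =>
    cases b <;> simpa [State.mem_set, outLen, outArr] using h.pc

theorem SubRep.output (h : SubRep O m e cM b w s c) :
    SubRep O m e cM b w (s.set 0 (outLen b) 0) { c with out := [] } := by
  constructor
  case frame =>
    refine h.frame.set (by simp) (.inl ⟨rfl, ?_⟩)
    cases b <;> simp [outLen]
  case out => simp
  case lenOut => simp [State.mem_set]
  case reg =>
    cases b <;> simpa [State.stamped, State.mem_set, outLen] using h.reg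
  case qreg =>
    cases b <;> simpa [State.stamped, State.mem_set, outLen] using h.qreg
  case cur =>
    cases b
    · simp [State.stamped, State.mem_set, outLen]
    · simpa [State.stamped, State.mem_set, outLen] using h.cur
  case asked => exact h.asked
  case inp =>
    cases b <;> simpa [State.mem_set, inArr] using h.inp
  case lenInp =>
    cases b <;> simpa [State.mem_set, inLen, outLen] using h.lenInp
  case epoch =>
    cases b <;> simpa [State.mem_set, outLen] using h.epoch
  case running =>
    cases b <;> simpa [State.mem_set, outLen] using h.running
  case ans =>
    cases b <;> simpa [State.mem_set, outLen] using h.ans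
  case pc =>
    cases b <;> simpa [State.mem_set, outLen] using h.pc

end


/-! ### Cached oracle access and soundness of the subroutine interface -/

section
variable {O : Oracle} {x : Word} {d m e : ℕ} {cM : Config} {w : Word} {s : State} {c : Config}

theorem codeSymbol_symbolCode (a : Option Bool) : codeSymbol (symbolCode a) = a := by
  rcases a with _ | _ | _ <;> rfl

/-- Loop invariant: variable `12` is the present position `i`, variable `11` is the code of the
first `i` letters, and these letters have been copied. Thus the code needed for the cache address
arises along with the copy. -/
theorem exec_copyLoop (h : SubRep O m e cM true w s c) {u : Word}
    (hu : c.qreg u.length = none) (hu' : ∀ i (hi : i < u.length), c.qreg i = some u[i])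
    (hm : u.length + 1 ≤ m) {k i : ℕ} (hk : u.length = i + k) (hi : s.mem 0 12 = i)
    (ha : s.mem 0 11 = revCode (u.take i))
    (hq : ∀ j (hj : j < u.length), j < i → s.qreg j = some u[j]) :
    ∃ s', Exec O x d copyLoop s ((k + 1) * copyLoop.cost) s' ∧ SubRep O m e cM true w s' c ∧
      s'.mem 0 12 = u.length ∧ s'.mem 0 11 = revCode u ∧
      ∀ j (hj : j < u.length), s'.qreg j = some u[j] := by
  induction k generalizing i s with
  | zero =>
    have hi' : i = u.length := by omega
    refine ⟨s, (Exec.loop_stop ?_).mono ?_, h, by rw [hi, hi'], ?_, ?_⟩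
    · rw [Expr.eval_stamped, h.qreg]
      simp [Expr.eval, hi, hi', hu, symbolCode]
    · simp [copyLoop, Cmd.cost]; omega
    · rw [ha, hi', List.take_length]
    · exact fun j hj => hq j hj (by omega)
  | succ k ih =>
    have hlt : i < u.length := by omega
    have hs : s.stamped 5 6 i = symbolCode (some u[i]) := by rw [h.qreg, hu' i hlt]
    have htake : u.take (i + 1) = u.take i ++ [u[i]] := by simp
    have hrev : revCode (u.take (i + 1)) =
        revCode (u.take i) + revCode (u.take i) + (symbolCode (some u[i]) - 1) := by
      rw [htake, revCode_concat]
      cases u[i] <;> simp [symbolCode] <;> ring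
    have hsize : (revCode (u.take (i + 1))).size ≤ m := by
      rw [Nat.size_le]
      refine (revCode_lt _).trans_le (Nat.pow_le_pow_right (by simp) ?_)
      simp; omega
    have h1 : SubRep O m e cM true w
        { s with qreg := Function.update s.qreg i (some u[i]) } c := h.setQreg _
    have h2 := h1.setScratch (i := 11) (by simp) hsize
    have h3 := h2.setScratch (i := 12) (v := i + 1) (by simp)
      ((size_le_self _).trans (by omega))
    obtain ⟨s', he, hR, r1, r2, r3⟩ := ih h3 (i := i + 1) (by omega)
      (by simp [State.mem_set]) (by simp [State.mem_set]) (by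
        intro j hj hji
        change Function.update s.qreg i _ j = _
        rw [Function.update_apply]
        split_ifs with hij
        · subst hij; rfl
        · exact hq j hj (by omega))
    have e1 := Exec.ask (O := O) (x := x) (d := d) (s := s) (e := .var 12)
      (f := .stamped 5 6 (.var 12))
    rw [Expr.eval_stamped] at e1
    simp only [Expr.eval, hi, hs, codeSymbol_symbolCode] at e1
    have e2 := Exec.write (O := O) (x := x) (d := d)
      (s := { s with qreg := Function.update s.qreg i (some u[i]) }) (e := .const 11)
      (f := .add (.add (.var 11) (.var 11)) (.sub (.stamped 5 6 (.var 12)) (.const 1))) 0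
    simp only [Expr.eval, Expr.eval_stamped, hi, ha] at e2
    rw [show State.stamped { s with qreg := Function.update s.qreg i (some u[i]) } 5 6 i =
      s.stamped 5 6 i from rfl, hs, ← hrev] at e2
    have e3 := Exec.write (O := O) (x := x) (d := d)
      (s := ({ s with qreg := Function.update s.qreg i (some u[i]) } : State).set 0 11
        (revCode (u.take (i + 1)))) (e := .const 12)
      (f := .add (.var 12) (.const 1)) 0
    simp only [Expr.eval] at e3
    rw [State.mem_set, if_neg (by simp), hi] at e3
    refine ⟨s', (Exec.loop_step ?_ (e1.seq (e2.seq e3)) he).mono ?_, hR, r1, r2, r3⟩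
    · rw [Expr.eval_stamped]
      simp only [Expr.eval, hi, hs]
      cases u[i] <;> simp [symbolCode]
    · rw [add_mul (k + 1) 1, add_comm, one_mul]
      exact Nat.add_le_add_left (by simp [copyLoop, Cmd.cost]) _

/-- What has to be known about a configuration of the second subroutine in which it asks a query. -/
structure GoodQuery (O : Oracle) (d m T : ℕ) (c : Config) : Prop where
  blank : ∃ i, c.qreg i = none
  length_le : c.queryWord.length ≤ T
  T_le : T ≤ d
  size_answer : (O c.queryWord (c.asked c.queryWord)).size ≤ d
  size_answer_succ : (O c.queryWord (c.asked c.queryWord) + 1).size ≤ m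
  size_cacheAddr : c.queryWord.length + 3 + c.asked c.queryWord ≤ m

/-- The present run has submitted `u` at most as often as the true oracle has received it. If it is
fewer times, the answer is in the cache. If the numbers agree, the true oracle is asked and its
answer is the one with the required index. Answers are stored increased by `1`, since the answer `0`
is possible and `0` marks an empty entry. -/
theorem exec_fetch (h : SubRep O m e cM true w s c) {u : Word} (hq : s.queryWord = u)
    (hl : u.length ≤ d) (hO : (O u (c.asked u)).size ≤ d) (hO' : (O u (c.asked u) + 1).size ≤ m)
    (hp : s.mem 0 13 = cacheAddr u (c.asked u)) :
    ∃ s', Exec O x d fetch s fetch.cost s' ∧ SubRep O m e cM true w s' c ∧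
      s'.mem 0 13 = s.mem 0 13 ∧ s'.mem 0 11 = s.mem 0 11 ∧
      s'.mem 9 (cacheAddr u (c.asked u)) = O u (c.asked u) + 1 ∧ c.asked u < s'.asked u := by
  have hc := h.frame.cache u (c.asked u)
  rcases (h.asked rfl u).lt_or_eq with hlt | heq
  · rw [if_pos hlt] at hc
    refine ⟨s, (Exec.ite_true ?_ Exec.skip).mono ?_, h, rfl, rfl, hc, hlt⟩
    · simp [Expr.eval, hp, hc]
    · simp [fetch, Cmd.cost]
  · rw [heq, if_neg (lt_irrefl _)] at hc
    have e1 := Exec.query (O := O) (x := x) (d := d) (s := s) (by rwa [hq]) (by rwa [hq, ← heq])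
    rw [hq, ← heq] at e1
    have e2 := Exec.write (O := O) (x := x) (d := d)
      (s := { s with
        ans := O u (c.asked u)
        asked := Function.update s.asked u (c.asked u + 1) })
      (e := .var 13) (f := .add .ans (.const 1)) 9
    simp only [Expr.eval, hp] at e2
    refine ⟨_, (Exec.ite_false ?_ (e1.seq e2)).mono ?_, ?_, ?_, ?_, ?_, ?_⟩
    · simp [Expr.eval, hp, heq, hc]
    · simp [fetch, Cmd.cost]
    · have hm : ∀ r j, (State.set { s with
          ans := O u (c.asked u)
          asked := Function.update s.asked u (c.asked u + 1) } 9 (cacheAddr u (c.asked u))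
            (O u (c.asked u) + 1)).mem r j =
          if r = 9 ∧ j = cacheAddr u (c.asked u) then O u (c.asked u) + 1 else s.mem r j :=
        fun r' i' => State.mem_set ..
      constructor
      case frame =>
        constructor
        case cache =>
          intro u' j
          rw [hm]
          simp only [true_and, cacheAddr_inj]
          change _ = if j < Function.update s.asked u (c.asked u + 1) u' then _ else _
          rw [Function.update_apply, h.frame.cache]
          by_cases hu : u' = u
          · subst hu
            by_cases hj : j = c.asked u'
            · simp [hj]
            · have : j < s.asked u' ↔ j < c.asked u' + 1 := by omega
              simp [hj, this]
          · simp [hu]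
        case size => exact State.size_set h.frame.size hO' _ _
        case size_ans => exact (Nat.size_le_size (Nat.le_succ _)).trans hO'
        case out => exact h.frame.out
        case regs => simpa [hm] using h.frame.regs
        case qregs => simpa [hm] using h.frame.qregs
        case pc => simpa [hm] using h.frame.pc
        case flag => simpa [hm] using h.frame.flag
        case flag' => simpa [hm] using h.frame.flag'
        case ans => simpa [hm] using h.frame.ans
        case stamp₄ => simpa [hm] using h.frame.stamp₄
        case stamp₆ => simpa [hm] using h.frame.stamp₆
        case stamp₈ => simpa [hm] using h.frame.stamp₈
      case asked =>
        intro _ u'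
        change _ ≤ Function.update s.asked u (c.asked u + 1) u'
        rw [Function.update_apply]
        split_ifs with hu
        · subst hu; omega
        · exact h.asked rfl u'
      case epoch => simpa [hm] using h.epoch
      case running => simpa [hm] using h.running
      case reg => simpa [hm, State.stamped] using h.reg
      case qreg => simpa [hm, State.stamped] using h.qreg
      case pc => simpa [hm] using h.pc
      case ans => simpa [hm] using h.ans
      case lenInp => simpa [hm] using h.lenInp
      case lenOut => simpa [hm] using h.lenOut
      case inp => simpa [hm, inArr] using h.inp
      case out => simpa [hm, outArr] using h.out
      case cur => simpa [hm, State.stamped] using h.cur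
    · simp [State.mem_set]
    · simp [State.mem_set]
    · simp [State.mem_set]
    · change _ < Function.update s.asked u (c.asked u + 1) u
      simp

/-- To the subroutine this looks like a query to an oracle that counts the submissions of the
present run only, which is what correctness of `D` presupposes. -/
theorem exec_cachedQuery {T : ℕ} (h : SubRep O m e cM true w s c) (hG : GoodQuery O d m T c) :
    ∃ s', Exec O x d cachedQuery s ((T + 2) * cachedQuery.cost) s' ∧
      SubRep O m e cM true w s' { c with
        ans := O c.queryWord (c.asked c.queryWord)
        asked := Function.update c.asked c.queryWord (c.asked c.queryWord + 1) } := by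
  obtain ⟨hu, hu'⟩ := Config.queryWord_spec hG.blank
  have hlT := hG.length_le
  have hTd := hG.T_le
  have hO := hG.size_answer
  have hO' := hG.size_answer_succ
  have hA := hG.size_cacheAddr
  generalize c.queryWord = u at *
  -- copying the word
  have e1 := Exec.write (O := O) (x := x) (d := d) (s := s) (e := .const 12) (f := .const 0) 0
  have e2 := Exec.write (O := O) (x := x) (d := d) (s := s.set 0 12 0)
    (e := .const 11) (f := .const 1) 0
  simp only [Expr.eval] at e1 e2
  obtain ⟨s₁, e3, h₁, i₁, a₁, q₁⟩ := exec_copyLoop (x := x) (d := d) (k := u.length) (i := 0)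
    ((h.setScratch (i := 12) (v := 0) (by simp) (by simp)).setScratch (i := 11) (v := 1) (by simp)
      (by simpa using (by omega : 1 ≤ m)))
    hu hu' (by omega) (by simp) (by simp [State.mem_set]) (by simp [State.mem_set, revCode])
    (by simp)
  have e4 := Exec.ask (O := O) (x := x) (d := d) (s := s₁) (e := .var 12) (f := .const 0)
  simp only [Expr.eval, i₁, codeSymbol] at e4
  have h₂ := h₁.setQreg (Function.update s₁.qreg u.length none)
  -- the address in the cache
  have hcur : s₁.stamped 7 8 (revCode u) = if c.asked u = 0 then 0 else cacheAddr u (c.asked u) :=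
    h₁.cur rfl u
  have e5 := Exec.write (O := O) (x := x) (d := d)
    (s := { s₁ with qreg := Function.update s₁.qreg u.length none }) (e := .const 13)
    (f := .cond (.stamped 7 8 (.var 11)) (.stamped 7 8 (.var 11))
    (.add (.add (.var 11) (.var 11)) (.const 1))) 0
  have hv : Expr.eval x { s₁ with qreg := Function.update s₁.qreg u.length none }
      (.cond (.stamped 7 8 (.var 11)) (.stamped 7 8 (.var 11))
        (.add (.add (.var 11) (.var 11)) (.const 1))) = cacheAddr u (c.asked u) := by
    have hs : State.stamped { s₁ with qreg := Function.update s₁.qreg u.length none } 7 8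
      (revCode u) = s₁.stamped 7 8 (revCode u) := rfl
    have hp := cacheAddr_pos u (c.asked u)
    -- Cache addresses are positive, so the stamped entry is `0` exactly at the first submission in
    -- this run. Then the address is `2 * revCode u + 1`, which is `cacheAddr u 0`.
    by_cases h0 : c.asked u = 0
    · simp [Expr.eval, Expr.eval_stamped, a₁, hs, hcur, h0, cacheAddr]; ring
    · simp [Expr.eval, Expr.eval_stamped, a₁, hs, hcur, h0, hp.ne']
  rw [hv] at e5
  simp only [Expr.eval] at e5
  have h₃ := h₂.setScratch (i := 13) (by simp)
    ((size_cacheAddr_le u (c.asked u)).trans (by omega : _ ≤ m))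
  have hqw : (State.set { s₁ with qreg := Function.update s₁.qreg u.length none } 0 13
      (cacheAddr u (c.asked u))).queryWord = u := by
    apply Config.queryWord_eq
    · exact Function.update_self ..
    · intro i hi
      exact (Function.update_of_ne hi.ne _ _).trans (q₁ i hi)
  obtain ⟨s₂, e6, h₄, p₂, a₂, c₂, k₂⟩ := exec_fetch (x := x) (d := d) h₃ hqw (by omega) hO hO'
    (by simp [State.mem_set])
  rw [State.mem_set, if_pos (by simp)] at p₂
  rw [State.mem_set, if_neg (by simp), show State.mem { s₁ with
    qreg := Function.update s₁.qreg u.length none } 0 11 = s₁.mem 0 11 from rfl, a₁] at a₂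
  -- advancing the address, and the answer
  have e7 := Exec.write (O := O) (x := x) (d := d) (s := s₂) (e := .var 11)
    (f := .add (.var 13) (.var 13)) 7
  simp only [Expr.eval, a₂, p₂, ← cacheAddr_succ] at e7
  have e8 := Exec.write (O := O) (x := x) (d := d)
    (s := s₂.set 7 (revCode u) (cacheAddr u (c.asked u + 1))) (e := .var 11) (f := .var 4) 8
  simp only [Expr.eval] at e8
  rw [State.mem_set, if_neg (by simp), State.mem_set, if_neg (by simp), a₂] at e8
  have e9 := Exec.write (O := O) (x := x) (d := d)
    (s := (s₂.set 7 (revCode u) (cacheAddr u (c.asked u + 1))).set 8 (revCode u) (s₂.mem 0 4))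
    (e := .const 7) (f := .sub (.mem 9 (.var 13)) (.const 1)) 0
  simp only [Expr.eval] at e9
  rw [show ((s₂.set 7 (revCode u) (cacheAddr u (c.asked u + 1))).set 8 (revCode u)
      (s₂.mem 0 4)).mem 0 13 = s₂.mem 0 13 by simp [State.mem_set], p₂,
    show ((s₂.set 7 (revCode u) (cacheAddr u (c.asked u + 1))).set 8 (revCode u)
      (s₂.mem 0 4)).mem 9 (cacheAddr u (c.asked u)) = s₂.mem 9 (cacheAddr u (c.asked u)) by
      simp [State.mem_set], c₂, Nat.add_sub_cancel] at e9
  refine ⟨_, (e1.seq (e2.seq (e3.seq (e4.seq (e5.seq (e6.seq (e7.seq (e8.seq e9)))))))).mono ?_, ?_⟩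
  · have key : ∀ a b c r L T : ℕ, L ≤ T → a + (b + ((L + 1) * c + r)) ≤
        (T + 2) * (a + (b + (c + r))) := by
      intro a b c r L T hL
      have h1 : (L + 1) * c ≤ (T + 1) * c := Nat.mul_le_mul_right _ (by omega)
      have h2 : (T + 2) * (a + (b + (c + r))) =
        (T + 1) * c + c + (T + 1) * (a + (b + r)) + (a + (b + r)) := by ring
      omega
    rw [cachedQuery]
    simp only [Cmd.cost_seq]
    exact key _ _ _ _ _ _ hlT
  · have hm : ∀ r j, (((s₂.set 7 (revCode u) (cacheAddr u (c.asked u + 1))).set 8 (revCode u)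
        (s₂.mem 0 4)).set 0 7 (O u (c.asked u))).mem r j =
        if r = 0 ∧ j = 7 then O u (c.asked u) else if r = 8 ∧ j = revCode u then s₂.mem 0 4 else
        if r = 7 ∧ j = revCode u then cacheAddr u (c.asked u + 1) else s₂.mem r j :=
      fun r j => by rw [State.mem_set, State.mem_set, State.mem_set]
    constructor
    case frame =>
      refine ((h₄.frame.set ((size_cacheAddr_le u _).trans (by omega)) (by simp)).set
        (h₄.frame.size 0 4) ?_).set ((Nat.size_le_size (Nat.le_succ _)).trans hO') (by simp)
      simp [State.mem_set]
    case cur =>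
      intro _ u'
      have := h₄.cur rfl u'
      simp only [State.stamped, hm, revCode_injective.eq_iff, Function.update_apply] at this ⊢
      by_cases hj : u' = u
      · subst hj; simp
      · simpa [hj] using this
    case asked =>
      intro _ u'
      change Function.update c.asked u (c.asked u + 1) u' ≤ s₂.asked u'
      rw [Function.update_apply]
      split_ifs with hj
      · subst hj; omega
      · exact h₄.asked rfl u'
    case epoch => simpa [hm] using h₄.epoch
    case running => simpa [hm] using h₄.running
    case reg => simpa [hm, State.stamped] using h₄.reg
    case qreg => simpa [hm, State.stamped] using h₄.qreg
    case pc => simpa [hm] using h₄.pc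
    case ans => simp [hm]
    case lenInp => simpa [hm, inLen] using h₄.lenInp
    case lenOut => simpa [hm, outLen] using h₄.lenOut
    case inp => simpa [hm, inArr] using h₄.inp
    case out => simpa [hm, outArr] using h₄.out

/-- The oracle of a subroutine. -/
def subOracle (O : Oracle) (b : Bool) : Oracle := bif b then O else noOracle

/-- An output of a subroutine has no outside effect. It only starts the printed word anew, and the
result of `F` is the word present when it halts. -/
theorem exec_subOutput {b : Bool} (h : SubRep O m e cM b w s c) :
    ∃ s', Exec O x d (subIface b).output s (subIface b).output.cost s' ∧
      SubRep O m e cM b w s' { c with out := [] } :=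
  ⟨_, Exec.write 0, h.output⟩

/-- The first subroutine runs with the trivial oracle, so a query merely stores the answer `0`; the
counts of submissions matter for the second one only. -/
theorem subIface_sound (hm : 2 ≤ m) (b : Bool) (T : ℕ) :
    (subIface b).Sound O x d m (subOracle O b) w (SubRep O m e cM b w)
      (fun c => (c.out.length + 1).size ≤ m) (fun c => b = true → GoodQuery O d m T c)
      ((T + 2) * (subIface b).query.cost) where
  get e h := by rw [subIface, Expr.eval_stamped, h.reg]
  inp {s c} e h := by
    have hl := h.lenInp
    have hi := h.inp (e.eval x s)
    by_cases hlt : e.eval x s < w.length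
    · have h0 : s.mem 0 (inLen b) - e.eval x s ≠ 0 := by omega
      simp only [subIface, Expr.eval, h0, if_false, hi hlt]
    · have h0 : s.mem 0 (inLen b) - e.eval x s = 0 := by omega
      rw [List.getElem?_eq_none (by omega)]
      simp only [subIface, Expr.eval, h0, if_true, symbolCode]
  ans h := h.ans
  pc h := h.pc
  setAddr h hv := h.setScratch (by simp) hv
  setValue h hv := h.setScratch (by simp) hv
  setPC h hv := h.setPC hv
  put {s c} h hv := by
    have e1 := Exec.write (O := O) (x := x) (d := d) (s := s) (e := .var 14) (f := .var 15) 3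
    have e2 := Exec.write (O := O) (x := x) (d := d) (s := s.set 3 (s.mem 0 14) (s.mem 0 15))
      (e := .var 14) (f := .var 4) 4
    simp only [Expr.eval] at e1 e2
    rw [State.mem_set, State.mem_set, if_neg (by simp), if_neg (by simp)] at e2
    exact ⟨_, e1.seq e2, h.put hv⟩
  ask {s c} h := by
    have e1 := Exec.write (O := O) (x := x) (d := d) (s := s) (e := .var 14)
      (f := .norm (.var 15)) 5
    have e2 := Exec.write (O := O) (x := x) (d := d)
      (s := s.set 5 (s.mem 0 14) (symbolCode (codeSymbol (s.mem 0 15))))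
      (e := .var 14) (f := .var 4) 6
    rw [Expr.eval_norm] at e1
    simp only [Expr.eval] at e1 e2
    rw [State.mem_set, State.mem_set, if_neg (by simp), if_neg (by simp)] at e2
    exact ⟨_, e1.seq e2, h.ask hm⟩
  print {s c} h hl := by
    have hlen := h.lenOut
    by_cases h0 : s.mem 0 15 = 0
    · refine ⟨s, (Exec.ite_false (by simpa [Expr.eval] using h0) Exec.skip).mono ?_, ?_⟩
      · simp [subIface, Cmd.cost]
      · simpa [h0, codeSymbol] using h
    · obtain ⟨a, ha⟩ : ∃ a, codeSymbol (s.mem 0 15) = some a := by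
        rcases h1 : s.mem 0 15 with _ | _ | _
        · exact absurd h1 h0
        all_goals exact ⟨_, rfl⟩
      have e1 := Exec.write (O := O) (x := x) (d := d) (s := s) (e := .var (outLen b))
        (f := .norm (.var 15)) (outArr b)
      rw [Expr.eval_norm] at e1
      simp only [Expr.eval, hlen, ha] at e1
      have e2 := Exec.write (O := O) (x := x) (d := d)
        (s := s.set (outArr b) c.out.length (symbolCode (some a)))
        (e := .const (outLen b)) (f := .add (.var (outLen b)) (.const 1)) 0
      simp only [Expr.eval] at e2
      rw [State.mem_set, if_neg (by cases b <;> simp [outArr]), hlen] at e2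
      refine ⟨_, (Exec.ite_true (by simpa [Expr.eval] using h0) (e1.seq e2)).mono ?_, ?_⟩
      · simp [subIface, Cmd.cost]
      · rw [ha]
        exact h.print hm hl
  query {s c} h hG := by
    cases b with
    | true => exact exec_cachedQuery h (hG rfl)
    | false =>
      have e1 := Exec.write (O := O) (x := x) (d := d) (s := s) (e := .const 7) (f := .const 0) 0
      refine ⟨_, e1.mono ?_, ?_⟩
      · simp only [subIface, cond_false]
        nlinarith
      · constructor
        case frame => exact h.frame.set (by simp [Expr.eval]) (by simp [Expr.eval])
        case ans => simp [State.mem_set, Expr.eval, subOracle, noOracle]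
        case epoch => simpa [State.mem_set, Expr.eval] using h.epoch
        case running => simpa [State.mem_set, Expr.eval] using h.running
        case reg => simpa [State.mem_set, Expr.eval, State.stamped] using h.reg
        case qreg => simpa [State.mem_set, Expr.eval, State.stamped] using h.qreg
        case pc => simpa [State.mem_set, Expr.eval] using h.pc
        case lenInp => simpa [State.mem_set, Expr.eval, inLen] using h.lenInp
        case lenOut => simpa [State.mem_set, Expr.eval, outLen] using h.lenOut
        case inp => simpa [State.mem_set, Expr.eval, inArr] using h.inp
        case out => simpa [State.mem_set, Expr.eval, outArr] using h.out
        case cur => simp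
        case asked => simp

end


/-! ### General facts about runs -/

section
variable {M : Program} {O : Oracle} {x : Word} {t d : ℕ}

theorem run_succ : run M O x (t + 1) = step M O x (run M O x t) :=
  Function.iterate_succ_apply' ..

theorem run_succ_of_getElem? {I : Instr} (h : M[(run M O x t).pc]? = some I) :
    run M O x (t + 1) = I.exec O x (run M O x t) := by
  rw [run_succ, step, h]

theorem HaltedAt.run_eq (h : HaltedAt M O x t) {t' : ℕ} (ht : t ≤ t') :
    run M O x t' = run M O x t := by
  induction t', ht using Nat.le_induction with
  | base => rfl
  | succ n hn ih => rw [run_succ, ih, step, show M[(run M O x t).pc]? = none from h]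

theorem HaltedAt.mono (h : HaltedAt M O x t) {t' : ℕ} (ht : t ≤ t') : HaltedAt M O x t' := by
  rw [HaltedAt, h.run_eq ht]; exact h

/-- A bound for the program counter and for the numbers in the program. -/
def Program.bound (M : Program) : ℕ := M.length + (M.map Instr.numerals).sum

theorem numerals_le_bound {I : Instr} (h : I ∈ M) : I.numerals ≤ Program.bound M :=
  (List.single_le_sum (by simp) _ (List.mem_map_of_mem h)).trans (Nat.le_add_left ..)

theorem pc_exec_le (I : Instr) (c : Config) : (I.exec O x c).pc ≤ max (c.pc + 1) I.numerals := by
  cases I <;> simp [Instr.exec, Config.set, Config.next, Instr.numerals]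
  split_ifs <;> simp

theorem pc_le_bound : (run M O x t).pc ≤ Program.bound M := by
  induction t with
  | zero => simp [run, startConfig]
  | succ t ih =>
    rcases h : M[(run M O x t).pc]? with _ | I
    · rwa [run_succ, step, h]
    · rw [run_succ_of_getElem? h]
      refine (pc_exec_le I _).trans (max_le ?_ (numerals_le_bound (List.mem_of_getElem? h)))
      have := (List.getElem?_eq_some_iff.1 h).1
      unfold Program.bound
      omega

theorem succ_pc_le_bound {I : Instr} (h : M[(run M O x t).pc]? = some I) :
    (run M O x t).pc + 1 ≤ Program.bound M := by
  have := (List.getElem?_eq_some_iff.1 h).1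
  unfold Program.bound
  omega

theorem length_out_succ_le : (run M O x (t + 1)).out.length ≤ (run M O x t).out.length + 1 := by
  rw [run_succ, step]
  rcases M[(run M O x t).pc]? with _ | I
  · simp
  · cases I <;> simp [Instr.exec, Config.set, Config.next]
    · split_ifs <;> simp

theorem length_out_add_le (s : ℕ) :
    (run M O x (t + s)).out.length ≤ (run M O x t).out.length + s := by
  induction s with
  | zero => simp
  | succ s ih =>
    have := length_out_succ_le (M := M) (O := O) (x := x) (t := t + s)
    rw [← add_assoc]
    omega

theorem length_out_le : (run M O x t).out.length ≤ t := by
  simpa [run, startConfig] using length_out_add_le (M := M) (O := O) (x := x) (t := 0) t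

theorem asked_le (w : Word) : (run M O x t).asked w ≤ t := by
  induction t with
  | zero => simp [run, startConfig]
  | succ t ih =>
    rw [run_succ, step]
    rcases M[(run M O x t).pc]? with _ | I
    · exact ih.trans (Nat.le_succ t)
    · cases I with
      | query =>
        simp only [Instr.exec, Config.next, Function.update_apply]
        split_ifs with h
        · rw [← h]; omega
        · omega
      | jumpZero i l =>
        simp only [Instr.exec]
        split_ifs <;> exact ih.trans (Nat.le_succ t)
      | _ => exact ih.trans (Nat.le_succ t)

/-- Each step fills at most one query register. Hence one of the first `t + 1` is blank, `queryWord`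
is never a junk value, and queries after `t` steps have length at most `t`. This bounds the queries
of `D`, for which `DecidesWithin` demands nothing. -/
theorem exists_support_qreg :
    ∃ S : Finset ℕ, S.card ≤ t ∧ ∀ i ∉ S, (run M O x t).qreg i = none := by
  induction t with
  | zero => exact ⟨∅, by simp, by simp [run, startConfig]⟩
  | succ t ih =>
    obtain ⟨S, hS, h⟩ := ih
    rcases hI : M[(run M O x t).pc]? with _ | I
    · exact ⟨S, by omega, by rwa [run_succ, step, hI]⟩
    · rw [run_succ_of_getElem? hI]
      by_cases hask : ∃ i j, I = .ask i j
      · obtain ⟨i, j, rfl⟩ := hask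
        refine ⟨insert ((run M O x t).reg i) S, (Finset.card_insert_le _ _).trans (by omega), ?_⟩
        intro k hk
        simp only [Finset.mem_insert, not_or] at hk
        simp [Instr.exec, hk.1, h k hk.2]
      · refine ⟨S, by omega, ?_⟩
        cases I <;> simp_all [Instr.exec, Config.set, Config.next]
        split_ifs <;> exact h

theorem exists_qreg_eq_none : ∃ i ≤ t, (run M O x t).qreg i = none := by
  obtain ⟨S, hS, h⟩ := exists_support_qreg (M := M) (O := O) (x := x) (t := t)
  obtain ⟨i, hi, hiS⟩ : ∃ i ∈ Finset.range (t + 1), i ∉ S := by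
    by_contra! hall
    have := Finset.card_le_card hall
    simp at this
    omega
  exact ⟨i, by simpa [Nat.lt_succ_iff] using hi, h i hiS⟩

theorem length_queryWord_le : (run M O x t).queryWord.length ≤ t := by
  obtain ⟨i, hi, h⟩ := exists_qreg_eq_none (M := M) (O := O) (x := x) (t := t)
  have : sInf {i : ℕ | (run M O x t).qreg i = none} ≤ i := Nat.sInf_le h
  simp [Config.queryWord]
  omega

end

/-! ### Runs of subroutines -/

/-- Run the program of a subroutine until it halts. -/
def subRun (b : Bool) (P : Program) : Cmd :=
  .loop (.var 6) ((subIface b).stepCmd P (.assign 6 (.const 0)))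

/-- A bound for the time to simulate one step of a subroutine that runs for at most `T` steps. -/
def subStepTime (b : Bool) (P : Program) (T : ℕ) : ℕ :=
  2 * ((subIface b).stepCmd P (.assign 6 (.const 0))).cost + (T + 2) * (subIface b).query.cost + 12

section
variable {O : Oracle} {x : Word} {d m e : ℕ} {cM : Config} {w : Word} {s : State} {b : Bool}
  {P : Program} {T t : ℕ}

/-- The bound `2 * T + 3` covers cache addresses, including that for the next submission: the
queried word has length at most `T` and was submitted at most `T` times before in this run. -/
theorem exec_subStep (h : SubRep O m e cM b w s (run P (subOracle O b) w t))
    (hr : RegistersBounded P (subOracle O b) w T) (ht : t < T)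
    (hP : ¬ HaltedAt P (subOracle O b) w t) (hd : T ≤ d) (hm : 2 * T + 3 + Program.bound P ≤ m) :
    ∃ s', Exec O x d ((subIface b).stepCmd P (.assign 6 (.const 0))) s
        (2 * ((subIface b).stepCmd P (.assign 6 (.const 0))).cost +
          (T + 2) * (subIface b).query.cost) s' ∧
      SubRep O m e cM b w s' (run P (subOracle O b) w (t + 1)) := by
  have hJ := subIface_sound (O := O) (x := x) (d := d) (m := m) (e := e) (cM := cM) (w := w)
    (by omega : 2 ≤ m) b T
  obtain ⟨I, hI⟩ := Option.ne_none_iff_exists'.1 hP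
  have hpc : ((run P (subOracle O b) w t).pc + 1).size ≤ m :=
    (size_le_self _).trans ((succ_pc_le_bound hI).trans (by omega))
  have hpc' : ((run P (subOracle O b) w (t + 1)).pc).size ≤ m :=
    (size_le_self _).trans (pc_le_bound.trans (by omega))
  have hc := fun i => ((hr t).1 i).trans (by omega : T ≤ m)
  have hc' := fun i => ((hr (t + 1)).1 i).trans (by omega : T ≤ m)
  have hnum : I.numerals.size ≤ m :=
    (size_le_self _).trans ((numerals_le_bound (List.mem_of_getElem? hI)).trans (by omega))
  have hrun := run_succ_of_getElem? hI
  by_cases hout : I = .output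
  · subst hout
    obtain ⟨s', h1, h2⟩ := hJ.block (Rep' := SubRep O m e cM b w) (e := .const 0) (f := .const 0)
      (op := .skip) (n := 0) h (by simp [Expr.eval]) (fun s h => rfl) (by simp)
      (fun s₁ h1 _ _ => ⟨s₁, Exec.skip, h1⟩) (fun s' h' => ⟨h'.pc, h'.setPC hpc⟩)
    obtain ⟨s'', h3, h4⟩ := exec_subOutput h2
    refine ⟨s'', hJ.stepCmd h hI ((h1.seq h3).mono ?_), ?_⟩
    · simp [Iface.instr, Cmd.cost]
    · rw [hrun]; exact h4
  · rw [hrun] at hc' hpc'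
    obtain ⟨s', h1, h2⟩ := hJ.instr hout h ((size_le_self _).trans (by
        have := length_out_le (M := P) (O := subOracle O b) (x := w) (t := t); omega)) (by
        rintro rfl rfl
        -- After the step the answer register holds the oracle's answer, so the register bound of
        -- `D` also bounds that answer.
        have ha := (hr (t + 1)).2
        rw [hrun] at ha
        have hl := length_queryWord_le (M := P) (O := subOracle O true) (x := w) (t := t)
        have hk := asked_le (M := P) (O := subOracle O true) (x := w) (t := t)
          (run P (subOracle O true) w t).queryWord
        refine ⟨?_, by omega, hd, ha.trans hd, ?_, by omega⟩
        · obtain ⟨i, -, hi⟩ :=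
            exists_qreg_eq_none (M := P) (O := subOracle O true) (x := w) (t := t)
          exact ⟨i, hi⟩
        · refine le_trans ?_ (by omega : T + 1 ≤ m)
          rw [Nat.size_le] at ha ⊢
          change O _ _ < _ at ha
          rw [pow_succ]
          have := Nat.one_le_two_pow (n := T)
          omega) hnum hc hc' hpc' hpc
    exact ⟨s', hJ.stepCmd h hI h1, by rw [hrun]; exact h2⟩

theorem exec_subRun_halted (h : SubRep O m e cM b w s (run P (subOracle O b) w t))
    (hh : HaltedAt P (subOracle O b) w t) (ht : t ≤ T) (hm : 2 ≤ m) :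
    ∃ s', Exec O x d (subRun b P) s ((T - t + 2) * subStepTime b P T) (s'.set 0 6 0) ∧
      SubRep O m e cM b w s' (run P (subOracle O b) w T) := by
  have hJ := subIface_sound (O := O) (x := x) (d := d) (m := m) (e := e) (cM := cM) (w := w)
    hm b T
  have e1 : Exec O x d ((subIface b).stepCmd P (.assign 6 (.const 0))) s
      (12 + ((subIface b).stepCmd P (.assign 6 (.const 0))).cost) (s.set 0 6 0) :=
    hJ.stepCmd_dead h hh (Exec.write (e := .const 6) (f := .const 0) 0)
  refine ⟨s, (Exec.loop_step (by simp [Expr.eval, h.running]) e1 (Exec.loop_stop ?_)).mono ?_, ?_⟩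
  · simp [Expr.eval, State.mem_set]
  · have h1 : 2 * subStepTime b P T ≤ (T - t + 2) * subStepTime b P T :=
      Nat.mul_le_mul_right _ (by omega)
    refine le_trans ?_ h1
    have h3 : (Expr.var 6).cost = 9 := rfl
    rw [h3, subStepTime]
    have h4 : 12 ≤ ((subIface b).stepCmd P (.assign 6 (.const 0))).cost :=
      Cmd.cost_le_cost_select_dead (dead := .assign 6 (.const 0))
    omega
  · rw [hh.run_eq ht]; exact h

/-- The final state is described as `s'` with variable `6` cleared because `SubRep` itself requires
this running flag to be `1`. -/
theorem exec_subRun (h : SubRep O m e cM b w s (run P (subOracle O b) w t))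
    (hr : RegistersBounded P (subOracle O b) w T) (ht : t ≤ T)
    (hP : HaltedAt P (subOracle O b) w T) (hd : T ≤ d) (hm : 2 * T + 3 + Program.bound P ≤ m) :
    ∃ s', Exec O x d (subRun b P) s ((T - t + 2) * subStepTime b P T) (s'.set 0 6 0) ∧
      SubRep O m e cM b w s' (run P (subOracle O b) w T) := by
  obtain ⟨k, hk⟩ : ∃ k, T = t + k := ⟨T - t, by omega⟩
  induction k generalizing s t with
  | zero =>
    obtain rfl : T = t := hk
    exact exec_subRun_halted h hP le_rfl (by omega)
  | succ k ih =>
    by_cases hh : HaltedAt P (subOracle O b) w t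
    · exact exec_subRun_halted h hh ht (by omega)
    · obtain ⟨s₁, e1, h1⟩ := exec_subStep (x := x) h hr (by omega) hh hd hm
      obtain ⟨s', e2, h2⟩ := ih h1 (by omega) (by omega)
      refine ⟨s', (Exec.loop_step (by simp [Expr.eval, h.running]) e1 e2).mono ?_, h2⟩
      have h3 : T - t + 2 = (T - (t + 1) + 2) + 1 := by omega
      rw [h3, add_mul _ 1, one_mul]
      have h4 : (Expr.var 6).cost = 9 := rfl
      rw [h4]
      unfold subStepTime
      omega

end

/-! ### Answering a query of the main machine -/

theorem Frame.setEpoch {O : Oracle} {m : ℕ} {c : Config} {s : State} (h : Frame O m c s) {v : ℕ}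
    (hv : v.size ≤ m) (hle : s.mem 0 4 ≤ v) : Frame O m c (s.set 0 4 v) where
  regs := by simpa [State.mem_set] using h.regs
  qregs := by simpa [State.mem_set] using h.qregs
  out := h.out
  pc := by simpa [State.mem_set] using h.pc
  flag := by simpa [State.mem_set] using h.flag
  flag' := by simpa [State.mem_set] using h.flag'
  ans := by simpa [State.mem_set] using h.ans
  cache w j := by rw [State.mem_set, if_neg (by simp)]; exact h.cache w j
  stamp₄ i := by simpa [State.mem_set] using (h.stamp₄ i).trans hle
  stamp₆ i := by simpa [State.mem_set] using (h.stamp₆ i).trans hle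
  stamp₈ i := by simpa [State.mem_set] using (h.stamp₈ i).trans hle
  size := State.size_set h.size hv _ _
  size_ans := h.size_ans

/-- Preparation of a run of a subroutine. -/
def subStart (b : Bool) : Cmd :=
  .seq (.assign 4 (.add (.var 4) (.const 1))) <| .seq (.assign 5 (.const 0)) <|
  .seq (.assign 7 (.const 0)) <| .seq (.assign (outLen b) (.const 0)) <| .assign 6 (.const 1)

section
variable {O : Oracle} {x : Word} {d m e : ℕ} {c : Config} {w : Word} {s : State} {b : Bool}

/-- No stamp exceeds the epoch, so raising it by one makes all stamps outdated and all stamped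
arrays read as zero, in constant time. The cache is not stamped and survives. -/
theorem exec_subStart (h : Frame O m c s) (hm : (s.mem 0 4 + 1).size ≤ m)
    (hl : s.mem 0 (inLen b) = w.length)
    (hi : ∀ i < w.length, s.mem (inArr b) i = symbolCode w[i]?) :
    ∃ s', Exec O x d (subStart b) s (subStart b).cost s' ∧
      SubRep O m (s.mem 0 4 + 1) c b w s' startConfig := by
  have e1 := Exec.write (O := O) (x := x) (d := d) (s := s) (e := .const 4)
    (f := .add (.var 4) (.const 1)) 0
  simp only [Expr.eval] at e1
  refine ⟨_, e1.seq ((Exec.write 0).seq ((Exec.write 0).seq ((Exec.write 0).seq (Exec.write 0)))),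
    ?_⟩
  simp only [Expr.eval]
  have h4 : ∀ i, s.mem 4 i ≠ s.mem 0 4 + 1 := fun i => by have := h.stamp₄ i; omega
  have h6 : ∀ i, s.mem 6 i ≠ s.mem 0 4 + 1 := fun i => by have := h.stamp₆ i; omega
  have h8 : ∀ i, s.mem 8 i ≠ s.mem 0 4 + 1 := fun i => by have := h.stamp₈ i; omega
  have hm1 : (1 : ℕ).size ≤ m := size_le_of_le (by omega) hm
  constructor
  case frame =>
    refine (((((h.setEpoch hm (by omega)).set (by simp) (by simp)).set (by simp) (by simp)).set
      (by simp) (.inl ⟨rfl, ?_⟩)).set hm1 (by simp))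
    cases b <;> simp [outLen]
  case epoch => cases b <;> simp [State.mem_set, outLen]
  case running => simp [State.mem_set]
  case reg => cases b <;> simp [State.stamped, State.mem_set, outLen, h4, startConfig]
  case qreg => cases b <;> simp [State.stamped, State.mem_set, outLen, h6, startConfig, symbolCode]
  case cur => cases b <;> simp [State.stamped, State.mem_set, outLen, h8, startConfig]
  case pc => cases b <;> simp [State.mem_set, outLen, startConfig]
  case ans => cases b <;> simp [State.mem_set, outLen, startConfig]
  case lenOut => cases b <;> simp [State.mem_set, outLen, startConfig]
  case lenInp => cases b <;> simpa [State.mem_set, outLen, inLen] using hl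
  case inp => cases b <;> simpa [State.mem_set, inArr] using hi
  case out => simp [startConfig]
  case asked => simp [startConfig]

/-- Determine the length of the query of the main machine. -/
def queryLength : Cmd :=
  .loop (.mem 2 (.var 8)) (.assign 8 (.add (.var 8) (.const 1)))

theorem exec_queryLength (h : Frame O m c s) (hw : c.qreg w.length = none)
    (hw' : ∀ i (hi : i < w.length), c.qreg i = some w[i]) (hm : w.length ≤ m) {i k : ℕ}
    (hk : w.length = i + k) (hi : s.mem 0 8 = i) :
    ∃ s', Exec O x d queryLength s ((k + 1) * queryLength.cost) s' ∧ Frame O m c s' ∧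
      s'.mem 0 4 = s.mem 0 4 ∧ s'.mem 0 8 = w.length := by
  induction k generalizing i s with
  | zero =>
    refine ⟨s, (Exec.loop_stop ?_).mono ?_, h, rfl, by omega⟩
    · have : i = w.length := by omega
      simp [Expr.eval, h.qregs, hi, this, hw, symbolCode]
    · simp [queryLength, Cmd.cost]; omega
  | succ k ih =>
    have e1 := Exec.write (O := O) (x := x) (d := d) (s := s) (e := .const 8)
      (f := .add (.var 8) (.const 1)) 0
    simp only [Expr.eval, hi] at e1
    obtain ⟨s', e2, h1, h2, h3⟩ := ih
      (h.set (r := 0) (i := 8) ((size_le_self (i + 1)).trans (by omega)) (by simp))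
      (i := i + 1) (by omega) (by simp [State.mem_set])
    refine ⟨s', (Exec.loop_step ?_ e1 e2).mono ?_, h1, ?_, h3⟩
    · simp only [Expr.eval, h.qregs, hi, hw' i (by omega)]
      cases w[i] <;> simp [symbolCode]
    · rw [add_mul (k + 1) 1, add_comm, one_mul]
      exact Nat.add_le_add_left (by simp [queryLength, Cmd.cost]) _
    · rw [h2]; simp [State.mem_set]

/-- Decide the query of the main machine: `F` computes the reduction, `D` decides the problem to
which it leads. -/
def mainQuery (F D : Program) : Cmd :=
  .seq (.assign 8 (.const 0)) <| .seq queryLength <|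
  .seq (subStart false) <| .seq (subRun false F) <|
  .seq (subStart true) <| .seq (subRun true D) <|
  .assign 3 (.cond (.stamped 3 4 (.const 0)) (.const 1) (.const 0))

/-- A bound for the time to decide a query of length at most `l`, if `F` runs for at most `T₁` and
`D` for at most `T₂` steps. -/
def mainQueryTime (F D : Program) (l T₁ T₂ : ℕ) : ℕ :=
  (mainQuery F D).cost + (l + 1) * queryLength.cost + (T₁ + 2) * subStepTime false F T₁ +
    (T₂ + 2) * subStepTime true D T₂

/-- Two subroutines are started, so the epoch grows by `2`. The counts `a` are arbitrary: a decision
oracle does not depend on them, and the frame does not record those of the main machine. -/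
theorem exec_mainQuery {F D : Program} {l T₁ T₂ : ℕ} {y : Word} {p : Prop} [Decidable p]
    (h : Frame O m c s) (hw : c.qreg w.length = none)
    (hw' : ∀ i (hi : i < w.length), c.qreg i = some w[i]) (hl : w.length ≤ l)
    (hF : ComputesWithin F noOracle w y T₁) (hD : DecidesWithin D O y p T₂)
    (hd₁ : T₁ ≤ d) (hd₂ : T₂ ≤ d) (hm : l ≤ m)
    (hm₁ : 2 * T₁ + 3 + Program.bound F ≤ m) (hm₂ : 2 * T₂ + 3 + Program.bound D ≤ m)
    (he : (s.mem 0 4 + 2).size ≤ m) (a : Word → ℕ) :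
    ∃ s', Exec O x d (mainQuery F D) s (mainQueryTime F D l T₁ T₂) s' ∧
      Frame O m { c with ans := if p then 1 else 0, asked := a } s' ∧
      s'.mem 0 4 = s.mem 0 4 + 2 := by
  have e1 := Exec.write (O := O) (x := x) (d := d) (s := s) (e := .const 8) (f := .const 0) 0
  simp only [Expr.eval] at e1
  obtain ⟨s₁, e2, h1, ep1, hl1⟩ := exec_queryLength (x := x) (d := d)
    (h.set (r := 0) (i := 8) (v := 0) (by simp) (by simp)) hw hw' (hl.trans hm)
    (i := 0) (k := w.length) (by simp) (by simp [State.mem_set])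
  rw [State.mem_set, if_neg (by simp)] at ep1
  obtain ⟨s₂, e3, h2⟩ := exec_subStart (b := false) (x := x) (d := d) (w := w) h1
    (size_le_of_le (by omega) he) hl1 (fun i hi => by
      rw [List.getElem?_eq_getElem hi, ← hw' i hi]
      exact h1.qregs i)
  rw [ep1] at h2
  obtain ⟨s₃, e4, h3⟩ := exec_subRun (x := x) (P := F) (T := T₁) (t := 0) h2 hF.2.2 (by simp) hF.1
    hd₁ hm₁
  have hy : (run F (subOracle O false) w T₁).out = y := hF.2.1
  have ho := h3.out
  have hol := h3.lenOut
  rw [hy] at ho hol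
  have f3 : Frame O m c (s₃.set 0 6 0) := h3.frame.set (by simp) (by simp)
  have ep3 : (s₃.set 0 6 0).mem 0 4 = s.mem 0 4 + 1 := by
    rw [State.mem_set, if_neg (by simp), h3.epoch]
  obtain ⟨s₄, e5, h4⟩ := exec_subStart (b := true) (x := x) (d := d) (w := y) f3
    (by rw [ep3]; exact he) (by simpa [State.mem_set, inLen, outLen] using hol)
    (by simpa [State.mem_set, inArr, outArr] using ho)
  rw [ep3] at h4
  obtain ⟨s₅, e6, h5⟩ := exec_subRun (x := x) (P := D) (T := T₂) (t := 0) h4 hD.2.2 (by simp) hD.1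
    hd₂ hm₂
  have f5 : Frame O m c (s₅.set 0 6 0) := h5.frame.set (by simp) (by simp)
  have ep5 : s₅.mem 0 4 = s.mem 0 4 + 2 := h5.epoch
  have hreg : (s₅.set 0 6 0).stamped 3 4 0 = (run D O y T₂).reg 0 := by
    rw [show run D O y T₂ = run D (subOracle O true) y T₂ from rfl, ← h5.reg]
    simp [State.stamped, State.mem_set]
  have e7 := Exec.write (O := O) (x := x) (d := d) (s := s₅.set 0 6 0) (e := .const 3)
    (f := .cond (.stamped 3 4 (.const 0)) (.const 1) (.const 0)) 0
  have hv : Expr.eval x (s₅.set 0 6 0) (.cond (.stamped 3 4 (.const 0)) (.const 1) (.const 0)) =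
      if p then 1 else 0 := by
    have := hD.2.1
    by_cases hp : p
    · simp [Expr.eval, Expr.eval_stamped, hreg, hp, this.1 hp]
    · have : (run D O y T₂).reg 0 = 0 := by by_contra h0; exact hp (this.2 h0)
      simp [Expr.eval, Expr.eval_stamped, hreg, hp, this]
  rw [hv] at e7
  simp only [Expr.eval] at e7
  refine ⟨_, (e1.seq (e2.seq (e3.seq (e4.seq (e5.seq (e6.seq e7)))))).mono ?_, ?_, ?_⟩
  · have h1 : (w.length + 1) * queryLength.cost ≤ (l + 1) * queryLength.cost :=
      Nat.mul_le_mul_right _ (by omega)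
    rw [mainQueryTime, mainQuery]
    simp only [Cmd.cost_seq, Cmd.assign, Nat.sub_zero]
    generalize (w.length + 1) * queryLength.cost = a1 at *
    generalize (l + 1) * queryLength.cost = a2 at *
    generalize (T₁ + 2) * subStepTime false F T₁ = a3 at *
    generalize (T₂ + 2) * subStepTime true D T₂ = a4 at *
    omega
  · constructor
    case ans => simp [State.mem_set]
    case size =>
      refine State.size_set f5.size (size_le_of_le (b := 1) (by split_ifs <;> simp) ?_) _ _
      exact (size_le_self 1).trans (by omega)
    case size_ans => exact f5.size_ans
    case out => exact f5.out
    case cache => intro w j; rw [State.mem_set, if_neg (by simp)]; exact f5.cache w j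
    case regs => simpa [State.mem_set] using f5.regs
    case qregs => simpa [State.mem_set] using f5.qregs
    case pc => simpa [State.mem_set] using f5.pc
    case flag => simpa [State.mem_set] using f5.flag
    case flag' => simpa [State.mem_set] using f5.flag'
    case stamp₄ => simpa [State.mem_set] using f5.stamp₄
    case stamp₆ => simpa [State.mem_set] using f5.stamp₆
    case stamp₈ => simpa [State.mem_set] using f5.stamp₈
  · simpa [State.mem_set] using ep5

end


/-! ### Simulation of the main machine -/

/-- The access to the main machine. -/
def mainIface (F D : Program) : Iface where
  get := .mem 1
  inp := .input
  put := .write 1 (.var 14) (.var 15)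
  ask := .write 2 (.var 14) (.norm (.var 15))
  print := .print (.var 15)
  query := mainQuery F D
  output := .seq (.assign 1 (.const 1)) (.assign 2 (.const 1))
  pc := 0
  ans := 3

section
variable {O : Oracle} {x : Word} {d m e : ℕ} {c : Config} {s : State}

theorem Frame.setPC (h : Frame O m c s) {v : ℕ} (hv : v.size ≤ m) :
    Frame O m { c with pc := v } (s.set 0 0 v) where
  regs := by simpa [State.mem_set] using h.regs
  qregs := by simpa [State.mem_set] using h.qregs
  out := h.out
  pc := by simp [State.mem_set]
  flag := by simpa [State.mem_set] using h.flag
  flag' := by simpa [State.mem_set] using h.flag'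
  ans := by simpa [State.mem_set] using h.ans
  cache w j := by rw [State.mem_set, if_neg (by simp)]; exact h.cache w j
  stamp₄ := by simpa [State.mem_set] using h.stamp₄
  stamp₆ := by simpa [State.mem_set] using h.stamp₆
  stamp₈ := by simpa [State.mem_set] using h.stamp₈
  size := State.size_set h.size hv _ _
  size_ans := h.size_ans

theorem Frame.put (h : Frame O m c s) {i v : ℕ} (hv : v.size ≤ m) :
    Frame O m { c with reg := Function.update c.reg i v } (s.set 1 i v) where
  regs j := by
    have := h.regs j
    simp only [State.mem_set, Function.update_apply]
    split_ifs <;> simp_all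
  qregs := by simpa [State.mem_set] using h.qregs
  out := h.out
  pc := by simpa [State.mem_set] using h.pc
  flag := by simpa [State.mem_set] using h.flag
  flag' := by simpa [State.mem_set] using h.flag'
  ans := by simpa [State.mem_set] using h.ans
  cache w j := by rw [State.mem_set, if_neg (by simp)]; exact h.cache w j
  stamp₄ := by simpa [State.mem_set] using h.stamp₄
  stamp₆ := by simpa [State.mem_set] using h.stamp₆
  stamp₈ := by simpa [State.mem_set] using h.stamp₈
  size := State.size_set h.size hv _ _
  size_ans := h.size_ans

theorem Frame.ask (h : Frame O m c s) {i : ℕ} {a : Option Bool} (hm : 2 ≤ m) :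
    Frame O m { c with qreg := Function.update c.qreg i a } (s.set 2 i (symbolCode a)) where
  regs := by simpa [State.mem_set] using h.regs
  qregs j := by
    have := h.qregs j
    simp only [State.mem_set, Function.update_apply]
    split_ifs <;> simp_all
  out := h.out
  pc := by simpa [State.mem_set] using h.pc
  flag := by simpa [State.mem_set] using h.flag
  flag' := by simpa [State.mem_set] using h.flag'
  ans := by simpa [State.mem_set] using h.ans
  cache w j := by rw [State.mem_set, if_neg (by simp)]; exact h.cache w j
  stamp₄ := by simpa [State.mem_set] using h.stamp₄
  stamp₆ := by simpa [State.mem_set] using h.stamp₆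
  stamp₈ := by simpa [State.mem_set] using h.stamp₈
  size := State.size_set h.size (size_symbolCode_le hm a) _ _
  size_ans := h.size_ans

theorem Frame.print (h : Frame O m c s) (y : Word) :
    Frame O m { c with out := c.out ++ y } { s with out := s.out ++ y } := by
  obtain ⟨a1, a2, a3, a4, a5, a6, a7, a8, a9, a10, a11, a12, a13⟩ := h
  exact ⟨a1, a2, by simp [a3], a4, a5, a6, a7, a8, a9, a10, a11, a12, a13⟩

/-- The two flags and the printed word may be changed. -/
theorem Frame.changeFlags (h : Frame O m c s) {s' : State}
    (hmem : ∀ r i, r ≠ 0 ∨ (i ≠ 1 ∧ i ≠ 2) → s'.mem r i = s.mem r i) (h1 : s'.mem 0 1 = 0)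
    (h2 : s'.mem 0 2 = 0) (ha : s'.asked = s.asked) (ha' : s'.ans = s.ans) :
    Frame O m { c with out := s'.out } s' where
  regs i := by rw [hmem _ _ (.inl (by simp))]; exact h.regs i
  qregs i := by rw [hmem _ _ (.inl (by simp))]; exact h.qregs i
  out := rfl
  pc := by rw [hmem _ _ (.inr (by simp))]; exact h.pc
  flag := h1
  flag' := h2
  ans := by rw [hmem _ _ (.inr (by simp))]; exact h.ans
  cache w j := by rw [hmem _ _ (.inl (by simp)), ha]; exact h.cache w j
  stamp₄ i := by rw [hmem _ _ (.inl (by simp)), hmem _ _ (.inr (by simp))]; exact h.stamp₄ i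
  stamp₆ i := by rw [hmem _ _ (.inl (by simp)), hmem _ _ (.inr (by simp))]; exact h.stamp₆ i
  stamp₈ i := by rw [hmem _ _ (.inl (by simp)), hmem _ _ (.inr (by simp))]; exact h.stamp₈ i
  size r i := by
    by_cases hr : r ≠ 0 ∨ (i ≠ 1 ∧ i ≠ 2)
    · rw [hmem _ _ hr]; exact h.size r i
    · push Not at hr
      obtain ⟨rfl, hi⟩ := hr
      by_cases hi1 : i = 1
      · rw [hi1, h1]; simp
      · rw [hi hi1, h2]; simp
  size_ans := by rw [ha']; exact h.size_ans

/-- The memory represents the configuration `c` of the main machine, `e` runs of subroutines have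
been simulated, and the flags are down. -/
def MainRep (O : Oracle) (m e : ℕ) (s : State) (c : Config) : Prop :=
  Frame O m c s ∧ s.mem 0 4 = e

/-- Queries are excluded here, since they change the epoch `e` that the representation fixes;
`exec_mainStep` deals with them. -/
theorem mainIface_sound (hm : 2 ≤ m) (F D : Program) (OV : Oracle) :
    (mainIface F D).Sound O x d m OV x (MainRep O m e) (fun _ => True) (fun _ => False) 0 where
  get f h := h.1.regs _
  inp f h := rfl
  ans h := h.1.ans
  pc h := h.1.pc
  setAddr h hv := ⟨h.1.set hv (by simp), by simpa [State.mem_set] using h.2⟩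
  setValue h hv := ⟨h.1.set hv (by simp), by simpa [State.mem_set] using h.2⟩
  setPC h hv := ⟨h.1.setPC hv, by simpa [State.mem_set, mainIface] using h.2⟩
  put {s c} h hv :=
    ⟨_, Exec.write 1, h.1.put hv, by simpa [State.mem_set] using h.2⟩
  ask {s c} h := by
    refine ⟨_, Exec.write 2, ?_, by simpa [State.mem_set] using h.2⟩
    rw [Expr.eval_norm]
    exact h.1.ask hm
  print {s c} h _ := ⟨_, Exec.print, h.1.print _, h.2⟩
  query _ h := h.elim

/-- Between two steps of the main machine, the memory represents its configuration `c`, whatever the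
flags are. -/
structure Inv (O : Oracle) (m e : ℕ) (s : State) (c : Config) : Prop where
  rep : MainRep O m e ((s.set 0 1 0).set 0 2 0) c
  size : ∀ r i, (s.mem r i).size ≤ m
  size_ans : s.ans.size ≤ m

theorem MainRep.inv (h : MainRep O m e s c) : Inv O m e s c where
  rep := by
    refine ⟨?_, by simpa [State.mem_set] using h.2⟩
    have := h.1.changeFlags (s' := (s.set 0 1 0).set 0 2 0)
      (by simp [State.mem_set]; grind) (by simp [State.mem_set]) (by simp [State.mem_set]) rfl rfl
    rwa [show ((s.set 0 1 0).set 0 2 0).out = c.out from h.1.out] at this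
  size := h.1.size
  size_ans := h.1.size_ans

theorem MainRep.inv_output (h : MainRep O m e s c) (hm : 1 ≤ m) :
    Inv O m e { ((s.set 0 1 1).set 0 2 1) with out := [] } { c with out := [] } where
  rep := by
    refine ⟨?_, by simpa [State.mem_set] using h.2⟩
    exact h.1.changeFlags
      (s' := (State.set { ((s.set 0 1 1).set 0 2 1) with out := [] } 0 1 0).set 0 2 0)
      (by simp [State.mem_set]; grind) (by simp [State.mem_set]) (by simp [State.mem_set]) rfl rfl
  size := State.size_set (State.size_set h.1.size (by simpa using hm) _ _) (by simpa using hm) _ _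
  size_ans := h.1.size_ans

/-- One step of the main machine. Flag `1` is raised if it has halted or outputs a word, and flag
`2` in the second case. -/
def mainStep (M F D : Program) : Cmd :=
  .seq (.assign 1 (.const 0)) <| .seq (.assign 2 (.const 0)) <|
    (mainIface F D).stepCmd M (.assign 1 (.const 1))

/-- What is needed for the simulation of `M` with oracle `L` on input `x` by a machine with oracle
`O`: the numbers of digits and the lengths of queries are bounded by `q`, and for queries of at
most this length, `F` computes in time `T₁` a word from which `D` decides in time `T₂` whether the
query belongs to `L`. -/
structure Setting (O : Oracle) (L : DecProblem) (M F D : Program) (x : Word) (q T₁ T₂ d m : ℕ) :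
    Prop where
  regs : RegistersBounded M (decOracle L) x q
  queries : ∀ t w, QueriesAt M (decOracle L) x t w → w.length ≤ q
  decides : ∀ w : Word, w.length ≤ q → ∃ y, ComputesWithin F noOracle w y T₁ ∧
    DecidesWithin D O y (w ∈ L) T₂
  le₁ : T₁ ≤ d
  le₂ : T₂ ≤ d
  bound_main : 2 * q + 4 + Program.bound M ≤ m
  bound₁ : 2 * T₁ + 3 + Program.bound F ≤ m
  bound₂ : 2 * T₂ + 3 + Program.bound D ≤ m

/-- A bound for the time to simulate one step. -/
def mainStepTime (M F D : Program) (q T₁ T₂ : ℕ) : ℕ :=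
  2 * (mainStep M F D).cost + mainQueryTime F D q T₁ T₂

variable {L : DecProblem} {M F D : Program} {q T₁ T₂ t : ℕ}

/-- The `24` steps lower the two flags. -/
theorem exec_mainStep_of {s' : State} {n : ℕ}
    (he : Exec O x d ((mainIface F D).stepCmd M (.assign 1 (.const 1)))
      ((s.set 0 1 0).set 0 2 0) n s') :
    Exec O x d (mainStep M F D) s (24 + n) s' := by
  refine ((Exec.write 0).seq ((Exec.write 0).seq he)).mono ?_
  simp [Cmd.cost, Expr.cost]
  omega

theorem cost_mainStep : (mainStep M F D).cost =
    24 + ((mainIface F D).stepCmd M (.assign 1 (.const 1))).cost := by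
  simp [mainStep, Cmd.cost, Expr.cost]
  omega

theorem exec_mainStep_halted (h : Inv O m e s (run M (decOracle L) x t)) (hm : 2 ≤ m)
    (hh : HaltedAt M (decOracle L) x t) :
    ∃ s', Exec O x d (mainStep M F D) s (mainStepTime M F D q T₁ T₂) s' ∧
      s'.mem 0 1 = 1 ∧ s'.mem 0 2 = 0 := by
  have hJ := mainIface_sound (O := O) (x := x) (d := d) (e := e) hm F D (decOracle L)
  have e1 : Exec O x d ((mainIface F D).stepCmd M (.assign 1 (.const 1)))
      ((s.set 0 1 0).set 0 2 0) (12 + ((mainIface F D).stepCmd M (.assign 1 (.const 1))).cost)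
      (((s.set 0 1 0).set 0 2 0).set 0 1 1) :=
    hJ.stepCmd_dead h.rep hh (Exec.write (e := .const 1) (f := .const 1) 0)
  refine ⟨_, (exec_mainStep_of e1).mono ?_, by simp [State.mem_set], by simp [State.mem_set]⟩
  rw [mainStepTime, cost_mainStep]
  omega

/-- The simulated output only raises both flags. The true output instruction stands behind the code
of `mainStep`, since commands have to be quiet; it empties the printed word, hence the invariant for
the emptied one. -/
theorem exec_mainStep_output (hS : Setting O L M F D x q T₁ T₂ d m)
    (h : Inv O m e s (run M (decOracle L) x t))
    (hI : M[(run M (decOracle L) x t).pc]? = some .output) :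
    ∃ s', Exec O x d (mainStep M F D) s (mainStepTime M F D q T₁ T₂) s' ∧
      s'.mem 0 1 = 1 ∧ s'.mem 0 2 = 1 ∧ s'.out = (run M (decOracle L) x t).out ∧
      (∀ r i, (s'.mem r i).size ≤ m) ∧
      Inv O m e { s' with out := [] } (run M (decOracle L) x (t + 1)) := by
  have hm := hS.bound_main
  have hJ := mainIface_sound (O := O) (x := x) (d := d) (e := e) (by omega : 2 ≤ m) F D
    (decOracle L)
  have hpc : ((run M (decOracle L) x t).pc + 1).size ≤ m :=
    (size_le_self _).trans ((succ_pc_le_bound hI).trans (by omega))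
  obtain ⟨s₁, h1, h2⟩ := hJ.block (Rep' := MainRep O m e) (e := .const 0) (f := .const 0)
    (op := .skip) (n := 0) h.rep (by simp [Expr.eval]) (fun s h => rfl) (by simp)
    (fun s₁ h1 _ _ => ⟨s₁, Exec.skip, h1⟩) (fun s' h' => ⟨h'.1.pc, hJ.setPC h' hpc⟩)
  have e3 : Exec O x d (mainIface F D).output s₁ (mainIface F D).output.cost
      ((s₁.set 0 1 1).set 0 2 1) := (Exec.write 0).seq (Exec.write 0)
  have hi := h2.inv_output (by omega)
  refine ⟨_, (exec_mainStep_of (hJ.stepCmd (n := 0) h.rep hI ((h1.seq e3).mono ?_))).mono ?_,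
    by simp [State.mem_set], by simp [State.mem_set], h2.1.out, hi.size, ?_⟩
  · simp [Iface.instr, Cmd.cost]
  · rw [mainStepTime, cost_mainStep]; omega
  · rw [run_succ_of_getElem? hI]
    exact hi

theorem exec_mainStep (hS : Setting O L M F D x q T₁ T₂ d m)
    (h : Inv O m e s (run M (decOracle L) x t)) (he : (e + 2).size ≤ m) {I : Instr}
    (hI : M[(run M (decOracle L) x t).pc]? = some I) (hout : I ≠ .output) :
    ∃ s', Exec O x d (mainStep M F D) s (mainStepTime M F D q T₁ T₂) s' ∧
      s'.mem 0 1 = 0 ∧ ∃ e' ≤ e + 2, Inv O m e' s' (run M (decOracle L) x (t + 1)) := by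
  classical
  have hm := hS.bound_main
  have hJ := mainIface_sound (O := O) (x := x) (d := d) (e := e) (by omega : 2 ≤ m) F D
    (decOracle L)
  have hpc : ((run M (decOracle L) x t).pc + 1).size ≤ m :=
    (size_le_self _).trans ((succ_pc_le_bound hI).trans (by omega))
  have hrun := run_succ_of_getElem? hI
  by_cases hq : I = .query
  · subst hq
    have hblank : ∃ i, (run M (decOracle L) x t).qreg i = none := by
      obtain ⟨i, -, hi⟩ := exists_qreg_eq_none (M := M) (O := decOracle L) (x := x) (t := t)
      exact ⟨i, hi⟩
    obtain ⟨hw, hw'⟩ := Config.queryWord_spec hblank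
    have hlen := hS.queries t _ ⟨hI, rfl⟩
    obtain ⟨y, hF, hD⟩ := hS.decides _ hlen
    have hJ' := mainIface_sound (O := O) (x := x) (d := d) (e := e + 2) (by omega : 2 ≤ m) F D
      (decOracle L)
    obtain ⟨s', h1, h2⟩ := hJ.block (Rep' := MainRep O m (e + 2)) (e := .const 0) (f := .const 0)
      (op := mainQuery F D) (n := mainQueryTime F D q T₁ T₂)
      (c' := { run M (decOracle L) x t with
        ans := decOracle L (run M (decOracle L) x t).queryWord
          ((run M (decOracle L) x t).asked (run M (decOracle L) x t).queryWord)
        asked := Function.update (run M (decOracle L) x t).asked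
          (run M (decOracle L) x t).queryWord
          ((run M (decOracle L) x t).asked (run M (decOracle L) x t).queryWord + 1) })
      h.rep (by simp [Expr.eval]) (fun s h => rfl) (by simp)
      (fun s₁ h1 _ _ => by
        obtain ⟨s', e1, e2, e3⟩ := exec_mainQuery (x := x) h1.1 hw hw' hlen hF hD hS.le₁ hS.le₂
          (by omega) hS.bound₁ hS.bound₂ (by rw [h1.2]; exact he)
          (Function.update (run M (decOracle L) x t).asked (run M (decOracle L) x t).queryWord
          ((run M (decOracle L) x t).asked (run M (decOracle L) x t).queryWord + 1))
        refine ⟨s', e1, ?_, by rw [e3, h1.2]⟩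
        convert e2 using 2
        simp [decOracle])
      (fun s' h' => ⟨h'.1.pc, hJ'.setPC h' hpc⟩)
    refine ⟨s', (exec_mainStep_of (hJ.stepCmd (n := mainQueryTime F D q T₁ T₂)
      h.rep hI (h1.mono ?_))).mono ?_, h2.1.flag,
      e + 2, le_rfl, ?_⟩
    · exact Nat.add_le_add_right (by simp [Iface.instr, Iface.block, Cmd.cost]) _
    · rw [mainStepTime, cost_mainStep]; omega
    · rw [hrun]
      exact h2.inv
  · have hpc' : ((run M (decOracle L) x (t + 1)).pc).size ≤ m :=
      (size_le_self _).trans (pc_le_bound.trans (by omega))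
    have hc := fun i => ((hS.regs t).1 i).trans (by omega : q ≤ m)
    have hc' := fun i => ((hS.regs (t + 1)).1 i).trans (by omega : q ≤ m)
    have hnum : I.numerals.size ≤ m :=
      (size_le_self _).trans ((numerals_le_bound (List.mem_of_getElem? hI)).trans (by omega))
    rw [hrun] at hc' hpc'
    obtain ⟨s', h1, h2⟩ := hJ.instr hout h.rep trivial (fun h => hq h) hnum hc hc' hpc' hpc
    refine ⟨s', (exec_mainStep_of (hJ.stepCmd h.rep hI h1)).mono ?_, h2.1.flag, e, by omega, ?_⟩
    · rw [mainStepTime, cost_mainStep]; omega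
    · rw [hrun]
      exact h2.inv

end


/-! ### The simulating machine -/

section
variable {O : Oracle} {x : Word} {d m k : ℕ} {c : Config} {P : Program}

/-- In one step, register contents grow by at most one digit. -/
theorem size_exec_le {I : Instr} (hc : ∀ i, (c.reg i).size ≤ k) (ha : c.ans.size ≤ k)
    (hI : I.numerals.size ≤ k) (hk : 2 ≤ k)
    (hq : I = .query → (O c.queryWord (c.asked c.queryWord)).size ≤ k) :
    (∀ i, ((I.exec O x c).reg i).size ≤ k + 1) ∧ (I.exec O x c).ans.size ≤ k + 1 := by
  have hset : ∀ i v, v.size ≤ k + 1 →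
      (∀ j, ((c.set i v).reg j).size ≤ k + 1) ∧ (c.set i v).ans.size ≤ k + 1 := by
    intro i v hv
    refine ⟨fun j => ?_, ha.trans (Nat.le_succ k)⟩
    simp only [Config.set, Function.update_apply]
    split_ifs
    exacts [hv, (hc j).trans (Nat.le_succ k)]
  have hkeep : ∀ v : ℕ, v.size ≤ k → v.size ≤ k + 1 := fun v h => h.trans (Nat.le_succ k)
  cases I with
  | const i n => exact hset _ _ (hkeep _ (size_le_of_le (by simp [Instr.numerals]) hI))
  | add i j l =>
    refine hset _ _ ?_
    have h1 := hc j
    have h2 := hc l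
    rw [Nat.size_le] at *
    rw [pow_succ]
    omega
  | sub i j l => exact hset _ _ (hkeep _ (size_le_of_le (Nat.sub_le ..) (hc j)))
  | half i j => exact hset _ _ (hkeep _ (size_le_of_le (Nat.div_le_self ..) (hc j)))
  | load i j => exact hset _ _ (hkeep _ (hc _))
  | store i j => exact hset _ _ (hkeep _ (hc _))
  | input i j => exact hset _ _ (hkeep _ (size_symbolCode_le hk _))
  | answer i => exact hset _ _ (hkeep _ ha)
  | query => exact ⟨fun i => hkeep _ (hc i), hkeep _ (hq rfl)⟩
  | jumpZero i l =>
    simp only [Instr.exec]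
    split_ifs <;> exact ⟨fun i => hkeep _ (hc i), hkeep _ ha⟩
  | _ => exact ⟨fun i => hkeep _ (hc i), hkeep _ ha⟩

/-- With this the temporary values of compiled code need no bookkeeping: starting from contents of
`m` digits, `n` steps lead to at most `m + n`. -/
theorem size_iterate_step_le (hc : ∀ i, (c.reg i).size ≤ m) (ha : c.ans.size ≤ m)
    (hP : Program.bound P ≤ m) (hm : 2 ≤ m) (hd : d ≤ m) {n : ℕ}
    (hq : ∀ j < n, P[((step P O x)^[j] c).pc]? = some .query →
      (O ((step P O x)^[j] c).queryWord
        (((step P O x)^[j] c).asked ((step P O x)^[j] c).queryWord)).size ≤ d) :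
    (∀ i, (((step P O x)^[n] c).reg i).size ≤ m + n) ∧
      ((step P O x)^[n] c).ans.size ≤ m + n := by
  induction n with
  | zero => exact ⟨hc, ha⟩
  | succ n ih =>
    obtain ⟨h1, h2⟩ := ih fun j hj => hq j (by omega)
    rw [Function.iterate_succ_apply', step]
    rcases hI : P[((step P O x)^[n] c).pc]? with _ | I
    · exact ⟨fun i => (h1 i).trans (by omega), h2.trans (by omega)⟩
    · refine size_exec_le (k := m + n) h1 h2 ((size_le_self _).trans
        ((numerals_le_bound (List.mem_of_getElem? hI)).trans (by omega))) (by omega) ?_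
      rintro rfl
      exact (hq n (by omega) hI).trans (by omega)

end

/-- The machine that simulates `M`. -/
def mainProgram (M F D : Program) : Program :=
  (mainStep M F D).code 0 ++
    [.jumpZero 17 0, .jumpZero 33 ((mainStep M F D).cost + 4), .output, .jump 0]

section
variable {O : Oracle} {x : Word} {d m e : ℕ} {s s' : State} {L : DecProblem} {M F D : Program}
  {q T₁ T₂ t N : ℕ}

theorem mainProgram_codeAt : CodeAt (mainProgram M F D) 0 ((mainStep M F D).code 0) ∧
    (mainProgram M F D)[(mainStep M F D).cost]? = some (.jumpZero 17 0) ∧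
    (mainProgram M F D)[(mainStep M F D).cost + 1]? =
      some (.jumpZero 33 ((mainStep M F D).cost + 4)) ∧
    (mainProgram M F D)[(mainStep M F D).cost + 2]? = some .output ∧
    (mainProgram M F D)[(mainStep M F D).cost + 3]? = some (.jump 0) ∧
    (mainProgram M F D)[(mainStep M F D).cost + 4]? = none := by
  have h : CodeAt (mainProgram M F D) 0 ((mainStep M F D).code 0 ++
      [.jumpZero 17 0, .jumpZero 33 ((mainStep M F D).cost + 4), .output, .jump 0]) :=
    fun i _ => by rw [Nat.zero_add]; rfl
  rw [codeAt_append, Cmd.length_code, codeAt_cons, codeAt_cons, codeAt_cons, codeAt_cons,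
    Nat.zero_add] at h
  obtain ⟨h1, h2, h3, h4, h5, -⟩ := h
  exact ⟨h1, h2, h3, h4, h5, by simp [mainProgram, Cmd.length_code]⟩

/-- The two extra steps are the tests of the flags, which lead to the next simulated step, to the
end of the program, or to the output instruction. -/
theorem seg_mainProgram (h : Exec O x d (mainStep M F D) s N s') :
    ∃ n, 1 ≤ n ∧ n ≤ N + 2 ∧
      (step (mainProgram M F D) O x)^[n] (s.config 0) = s'.config (if s'.mem 0 1 = 0 then 0 else
        if s'.mem 0 2 = 0 then (mainStep M F D).cost + 4 else (mainStep M F D).cost + 2) ∧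
      ∀ j < n, Quiet (mainProgram M F D) O d
        ((step (mainProgram M F D) O x)^[j] (s.config 0)) := by
  obtain ⟨hc, h1, h2, -⟩ := mainProgram_codeAt (M := M) (F := F) (D := D)
  obtain ⟨k, hk, hs, hq⟩ := h _ 0 hc
  rw [Nat.zero_add] at hs
  -- Registers `17` and `33` are the places of variables `1` and `2`, the two flags.
  have p1 : s'.phys 17 = s'.mem 0 1 := s'.phys_addr 0 1
  have p2 : s'.phys 33 = s'.mem 0 2 := s'.phys_addr 0 2
  have q1 : Quiet (mainProgram M F D) O d (s'.config (mainStep M F D).cost) :=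
    quiet_of_ne (I := .jumpZero 17 0) h1 (by simp) (by simp)
  have q2 : Quiet (mainProgram M F D) O d (s'.config ((mainStep M F D).cost + 1)) :=
    quiet_of_ne (I := .jumpZero 33 ((mainStep M F D).cost + 4)) h2 (by simp) (by simp)
  have e1 : (step (mainProgram M F D) O x)^[k + 1] (s.config 0) =
      s'.config (if s'.mem 0 1 = 0 then 0 else (mainStep M F D).cost + 1) := by
    rw [Function.iterate_succ_apply', hs, step,
      show (mainProgram M F D)[(s'.config (mainStep M F D).cost).pc]? = _ from h1]
    by_cases h0 : s'.mem 0 1 = 0 <;>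
      simp [Instr.exec, State.config, State.withReg, p1, h0, Config.next]
  have hq1 : ∀ j < k + 1, Quiet (mainProgram M F D) O d
      ((step (mainProgram M F D) O x)^[j] (s.config 0)) := by
    intro j hj
    rcases Nat.lt_succ_iff_lt_or_eq.1 hj with hj | rfl
    · exact hq j hj
    · rwa [hs]
  by_cases h0 : s'.mem 0 1 = 0
  · rw [if_pos h0] at e1 ⊢
    exact ⟨k + 1, by omega, by omega, e1, hq1⟩
  · rw [if_neg h0] at e1 ⊢
    refine ⟨k + 2, by omega, by omega, ?_, ?_⟩
    · rw [Function.iterate_succ_apply', e1, step,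
        show (mainProgram M F D)[(s'.config ((mainStep M F D).cost + 1)).pc]? = _ from h2]
      by_cases h0 : s'.mem 0 2 = 0 <;>
        simp [Instr.exec, State.config, State.withReg, p2, h0, Config.next]
    · intro j hj
      rcases Nat.lt_succ_iff_lt_or_eq.1 hj with hj | rfl
      · exact hq1 j hj
      · rwa [e1]

/-- What the simulating machine does while it simulates one step of the main machine. -/
theorem mainProgram_window (hS : Setting O L M F D x q T₁ T₂ d m)
    (h : Inv O m e s (run M (decOracle L) x t))
    (he : ¬ HaltedAt M (decOracle L) x t → (e + 2).size ≤ m) :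
    ∃ n, 1 ≤ n ∧ n ≤ mainStepTime M F D q T₁ T₂ + 4 ∧
      (HaltedAt M (decOracle L) x t →
        (mainProgram M F D)[((step (mainProgram M F D) O x)^[n] (s.config 0)).pc]? = none) ∧
      (¬ HaltedAt M (decOracle L) x t → ∃ s', ∃ e' ≤ e + 2,
        (step (mainProgram M F D) O x)^[n] (s.config 0) = s'.config 0 ∧
        Inv O m e' s' (run M (decOracle L) x (t + 1))) ∧
      ((M[(run M (decOracle L) x t).pc]? ≠ some .output ∧
          ∀ j < n, Quiet (mainProgram M F D) O d
            ((step (mainProgram M F D) O x)^[j] (s.config 0))) ∨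
        M[(run M (decOracle L) x t).pc]? = some .output ∧ ∃ k < n,
          (mainProgram M F D)[((step (mainProgram M F D) O x)^[k] (s.config 0)).pc]? =
            some .output ∧
          ((step (mainProgram M F D) O x)^[k] (s.config 0)).out =
            (run M (decOracle L) x t).out ∧
          ∀ j < n, j ≠ k → Quiet (mainProgram M F D) O d
            ((step (mainProgram M F D) O x)^[j] (s.config 0))) := by
  obtain ⟨-, -, -, c2, c3, c4⟩ := mainProgram_codeAt (M := M) (F := F) (D := D)
  have hm := hS.bound_main
  rcases hI : M[(run M (decOracle L) x t).pc]? with _ | I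
  · obtain ⟨s', hs', f1, f2⟩ := exec_mainStep_halted (F := F) (D := D) (q := q) (T₁ := T₁)
      (T₂ := T₂) (d := d) h (by omega) hI
    obtain ⟨n, h1, hn, h2, h3⟩ := seg_mainProgram hs'
    rw [f1, f2, if_neg one_ne_zero, if_pos rfl] at h2
    exact ⟨n, h1, by omega, fun _ => by rw [h2]; exact c4, fun hh => absurd hI hh,
      .inl ⟨by simp, h3⟩⟩
  · have hh : ¬ HaltedAt M (decOracle L) x t := by simp [HaltedAt, hI]
    by_cases hout : I = .output
    · subst hout
      obtain ⟨s', hs', f1, f2, ho, -, hi⟩ := exec_mainStep_output hS h hI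
      obtain ⟨n, h1, hn, h2, h3⟩ := seg_mainProgram hs'
      rw [f1, f2, if_neg one_ne_zero, if_neg one_ne_zero] at h2
      have e1 : (step (mainProgram M F D) O x)^[n + 1] (s.config 0) =
          State.config { s' with out := [] } ((mainStep M F D).cost + 3) := by
        rw [Function.iterate_succ_apply', h2, step,
          show (mainProgram M F D)[(s'.config ((mainStep M F D).cost + 2)).pc]? = _ from c2]
        rfl
      have e2 : (step (mainProgram M F D) O x)^[n + 2] (s.config 0) =
          State.config { s' with out := [] } 0 := by
        rw [Function.iterate_succ_apply', e1, step,
          show (mainProgram M F D)[(State.config { s' with out := [] }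
            ((mainStep M F D).cost + 3)).pc]? = _ from c3]
        rfl
      refine ⟨n + 2, by omega, by omega, fun h => absurd h hh,
        fun _ => ⟨_, e, by omega, e2, hi⟩, .inr ⟨rfl, n, by omega, ?_, ?_, ?_⟩⟩
      · rw [h2]; exact c2
      · rw [h2]; exact ho
      · intro j hj hjn
        rcases lt_or_ge j n with hlt | hge
        · exact h3 j hlt
        · obtain rfl : j = n + 1 := by omega
          rw [e1]
          exact quiet_of_ne (I := .jump 0) c3 (by simp) (by simp)
    · obtain ⟨s', hs', f1, e', he', hi⟩ := exec_mainStep hS h (he hh) hI hout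
      obtain ⟨n, h1, hn, h2, h3⟩ := seg_mainProgram hs'
      rw [f1, if_pos rfl] at h2
      exact ⟨n, h1, by omega, fun h => absurd h hh, fun _ => ⟨s', e', he', h2, hi⟩,
        .inl ⟨by simpa using hout, h3⟩⟩

end

/-! ### Windows of the simulating run -/

/-- At time `τ` the machine `P` is about to simulate step `t` of the main machine, or both have
halted. -/
def InStep (O : Oracle) (L : DecProblem) (M P : Program) (x : Word) (m K t τ : ℕ) : Prop :=
  (∃ s, ∃ e ≤ 2 * t, run P O x τ = s.config 0 ∧ Inv O m e s (run M (decOracle L) x t)) ∨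
  (HaltedAt P O x τ ∧ HaltedAt M (decOracle L) x t ∧
    ∀ i, ((run P O x τ).reg i).size ≤ m + K ∧ (run P O x τ).ans.size ≤ m + K)

/-- From time `τ` on, `n` steps of the machine `P` simulate step `t` of the main machine. -/
structure Window (O : Oracle) (L : DecProblem) (M P : Program) (x : Word) (d K t τ n : ℕ) :
    Prop where
  output : ∀ y, OutputsAt M (decOracle L) x t y ↔ ∃ j < n, OutputsAt P O x (τ + j) y
  output_unique : ∀ j < n, ∀ j' < n, ∀ y y', OutputsAt P O x (τ + j) y →
    OutputsAt P O x (τ + j') y' → j = j'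
  query : ∀ j < n, ∀ w, QueriesAt P O x (τ + j) w → w.length ≤ d
  size : ∀ j < n, (∀ i, ((run P O x (τ + j)).reg i).size ≤ K) ∧
    (run P O x (τ + j)).ans.size ≤ K
  halted : HaltedAt M (decOracle L) x t → HaltedAt P O x (τ + n)

theorem run_add {P : Program} {O : Oracle} {x : Word} (τ j : ℕ) :
    run P O x (τ + j) = (step P O x)^[j] (run P O x τ) := by
  rw [run, run, add_comm, Function.iterate_add_apply]

/-- At most two runs of subroutines belong to each step of `M`, so the epoch stays below `2 * t`.
Its size is only needed while `M` has not halted, because only then is a running time bound for `M`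
available. -/
theorem InStep.next {O : Oracle} {x : Word} {d m : ℕ} {L : DecProblem} {M F D : Program}
    {q T₁ T₂ t τ : ℕ} (hS : Setting O L M F D x q T₁ T₂ d m) (hd : d ≤ m)
    (hP : Program.bound (mainProgram M F D) ≤ m)
    (ht : ¬ HaltedAt M (decOracle L) x t → (2 * t + 2).size ≤ m)
    (h : InStep O L M (mainProgram M F D) x m (mainStepTime M F D q T₁ T₂ + 4) t τ) :
    ∃ n, 1 ≤ n ∧ n ≤ mainStepTime M F D q T₁ T₂ + 4 ∧
      InStep O L M (mainProgram M F D) x m (mainStepTime M F D q T₁ T₂ + 4) (t + 1) (τ + n) ∧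
      Window O L M (mainProgram M F D) x d (m + (mainStepTime M F D q T₁ T₂ + 4)) t τ n := by
  rcases h with ⟨s, e, he, hrun, hi⟩ | ⟨h1, h2, h3⟩
  · have hm := hS.bound_main
    obtain ⟨n, hn1, hn, hhalt, hgo, hev⟩ := mainProgram_window hS hi
      (fun hh => size_le_of_le (by omega) (ht hh))
    rw [← hrun] at hhalt hgo hev
    simp only [← run_add] at hhalt hgo hev
    have hquery : ∀ j < n, ∀ w, QueriesAt (mainProgram M F D) O x (τ + j) w → w.length ≤ d ∧
        (O w ((run (mainProgram M F D) O x (τ + j)).asked w)).size ≤ d := by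
      rintro j hj w ⟨hw, rfl⟩
      rcases hev with ⟨-, hq⟩ | ⟨-, k, -, hk, -, hq⟩
      · exact (hq j hj).2 hw
      · refine (hq j hj ?_).2 hw
        rintro rfl
        rw [hk] at hw
        simp at hw
    have hsize : ∀ j ≤ n, (∀ i, ((run (mainProgram M F D) O x (τ + j)).reg i).size ≤ m + j) ∧
        (run (mainProgram M F D) O x (τ + j)).ans.size ≤ m + j := by
      intro j hj
      rw [run_add]
      refine size_iterate_step_le (d := d) ?_ ?_ hP (by omega) hd ?_
      · intro a
        rw [hrun]
        change (s.phys a).size ≤ m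
        by_cases ha : a % 16 = 0
        · simp [State.phys, ha]
        · obtain ⟨r, i, rfl⟩ := eq_addr_of_mod ha
          rw [s.phys_addr]
          exact hi.size r i
      · rw [hrun]; exact hi.size_ans
      · intro l hl hq
        rw [← run_add] at hq ⊢
        exact (hquery l (by omega) _ ⟨hq, rfl⟩).2
    refine ⟨n, hn1, hn, ?_, ?_, ?_, fun j hj w hw => (hquery j hj w hw).1, ?_, hhalt⟩
    · by_cases hh : HaltedAt M (decOracle L) x t
      · refine .inr ⟨hhalt hh, hh.mono (Nat.le_succ t), fun i => ⟨?_, ?_⟩⟩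
        · exact ((hsize n le_rfl).1 i).trans (by omega)
        · exact (hsize n le_rfl).2.trans (by omega)
      · obtain ⟨s', e', he', h1, h2⟩ := hgo hh
        exact .inl ⟨s', e', by omega, h1, h2⟩
    · intro y
      rcases hev with ⟨h1, hq⟩ | ⟨h1, k, hk, hk1, hk2, hq⟩
      · exact ⟨fun h => absurd h.1 h1, fun ⟨j, hj, hy⟩ => absurd hy.1 (hq j hj).1⟩
      · constructor
        · rintro ⟨-, rfl⟩
          exact ⟨k, hk, hk1, hk2⟩
        · rintro ⟨j, hj, hy, rfl⟩
          obtain rfl : j = k := by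
            by_contra hjk
            exact (hq j hj hjk).1 hy
          exact ⟨h1, hk2.symm⟩
    · intro j hj j' hj' y y' hy hy'
      rcases hev with ⟨h1, hq⟩ | ⟨h1, k, hk, hk1, hk2, hq⟩
      · exact absurd hy.1 (hq j hj).1
      · have : j = k := by
          by_contra hjk
          exact (hq j hj hjk).1 hy.1
        have : j' = k := by
          by_contra hjk
          exact (hq j' hj' hjk).1 hy'.1
        omega
    · intro j hj
      exact ⟨fun i => ((hsize j hj.le).1 i).trans (by omega), (hsize j hj.le).2.trans (by omega)⟩
  -- After halting, windows of length `1` in which nothing happens continue the sequence, so that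
  -- every time lies in some window.
  · have hrun1 := h1.run_eq (Nat.le_succ τ)
    have h0 : ∀ y, ¬ OutputsAt (mainProgram M F D) O x τ y := fun y hy => by
      have := hy.1; rw [show (mainProgram M F D)[_]? = none from h1] at this; simp at this
    refine ⟨1, le_rfl, by omega,
      .inr ⟨h1.mono (Nat.le_succ τ), h2.mono (Nat.le_succ t), ?_⟩, ?_, ?_,
      ?_, ?_, fun _ => h1.mono (Nat.le_succ τ)⟩
    · rw [hrun1]; exact h3
    · intro y
      constructor
      · intro hy
        have := hy.1; rw [show M[_]? = none from h2] at this; simp at this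
      · rintro ⟨j, hj, hy⟩
        obtain rfl : j = 0 := by omega
        exact absurd hy (h0 y)
    · intro j hj j' hj' _ _ _ _; omega
    · rintro j hj w ⟨hw, -⟩
      obtain rfl : j = 0 := by omega
      rw [add_zero, show (mainProgram M F D)[_]? = none from h1] at hw
      simp at hw
    · intro j hj
      obtain rfl : j = 0 := by omega
      exact ⟨fun i => (h3 i).1, (h3 0).2⟩


/-! ### The running time of enumerations -/

section
variable {M : Program} {O : Oracle} {x : Word} {S : Set Word} {d t : ℕ}

/-- At most one letter is printed per step, and the printed word is emptied at each output, so its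
length is at most the delay. -/
theorem EnumeratesWithin.length_le (h : EnumeratesWithin M O x S d) {y : Word}
    (hy : OutputsAt M O x t y) : y.length ≤ d := by
  obtain ⟨hI, rfl⟩ := hy
  rcases le_or_gt t d with htd | htd
  · exact length_out_le.trans htd
  -- From this starting time the next event occurs strictly before `t`. As the machine still outputs
  -- at time `t`, it is an output.
  · obtain ⟨u, h1, h2, hu⟩ := h.2.2.1 (t - d - 1)
    rcases hu with hu | ⟨z, hz, -⟩
    · have := hu.mono (show u ≤ t by omega)
      rw [HaltedAt, hI] at this
      simp at this
    · have h3 : (run M O x (u + 1)).out = [] := by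
        rw [run_succ_of_getElem? hz]; rfl
      have h4 := length_out_add_le (M := M) (O := O) (x := x) (t := u + 1) (t - u - 1)
      rw [h3, show u + 1 + (t - u - 1) = t by omega] at h4
      simp only [List.length_nil, zero_add] at h4
      omega

/-- Before halting, each block of `d + 1` consecutive steps contains an output. Outputs at different
times are different words of length at most `d`, and `revCode` embeds these words into the numbers
below `2 ^ (d + 1)`, which bounds the number of blocks. -/
theorem EnumeratesWithin.le_of_not_halted (h : EnumeratesWithin M O x S d)
    (ht : ¬ HaltedAt M O x t) : t + 1 ≤ (2 ^ (d + 1) + 1) * (d + 1) := by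
  have hout : ∀ k : Fin ((t + 1) / (d + 1)), ∃ u y, k * (d + 1) ≤ u ∧ u < (k + 1) * (d + 1) ∧
      OutputsAt M O x u y := by
    intro k
    obtain ⟨u, h1, h2, hu⟩ := h.2.2.1 (k * (d + 1))
    have h3 : ((k : ℕ) + 1) * (d + 1) ≤ t + 1 :=
      (Nat.mul_le_mul_right _ k.2).trans (Nat.div_mul_le_self _ _)
    rw [add_mul, one_mul] at h3
    rcases hu with hu | ⟨y, hy⟩
    · exact absurd (hu.mono (by omega)) ht
    · exact ⟨u, y, h1, by rw [add_mul]; omega, hy⟩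
  choose u y h1 h2 hy using hout
  have hinj : Function.Injective fun k => (⟨revCode (y k), (revCode_lt _).trans_le
      (Nat.pow_le_pow_right (by simp) (Nat.succ_le_succ (h.length_le (hy k))))⟩ :
        Fin (2 ^ (d + 1))) := by
    intro k k' hk
    simp only [Fin.mk.injEq] at hk
    have hyy := revCode_injective hk
    have huu : u k = u k' := h.2.1 _ _ (y k) (hy k) (hyy ▸ hy k')
    have a1 := h1 k
    have a2 := h2 k
    have a3 := h1 k'
    have a4 := h2 k'
    rw [← huu] at a3 a4
    have b1 : (k : ℕ) < k' + 1 := Nat.lt_of_mul_lt_mul_right (a1.trans_lt a4)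
    have b2 : (k' : ℕ) < k + 1 := Nat.lt_of_mul_lt_mul_right (a3.trans_lt a2)
    ext
    omega
  have hcard := Fintype.card_le_of_injective _ hinj
  rw [Fintype.card_fin, Fintype.card_fin] at hcard
  have h4 : t + 1 < ((t + 1) / (d + 1) + 1) * (d + 1) := by
    have h5 := Nat.div_add_mod (t + 1) (d + 1)
    have h6 := Nat.mod_lt (t + 1) (show 0 < d + 1 by omega)
    rw [add_mul, one_mul, mul_comm]
    omega
  exact h4.le.trans (Nat.mul_le_mul_right _ (by omega))

theorem EnumeratesWithin.size_le (h : EnumeratesWithin M O x S d)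
    (ht : ¬ HaltedAt M O x t) : (2 * t + 2).size ≤ 2 * d + 3 := by
  have h1 := h.le_of_not_halted ht
  rw [Nat.size_le]
  have h2 : d + 1 ≤ 2 ^ d := Nat.lt_two_pow_self
  have h3 : 2 ^ (d + 1) + 1 < 2 ^ (d + 2) := by
    rw [pow_succ 2 (d + 1)]
    have : 2 ≤ 2 ^ (d + 1) := by rw [pow_succ]; have := Nat.one_le_two_pow (n := d); omega
    omega
  have h4 : (2 ^ (d + 1) + 1) * (d + 1) < 2 ^ (d + 2) * 2 ^ d :=
    Nat.mul_lt_mul_of_lt_of_le h3 h2 (by positivity)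
  have h5 : 2 ^ (2 * d + 3) = 2 * (2 ^ (d + 2) * 2 ^ d) := by ring
  omega

end

/-! ### The simulating machine enumerates the same problem -/

/-- The memory in the beginning. -/
def startState : State := ⟨fun _ _ => 0, fun _ => none, 0, fun _ => 0, []⟩

theorem startState_config : startState.config 0 = startConfig := by
  simp only [State.config, State.withReg, startState, startConfig, Config.mk.injEq, and_true,
    true_and]
  funext a
  simp [State.phys]

theorem startState_inv (O : Oracle) (m : ℕ) : Inv O m 0 startState startConfig := by
  apply MainRep.inv
  refine ⟨?_, rfl⟩
  constructor <;> simp [startState, startConfig, symbolCode]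

theorem exists_mem_Ico_of_strictMono {τ : ℕ → ℕ} (h0 : τ 0 = 0) (h : ∀ i, τ i < τ (i + 1))
    (t : ℕ) : ∃ i, τ i ≤ t ∧ t < τ (i + 1) := by
  induction t with
  | zero => exact ⟨0, h0.le, by have := h 0; omega⟩
  | succ t ih =>
    obtain ⟨i, h1, h2⟩ := ih
    rcases (Nat.succ_le_of_lt h2).lt_or_eq with hlt | heq
    · exact ⟨i, by omega, hlt⟩
    · exact ⟨i + 1, heq.ge, by rw [show t + 1 = τ (i + 1) from heq]; exact h _⟩

/-- The windows partition the time axis, and window `i` contains an output exactly if step `i` of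
`M` is that output. All properties of the enumeration carry over, with delays stretched by the
maximal window length. -/
theorem mainProgram_enumerates {O : Oracle} {x : Word} {d m : ℕ} {L : DecProblem}
    {M F D : Program} {q T₁ T₂ B : ℕ} {S : Set Word}
    (hM : EnumeratesWithin M (decOracle L) x S q)
    (hS : Setting O L M F D x q T₁ T₂ d m) (hd : d ≤ m)
    (hP : Program.bound (mainProgram M F D) ≤ m)
    (hB : m + (q + 2) * (mainStepTime M F D q T₁ T₂ + 4) ≤ B) :
    EnumeratesWithin (mainProgram M F D) O x S B := by
  have hm := hS.bound_main
  have hnext := fun t τ => InStep.next (t := t) (τ := τ) hS hd hP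
    (fun ht => (hM.size_le ht).trans (by omega))
  generalize mainStepTime M F D q T₁ T₂ + 4 = K at *
  generalize mainProgram M F D = P at *
  have hKB : m + K ≤ B := le_trans (by rw [add_mul]; omega) hB
  have hstart : InStep O L M P x m K 0 0 :=
    .inl ⟨startState, 0, by simp, startState_config.symm, startState_inv O m⟩
  choose g hg1 hg2 hg3 hg4 using hnext
  -- The length of a window depends on the proof that a window begins at `τ`, so starting times and
  -- these proofs are constructed together.
  let f : (t : ℕ) → {τ // InStep O L M P x m K t τ} := fun t =>
    Nat.rec ⟨0, hstart⟩ (fun t p => ⟨p.1 + g t p.1 p.2, hg3 t p.1 p.2⟩) t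
  obtain ⟨τ, h0, hτ⟩ : ∃ τ : ℕ → ℕ, τ 0 = 0 ∧ ∀ t, ∃ n, τ (t + 1) = τ t + n ∧ 1 ≤ n ∧ n ≤ K ∧
      Window O L M P x d (m + K) t (τ t) n :=
    ⟨fun t => (f t).1, rfl, fun t => ⟨_, rfl, hg1 _ _ (f t).2, hg2 _ _ (f t).2, hg4 _ _ (f t).2⟩⟩
  choose n hn hn1 hnK hW using hτ
  have hlt : ∀ t, τ t < τ (t + 1) := fun t => by have := hn t; have := hn1 t; omega
  have hmono : StrictMono τ := strictMono_nat_of_lt_succ hlt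
  have hfind : ∀ t, ∃ i, ∃ j < n i, t = τ i + j := by
    intro t
    obtain ⟨i, h1, h2⟩ := exists_mem_Ico_of_strictMono h0 hlt t
    exact ⟨i, t - τ i, by rw [hn] at h2; omega, by omega⟩
  refine ⟨?_, ?_, ?_, ?_, ?_⟩
  · intro y
    rw [hM.1]
    constructor
    · rintro ⟨i, hi⟩
      obtain ⟨j, -, hj⟩ := ((hW i).output y).1 hi
      exact ⟨_, hj⟩
    · rintro ⟨t, ht⟩
      obtain ⟨i, j, hj, rfl⟩ := hfind t
      exact ⟨i, ((hW i).output y).2 ⟨j, hj, ht⟩⟩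
  · intro t t' y ht ht'
    obtain ⟨i, j, hj, rfl⟩ := hfind t
    obtain ⟨i', j', hj', rfl⟩ := hfind t'
    have h1 := ((hW i).output y).2 ⟨j, hj, ht⟩
    have h2 := ((hW i').output y).2 ⟨j', hj', ht'⟩
    obtain rfl := hM.2.1 _ _ _ h1 h2
    rw [(hW i).output_unique j hj j' hj' y y ht ht']
  · intro t
    obtain ⟨i, j, hj, rfl⟩ := hfind t
    -- The output of window `i` may already be over at the given time, so the next event of `M` is
    -- sought from step `i + 1` on. It has `u ≤ i + 1 + q`, whence at most `q + 2` windows have to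
    -- be passed.
    obtain ⟨u, h1, h2, hu⟩ := hM.2.2.1 (i + 1)
    have hgrow : ∀ k, τ (i + k) ≤ τ i + k * K := by
      intro k
      induction k with
      | zero => simp
      | succ k ih =>
        have := hn (i + k)
        have := hnK (i + k)
        rw [← add_assoc, add_mul]
        omega
    have hup : τ (u + 1) ≤ τ i + (q + 2) * K := by
      have h3 := hgrow (u + 1 - i)
      rw [show i + (u + 1 - i) = u + 1 by omega] at h3
      exact h3.trans (Nat.add_le_add_left (Nat.mul_le_mul_right _ (by omega)) _)
    have hlow : τ i + j ≤ τ u := by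
      have h3 := hmono.monotone h1
      rw [hn] at h3
      omega
    rcases hu with hu | ⟨y, hy⟩
    · refine ⟨τ (u + 1), ?_, by omega, .inl ?_⟩
      · have := hlt u; omega
      · rw [hn]; exact (hW u).halted hu
    · obtain ⟨j', hj', hy'⟩ := ((hW u).output y).1 hy
      refine ⟨τ u + j', by omega, ?_, .inr ⟨y, hy'⟩⟩
      rw [hn] at hup
      omega
  · intro t w hw
    obtain ⟨i, j, hj, rfl⟩ := hfind t
    exact ((hW i).query j hj w hw).trans (by omega)
  · intro t
    obtain ⟨i, j, hj, rfl⟩ := hfind t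
    exact ⟨fun a => (((hW i).size j hj).1 a).trans hKB, ((hW i).size j hj).2.trans hKB⟩

/-! ### Polynomial bounds -/

theorem eval_mono_of_nat (p : Polynomial ℕ) {a b : ℕ} (h : a ≤ b) : p.eval a ≤ p.eval b := by
  rw [Polynomial.eval_eq_sum_range, Polynomial.eval_eq_sum_range]
  gcongr

theorem RegistersBounded.mono {M : Program} {O : Oracle} {x : Word} {d d' : ℕ}
    (h : RegistersBounded M O x d) (hd : d ≤ d') : RegistersBounded M O x d' :=
  fun t => ⟨fun i => ((h t).1 i).trans hd, (h t).2.trans hd⟩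

theorem ComputesWithin.mono {M : Program} {O : Oracle} {x y : Word} {d d' : ℕ}
    (h : ComputesWithin M O x y d) (hd : d ≤ d') : ComputesWithin M O x y d' :=
  ⟨h.1.mono hd, by rw [h.1.run_eq hd]; exact h.2.1, h.2.2.mono hd⟩

theorem DecidesWithin.mono {M : Program} {O : Oracle} {x : Word} {p : Prop} {d d' : ℕ}
    (h : DecidesWithin M O x p d) (hd : d ≤ d') : DecidesWithin M O x p d' :=
  ⟨h.1.mono hd, by rw [h.1.run_eq hd]; exact h.2.1, h.2.2.mono hd⟩

theorem exists_sizeBound (p q r : Polynomial ℕ) (c : ℕ) : ∃ m : Polynomial ℕ, ∀ n,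
    m.eval n = 2 * p.eval n + 3 * q.eval n + 3 * r.eval n + c :=
  ⟨2 * p + 3 * q + 3 * r + (c : Polynomial ℕ), fun n => by simp⟩

theorem exists_subStepTime (b : Bool) (P : Program) (T : Polynomial ℕ) : ∃ s : Polynomial ℕ, ∀ n,
    s.eval n = subStepTime b P (T.eval n) := by
  unfold subStepTime
  generalize Cmd.cost _ = c
  generalize Cmd.cost _ = c'
  exact ⟨2 * (c : Polynomial ℕ) + (T + 2) * (c' : Polynomial ℕ) + 12, fun n => by simp⟩

theorem exists_mainStepTime (M F D : Program) (p q r : Polynomial ℕ) : ∃ s : Polynomial ℕ, ∀ n,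
    s.eval n = mainStepTime M F D (p.eval n) (q.eval n) (r.eval n) := by
  obtain ⟨s₁, h₁⟩ := exists_subStepTime false F q
  obtain ⟨s₂, h₂⟩ := exists_subStepTime true D r
  simp only [mainStepTime, mainQueryTime, ← h₁, ← h₂]
  generalize Cmd.cost _ = c
  generalize Cmd.cost _ = c'
  generalize Cmd.cost _ = c''
  exact ⟨2 * (c : Polynomial ℕ) + (c' + (p + 1) * (c'' : Polynomial ℕ) + (q + 2) * s₁ +
    (r + 2) * s₂), fun n => by simp⟩

/-- If `B` is enumerated with oracle `L`, and `L` reduces to a problem that is decided with an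
oracle for `E`, then `B` reduces to `E`. -/
theorem DReducible.of_polyManyOneReducible {L A : DecProblem} {E B : EnumProblem}
    (hB : B ∈ Del {L}) (hL : PolyManyOneReducible L A) (hE : DecidableInPolyTimeWith A E) :
    DReducible B E := by
  obtain ⟨_, rfl, M, pM, hM⟩ := hB
  obtain ⟨f, ⟨F, pF, hF⟩, hf⟩ := hL
  obtain ⟨D, pD, hD⟩ := hE
  -- Queries of `M` have length at most `pM`, so `T₁` bounds the running time of `F`. It also bounds
  -- the length of the word printed by `F`, so that `T₂` bounds the running time of `D` on that
  -- word.
  let T₁ : Polynomial ℕ := pF.comp pM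
  let T₂ : Polynomial ℕ := pD.comp T₁
  obtain ⟨m, hm⟩ := exists_sizeBound pM T₁ T₂ (7 + Program.bound M + Program.bound F +
    Program.bound D + Program.bound (mainProgram M F D) + 3)
  obtain ⟨K, hK⟩ := exists_mainStepTime M F D pM T₁ T₂
  refine ⟨mainProgram M F D, m + (pM + 2) * (K + 4), fun a ha x => ?_⟩
  replace hm := hm x.length
  replace hK := hK x.length
  refine mainProgram_enumerates (hM x) (T₁ := T₁.eval x.length) (T₂ := T₂.eval x.length)
    (d := T₁.eval x.length + T₂.eval x.length) (m := m.eval x.length) ?_ ?_ ?_ ?_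
  · refine ⟨(hM x).2.2.2.2, (hM x).2.2.2.1, fun w hw => ⟨f w, ?_, ?_⟩, by omega, by omega, by omega,
      by omega, by omega⟩
    · exact (hF w).mono (by simpa [T₁] using eval_mono_of_nat pF hw)
    · have h1 : (f w).length ≤ T₁.eval x.length := by
        have := length_out_le (M := F) (O := noOracle) (x := w) (t := pF.eval w.length)
        rw [(hF w).2.1] at this
        exact this.trans (by simpa [T₁] using eval_mono_of_nat pF hw)
      rw [hf w]
      exact (hD a ha (f w)).mono (by
        have := eval_mono_of_nat pD h1
        rwa [← Polynomial.eval_comp] at this)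
  · omega
  · omega
  · rw [← hK, Polynomial.eval_add, Polynomial.eval_mul]
    simp

end EnumComplexity

theorem mainTheorem11 (k : ℕ) (A : EnumComplexity.DecProblem) (E : EnumComplexity.EnumProblem)
    (hA : EnumComplexity.IsHard (EnumComplexity.SigmaP k) A)
    (hE : EnumComplexity.DecidableInPolyTimeWith A E) :
    EnumComplexity.IsDHard (EnumComplexity.Del (EnumComplexity.SigmaP k)) E := by
  -- Hardness is applied to the single problem `L` whose oracle the enumeration of `B` uses.
  rintro B ⟨L, hL, hB⟩
  exact EnumComplexity.DReducible.of_polyManyOneReducible ⟨L, rfl, hB⟩ (hA L hL) hE
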